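/- Let $\mathbb K$ be an algebraically closed field of characteristic $0$ and let $(\mathcal L,[\cdot,\cdot],\alpha)$ be a multiplicative Hom-Leibniz algebra over $\mathbb K$: $\alpha[x,y]=[\alpha x,\alpha y]$ and $[\alpha x,[y,z]]=[[x,y],\alpha z]-[[x,z],\alpha y]$. Let $C^n=C^n(\mathcal L,\mathcal L)$ be the space of $n$-linear maps $\varphi:\mathcal L^n\to\mathcal L$ with $\alpha\circ\varphi=\varphi\circ\alpha^{\times n}$, with the differential $$\delta\varphi(x_1,\dots,x_{n+1})=[\alpha^{n-1}x_1,\varphi(x_2,\dots,x_{n+1})]+\sum_{i=2}^{n+1}(-1)^i[\varphi(\dots,\widehat{x_i},\dots),\alpha^{n-1}x_i]+\sum_{i<j}(-1)^{j+1}\varphi(\alpha x_1,\dots,\alpha x_{i-1},[x_i,x_j],\alpha x_{i+1},\dots,\widehat{x_j},\dots,\alpha x_{n+1}),$$ and cohomology $H^n(\mathcal L,\mathcal L)$. Assume that $\mathbb H=H^2(\mathcal L,\mathcal L)$ is finite-dimensional. On $C^2$ put $d=-\delta$ and $\nu(\varphi,\chi)=\varphi\circ\chi+\chi\circ\varphi\in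 C^3$, where $(\varphi\circ\chi)(x,y,z)=\varphi(\alpha x,\chi(y,z))-\varphi(\chi(x,y),\alpha z)+\varphi(\chi(x,z),\alpha y)$. Primes denote dual spaces. A deformation of $\mathcal L$ with base a finite-dimensional commutative algebra $A$ with augmentation $\varepsilon$ is an $A$-bilinear bracket on $A\otimes\mathcal L$ that, together with $\mathrm{id}\otimes\alpha$, is a multiplicative Hom-Leibniz structure and for which $\varepsilon\otimes\mathrm{id}:A\otimes\mathcal L\to\mathcal L$ is a morphism. Let $C_1=\mathbb K\oplus\mathbb H'$ with $\mathbb H'^2=0$, fix a linear choice $\mu$ of representing cocycles of the classes in $\mathbb H$, and let $\eta_1$ be the deformation with base $C_1$ given by $[1\otimes x,1\otimes y]=1\otimes[x,y]+\sum_i g_i\otimes\mu(h_i)(x,y)$ for dual bases $(h_i)$ of $\mathbb H$ and $(g_i)$ of $\mathbb H'$. Given $(C_k,\eta_k)$, let $0\to H^2_{Harr}(C_k,\mathbb K)'\to\bar C_{k+1}\to C_k\to0$ be the extension of $C_k$ whose Harrison cocycle is dual to a linear choice of cocycles representing the classes of $H^2_{Harr}(C_k,\mathbb K)$. Lift the bracket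 of $\eta_k$ to a $\bar C_{k+1}$-bilinear operation $\{\cdot,\cdot\}$ on $\bar C_{k+1}\otimes\mathcal L$ commuting with $\mathrm{id}\otimes\alpha$. The expression $\{\alpha x,\{y,z\}\}-\{\{x,y\},\alpha z\}+\{\{x,z\},\alpha y\}$, for $x,y,z\in 1\otimes\mathcal L$ (with $\alpha$ standing for $\mathrm{id}\otimes\alpha$), lies in $H^2_{Harr}(C_k,\mathbb K)'\otimes\mathcal L$ and its components are $3$-cocycles; their classes form the obstruction map $w_k:H^2_{Harr}(C_k,\mathbb K)\to H^3(\mathcal L,\mathcal L)$. Put $C_{k+1}=\bar C_{k+1}/w_k'(H^3(\mathcal L,\mathcal L)')$ and let $\eta_{k+1}$ be any deformation with base $C_{k+1}$ whose push-out to $C_k$ is $\eta_k$. Let $\mathfrak m_k,\bar{\mathfrak m}_{k+1}$ be the augmentation ideals of $C_k,\bar C_{k+1}$, let $F=\bar{\mathfrak m}_{k+1}'$ be the coalgebra whose comultiplication $\Delta$ is dual to the multiplication of $\bar{\mathfrak m}_{k+1}$, and let $F_1=\mathfrak m_k'\subset F$ and $F_0=(\mathfrak m_k/\mathfrak m_k^2)'\subset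 F_1$. For a constant $c$ and a linear map $a:F_0\to\mathbb H$ let $[a]_F^{(c)}$ be the set of all linear maps $b:F/F_1\to H^3(\mathcal L,\mathcal L)$ for which there is a linear map $\psi:F_1\to C^2$ with $$d\psi=c\,\nu\circ(\psi\otimes\psi)\circ\Delta\quad\text{on }F_1,$$ such that $\psi(x)$ is a cocycle of class $a(x)$ for all $x\in F_0$, and $\nu\circ(\psi\otimes\psi)\circ\Delta(x)$ is a cocycle of class $b(x+F_1)$ for all $x\in F$. The Massey $F$-bracket is $[a]_F=[a]_F^{(1/2)}$. **Theorem.** For all $C_k$, $\eta_k$ ($k\ge1$) obtained in this way, the canonical maps $\mathbb H\to F_0$ and $H^2_{Harr}(C_k,\mathbb K)\to F/F_1$ are isomorphisms, the obstruction map $w_k$ is well defined, and under these identifications: 1. $2w_k\in[\mathrm{id}]_F$; 2. conversely, every element of $[\mathrm{id}]_F$ equals $2w_k$, where $w_k$ is the obstruction map of a suitable deformation $\eta_k$ with base $C_k$ that extends $\eta_1$ (that is, the push-out of $\eta_k$ along $C_k\to C_1$ is $\eta_1$). Equivalently, in the normalization $d\psi=\nu\circ(\psi\otimes\psi)\circ\Delta$: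 $\tfrac12w_k\in[\tfrac12\mathrm{id}]_F^{(1)}$, and every element of $[\tfrac12\mathrm{id}]_F^{(1)}$ equals $\tfrac12w_k$ for a suitable such extension of $\eta_1$. -/

import Mathlib

open scoped TensorProduct

universe u v w x

noncomputable section

/-! ### Multiplicative Hom-Leibniz algebras and their cohomology -/

/-- A multiplicative (right) Hom-Leibniz algebra structure on the `K`-module `L`. -/
structure HomLeibniz (K : Type u) (L : Type v) [Field K] [AddCommGroup L] [Module K L] where
  br : L →ₗ[K] L →ₗ[K] L
  α : L →ₗ[K] L
  hom_jacobi : ∀ x y z, br (α x) (br y z) = br (br x y) (α z) - br (br x z) (α y)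
  α_br : ∀ x y, α (br x y) = br (α x) (α y)

namespace HomLeibniz

variable {K : Type u} {L : Type v} [Field K] [AddCommGroup L] [Module K L]
variable (𝓛 : HomLeibniz K L)

/-- `C^n(L, L)`: the `n`-linear maps `φ : L^n → L` with `α ∘ φ = φ ∘ α^{× n}`. -/
def cochains (n : ℕ) : Submodule K ((Fin n → L) → L) where
  carrier := {φ | (∃ m : MultilinearMap K (fun _ : Fin n => L) L, ⇑m = φ) ∧
    ∀ x : Fin n → L, 𝓛.α (φ x) = φ (fun i => 𝓛.α (x i))}
  zero_mem' := ⟨⟨0, rfl⟩, fun x => by simp⟩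
  add_mem' := by
    rintro φ χ ⟨⟨m, rfl⟩, hφ⟩ ⟨⟨m', rfl⟩, hχ⟩
    exact ⟨⟨m + m', rfl⟩, fun x => by simp [hφ, hχ]⟩
  smul_mem' := by
    rintro c φ ⟨⟨m, rfl⟩, hφ⟩
    exact ⟨⟨c • m, rfl⟩, fun x => by simp [hφ]⟩

/-- The differential `δ^n` (for `n ≥ 1`). The arguments are numbered from `0` here, so the sign
`(-1)^i` of the argument in place `i.succ` is the sign `(-1)^(i+2)` of the usual numbering, and
likewise `(-1)^j` stands for `(-1)^(j+2)`. In the last sum `[x_i, x_j]` is put in place `i`, the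
map `α` is applied to all other arguments, and the argument in place `j` is omitted. -/
def δ (n : ℕ) : ((Fin n → L) → L) →ₗ[K] ((Fin (n + 1) → L) → L) where
  toFun φ x :=
    𝓛.br ((𝓛.α ^ (n - 1)) (x 0)) (φ (fun k => x k.succ))
    + ∑ i : Fin n, (-1 : K) ^ (i : ℕ) •
        𝓛.br (φ (fun k => x (i.succ.succAbove k))) ((𝓛.α ^ (n - 1)) (x i.succ))
    + ∑ i : Fin (n + 1), ∑ j : Fin (n + 1), if i < j then
        (-1 : K) ^ (j : ℕ) •
          φ (fun k => Function.update (fun m => 𝓛.α (x m)) i (𝓛.br (x i) (x j)) (j.succAbove k))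
        else 0
  map_add' φ χ := by
    funext x
    simp only [Pi.add_apply, map_add, LinearMap.add_apply, smul_add, ite_add_zero,
      Finset.sum_add_distrib]
    abel
  map_smul' c φ := by
    funext x
    simp only [Pi.smul_apply, map_smul, LinearMap.smul_apply, RingHom.id_apply, smul_add,
      Finset.smul_sum, smul_ite, smul_zero, smul_comm c]

/-- The `n`-cocycles. -/
def Z (n : ℕ) : Submodule K ((Fin n → L) → L) := 𝓛.cochains n ⊓ LinearMap.ker (𝓛.δ n)

/-- The `n`-coboundaries. -/
def B : (n : ℕ) → Submodule K ((Fin n → L) → L)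
  | 0 => ⊥
  | n + 1 => (𝓛.cochains n).map (𝓛.δ n)

/-- The cohomology `H^n(L, L)`. -/
abbrev H (n : ℕ) : Type v := ↥(𝓛.Z n) ⧸ (𝓛.B n).submoduleOf (𝓛.Z n)

/-- `φ` is a cocycle and `c` is its cohomology class. -/
def Represents {n : ℕ} (φ : (Fin n → L) → L) (c : 𝓛.H n) : Prop :=
  ∃ h : φ ∈ 𝓛.Z n, Submodule.Quotient.mk (⟨φ, h⟩ : 𝓛.Z n) = c

/-- The differential `d φ = (-1)^{|φ|} δ φ`, `|φ| = n - 1`, of the differential graded Lie algebra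
`C^*(L, L)`, on cochains of degree one, that is on `C^2(L, L)`. -/
def d : 𝓛.cochains 2 →ₗ[K] ((Fin 3 → L) → L) := -(𝓛.δ 2 ∘ₗ (𝓛.cochains 2).subtype)

theorem cochain_snd_add (φ : 𝓛.cochains 2) (x y y' : L) :
    φ.1 ![x, y + y'] = φ.1 ![x, y] + φ.1 ![x, y'] := by
  obtain ⟨_, ⟨⟨m, rfl⟩, _⟩⟩ := φ
  have h : ∀ z, Function.update ![x, y] 1 z = ![x, z] := fun z => by
    funext i; fin_cases i <;> rfl
  have := m.map_update_add ![x, y] 1 y y'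
  simp only [h] at this
  exact this

theorem cochain_snd_smul (φ : 𝓛.cochains 2) (c : K) (x y : L) :
    φ.1 ![x, c • y] = c • φ.1 ![x, y] := by
  obtain ⟨_, ⟨⟨m, rfl⟩, _⟩⟩ := φ
  have h : ∀ z, Function.update ![x, y] 1 z = ![x, z] := fun z => by
    funext i; fin_cases i <;> rfl
  have := m.map_update_smul ![x, y] 1 c y
  simp only [h] at this
  exact this

theorem cochain_fst_add (φ : 𝓛.cochains 2) (x x' y : L) :
    φ.1 ![x + x', y] = φ.1 ![x, y] + φ.1 ![x', y] := by
  obtain ⟨_, ⟨⟨m, rfl⟩, _⟩⟩ := φ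
  have h : ∀ z, Function.update ![x, y] 0 z = ![z, y] := fun z => by
    funext i; fin_cases i <;> rfl
  have := m.map_update_add ![x, y] 0 x x'
  simp only [h] at this
  exact this

theorem cochain_fst_smul (φ : 𝓛.cochains 2) (c : K) (x y : L) :
    φ.1 ![c • x, y] = c • φ.1 ![x, y] := by
  obtain ⟨_, ⟨⟨m, rfl⟩, _⟩⟩ := φ
  have h : ∀ z, Function.update ![x, y] 0 z = ![z, y] := fun z => by
    funext i; fin_cases i <;> rfl
  have := m.map_update_smul ![x, y] 0 c x
  simp only [h] at this
  exact this

/-- The circle product of two `2`-cochains. -/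
def circ : 𝓛.cochains 2 →ₗ[K] 𝓛.cochains 2 →ₗ[K] ((Fin 3 → L) → L) :=
  LinearMap.mk₂ K
    (fun φ χ x =>
      φ.1 ![𝓛.α (x 0), χ.1 ![x 1, x 2]] - φ.1 ![χ.1 ![x 0, x 1], 𝓛.α (x 2)]
        + φ.1 ![χ.1 ![x 0, x 2], 𝓛.α (x 1)])
    (fun φ φ' χ => by funext x; simp; abel)
    (fun c φ χ => by funext x; simp [smul_sub])
    (fun φ χ χ' => by
      funext x
      simp [cochain_fst_add, cochain_snd_add]
      abel)
    (fun c φ χ => by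
      funext x
      simp [cochain_fst_smul, cochain_snd_smul, smul_sub])

/-- The graded Lie bracket `ν` of the differential graded Lie algebra `C^*(L, L)` on elements of
degree one: `ν(φ, χ) = φ ∘ χ - (-1)^{|φ||χ|} χ ∘ φ = φ ∘ χ + χ ∘ φ`. -/
def ν : 𝓛.cochains 2 →ₗ[K] 𝓛.cochains 2 →ₗ[K] ((Fin 3 → L) → L) := 𝓛.circ + 𝓛.circ.flip

end HomLeibniz

/-! ### Massey `F`-brackets -/

/-- A cocommutative coassociative coalgebra `F` (without counit, placed in degree zero) with a
filtration `F₀ ⊆ F₁ ⊆ F` such that `F₀ ⊆ ker Δ` and `im Δ ⊆ F₁ ⊗ F₁`. -/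
structure FilteredCoalgebra (K : Type u) (F : Type w) [Field K] [AddCommGroup F] [Module K F] where
  Δ : F →ₗ[K] F ⊗[K] F
  cocomm : ∀ x, TensorProduct.comm K F F (Δ x) = Δ x
  coassoc : ∀ x, TensorProduct.assoc K F F F (Δ.rTensor F (Δ x)) = Δ.lTensor F (Δ x)
  F₀ : Submodule K F
  F₁ : Submodule K F
  F₀_le : F₀ ≤ F₁
  F₀_le_ker : F₀ ≤ LinearMap.ker Δ
  range_le : LinearMap.range Δ ≤ LinearMap.range (TensorProduct.map F₁.subtype F₁.subtype)

namespace FilteredCoalgebra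

variable {K : Type u} {F : Type w} [Field K] [AddCommGroup F] [Module K F]
variable (Φ : FilteredCoalgebra K F)

theorem map_subtype_injective :
    Function.Injective (TensorProduct.map Φ.F₁.subtype Φ.F₁.subtype) :=
  TensorProduct.map_injective_of_flat_flat _ _ Φ.F₁.injective_subtype Φ.F₁.injective_subtype

/-- The comultiplication, with values in `F₁ ⊗ F₁`. -/
def Δ₁ : F →ₗ[K] Φ.F₁ ⊗[K] Φ.F₁ :=
  (LinearEquiv.ofInjective _ Φ.map_subtype_injective).symm.toLinearMap ∘ₗ
    Submodule.inclusion Φ.range_le ∘ₗ Φ.Δ.rangeRestrict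

theorem map_Δ₁ (x : F) : TensorProduct.map Φ.F₁.subtype Φ.F₁.subtype (Φ.Δ₁ x) = Φ.Δ x := by
  have := LinearEquiv.ofInjective_apply (TensorProduct.map Φ.F₁.subtype Φ.F₁.subtype)
    (h := Φ.map_subtype_injective) (Φ.Δ₁ x)
  rw [← this]
  simp [Δ₁]

variable {L : Type v} [AddCommGroup L] [Module K L]

/-- The Massey `F`-bracket `[a]_F` of `a : F₀ → H^2(L, L)` in `C^*(L, L)`, for the defining
equation `d ψ = c · ν ∘ (ψ ⊗ ψ) ∘ Δ` on `F₁`: the set of all `b : F / F₁ → H^3(L, L)` for which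
there is a solution `ψ` such that `ψ` induces `a` on `F₀` and `ν ∘ (ψ ⊗ ψ) ∘ Δ` induces `b`. -/
def massey (c : K) (𝓛 : HomLeibniz K L) (a : Φ.F₀ →ₗ[K] 𝓛.H 2) : Set (F ⧸ Φ.F₁ →ₗ[K] 𝓛.H 3) :=
  {b | ∃ ψ : Φ.F₁ →ₗ[K] 𝓛.cochains 2,
    (∀ x : Φ.F₁, 𝓛.d (ψ x) =
      c • TensorProduct.lift 𝓛.ν (TensorProduct.map ψ ψ (Φ.Δ₁ (x : F)))) ∧
    (∀ x : Φ.F₀, 𝓛.Represents (ψ (Submodule.inclusion Φ.F₀_le x)).1 (a x)) ∧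
    (∀ x : F, 𝓛.Represents (TensorProduct.lift 𝓛.ν (TensorProduct.map ψ ψ (Φ.Δ₁ x)))
      (b (Submodule.Quotient.mk x)))}

end FilteredCoalgebra

/-! ### Augmented algebras, Harrison cohomology and extensions -/

/-- A finite-dimensional commutative unital `K`-algebra with an augmentation. -/
structure AugAlg (K : Type u) [Field K] where
  carrier : Type w
  [commRing : CommRing carrier]
  [algebra : Algebra K carrier]
  [finite : FiniteDimensional K carrier]
  ε : carrier →ₐ[K] K

namespace AugAlg

attribute [instance] AugAlg.commRing AugAlg.algebra AugAlg.finite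

variable {K : Type u} [Field K]

instance : CoeSort (AugAlg.{u, w} K) (Type w) := ⟨AugAlg.carrier⟩

variable (A : AugAlg.{u, w} K)

/-- The augmentation ideal `𝔪 = ker ε`, as a `K`-space. -/
abbrev 𝔪 : Submodule K A := LinearMap.ker A.ε.toLinearMap

/-- The multiplication `𝔪 × 𝔪 → 𝔪`. -/
def mulM : A.𝔪 →ₗ[K] A.𝔪 →ₗ[K] A.𝔪 :=
  LinearMap.mk₂ K (fun x y => ⟨x.1 * y.1, by
    have := x.2
    simp_all only [LinearMap.mem_ker, AlgHom.toLinearMap_apply, map_mul, zero_mul]⟩)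
    (fun _ _ _ => by ext; simp [add_mul]) (fun _ _ _ => by ext; simp)
    (fun _ _ _ => by ext; simp [mul_add]) (fun _ _ _ => by ext; simp)

/-- The comultiplication `𝔪' → 𝔪' ⊗ 𝔪'` dual to the multiplication `𝔪 ⊗ 𝔪 → 𝔪`. -/
def Δ : Module.Dual K A.𝔪 →ₗ[K] Module.Dual K A.𝔪 ⊗[K] Module.Dual K A.𝔪 :=
  (TensorProduct.dualDistribEquiv K A.𝔪 A.𝔪).symm.toLinearMap ∘ₗ
    (TensorProduct.lift A.mulM).dualMap

section Harrison

variable (M : Type*) [AddCommGroup M] [Module K M]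

/-- Harrison `2`-cocycles of `A` with values in the space `M`, on which `A` acts through the
augmentation: the Hochschild `2`-cocycles that vanish on the shuffles `a ⊗ b - b ⊗ a`. -/
def harrZ : Submodule K (A → A → M) where
  carrier := {f | (∃ g : A →ₗ[K] A →ₗ[K] M, ∀ a b, g a b = f a b) ∧ (∀ a b, f a b = f b a) ∧
    ∀ a b c, A.ε a • f b c - f (a * b) c + f a (b * c) - A.ε c • f a b = 0}
  zero_mem' := ⟨⟨0, fun _ _ => rfl⟩, fun _ _ => rfl, fun _ _ _ => by simp⟩
  add_mem' := by
    rintro f g ⟨⟨f', hf₀⟩, hf, hf'⟩ ⟨⟨g', hg₀⟩, hg, hg'⟩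
    refine ⟨⟨f' + g', fun a b => by simp [hf₀, hg₀]⟩,
      fun a b => by simp [hf a b, hg a b], fun a b c => ?_⟩
    have := congrArg₂ (· + ·) (hf' a b c) (hg' a b c)
    simp only [add_zero] at this
    rw [← this]
    simp only [Pi.add_apply, smul_add]
    abel
  smul_mem' := by
    rintro r f ⟨⟨f', hf₀⟩, hf, hf'⟩
    refine ⟨⟨r • f', fun a b => by simp [hf₀]⟩, fun a b => by simp [hf a b], fun a b c => ?_⟩
    have := congrArg (r • ·) (hf' a b c)
    simpa [smul_add, smul_sub, smul_comm r] using this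

/-- The Harrison coboundary of a linear map `g : A → M`. -/
def harrD : (A →ₗ[K] M) →ₗ[K] (A → A → M) where
  toFun g a b := A.ε a • g b - g (a * b) + A.ε b • g a
  map_add' g h := by
    funext a b
    simp
    abel
  map_smul' c g := by
    funext a b
    simp [smul_sub, smul_comm _ c]

/-- The second Harrison cohomology `H^2_Harr(A, M)`. -/
abbrev harrH := ↥(A.harrZ M) ⧸ (LinearMap.range (A.harrD M)).submoduleOf (A.harrZ M)

instance [FiniteDimensional K M] : FiniteDimensional K (A.harrZ M) := by
  let e : (A →ₗ[K] A →ₗ[K] M) →ₗ[K] (A → A → M) :=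
    { toFun := fun g a b => g a b, map_add' := fun _ _ => rfl, map_smul' := fun _ _ => rfl }
  have : A.harrZ M ≤ LinearMap.range e := by
    rintro f ⟨⟨g, hg⟩, -⟩
    exact ⟨g, funext fun a => funext fun b => hg a b⟩
  exact Submodule.finiteDimensional_of_le this

end Harrison

/-- The extension `0 → M → Ext f → A → 0` of `A` by the space `M` (on which `A` acts through the
augmentation) defined by the Harrison cocycle `f`: the space of pairs `(a, m)` with the
multiplication `(a, m) (b, n) = (a b, ε(a) n + ε(b) m + f(a, b))`. -/
@[ext]
structure Ext {M : Type x} [AddCommGroup M] [Module K M] (f : A.harrZ M) : Type (max w x) where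
  base : A.carrier
  fib : M

namespace Ext

variable {A} {M : Type x} [AddCommGroup M] [Module K M] (f : A.harrZ M)

/-- The underlying space of `Ext f` is `A × M`. -/
def equivProd : A.Ext f ≃ A × M where
  toFun e := (e.base, e.fib)
  invFun e := ⟨e.1, e.2⟩
  left_inv _ := rfl
  right_inv _ := rfl

instance : AddCommGroup (A.Ext f) := (equivProd f).addCommGroup
instance : Module K (A.Ext f) := (equivProd f).module K

/-- The underlying space of `Ext f` is `A × M`. -/
def linearEquivProd : A.Ext f ≃ₗ[K] A × M := (equivProd f).linearEquiv K

instance [FiniteDimensional K M] : FiniteDimensional K (A.Ext f) :=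
  Module.Finite.equiv (linearEquivProd f).symm

theorem comm (a b : A) : f.1 a b = f.1 b a := f.2.2.1 a b

theorem add_left (a a' b : A) : f.1 (a + a') b = f.1 a b + f.1 a' b := by
  obtain ⟨g, hg⟩ := f.2.1
  simp [← hg]

theorem smul_left (c : K) (a b : A) : f.1 (c • a) b = c • f.1 a b := by
  obtain ⟨g, hg⟩ := f.2.1
  simp [← hg]

theorem add_right (a b b' : A) : f.1 a (b + b') = f.1 a b + f.1 a b' := by
  rw [comm, add_left, comm f b, comm f b']

theorem smul_right (c : K) (a b : A) : f.1 a (c • b) = c • f.1 a b := by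
  rw [comm, smul_left, comm f b]

theorem zero_left (b : A) : f.1 0 b = 0 := by
  simpa using smul_left f 0 0 b

theorem zero_right (a : A) : f.1 a 0 = 0 := by
  simpa using smul_right f 0 a 0

theorem cocycle (a b c : A) :
    A.ε a • f.1 b c + f.1 a (b * c) = f.1 (a * b) c + A.ε c • f.1 a b := by
  have := f.2.2.2 a b c
  rw [sub_add_eq_add_sub, sub_sub, sub_eq_zero] at this
  exact this

theorem one_left (c : A) : f.1 1 c = A.ε c • f.1 1 1 := by
  have := cocycle f 1 1 c
  simp only [map_one, one_smul, one_mul] at this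
  simpa using this

instance : Mul (A.Ext f) :=
  ⟨fun e e' => ⟨e.base * e'.base, A.ε e.base • e'.fib + A.ε e'.base • e.fib + f.1 e.base e'.base⟩⟩

instance : One (A.Ext f) := ⟨⟨1, -f.1 1 1⟩⟩

variable {f}

@[simp] theorem mul_base (e e' : A.Ext f) : (e * e').base = e.base * e'.base := rfl
@[simp] theorem mul_fib (e e' : A.Ext f) :
    (e * e').fib = A.ε e.base • e'.fib + A.ε e'.base • e.fib + f.1 e.base e'.base := rfl
@[simp] theorem one_base : (1 : A.Ext f).base = 1 := rfl
@[simp] theorem one_fib : (1 : A.Ext f).fib = -f.1 1 1 := rfl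
@[simp] theorem add_base (e e' : A.Ext f) : (e + e').base = e.base + e'.base := rfl
@[simp] theorem add_fib (e e' : A.Ext f) : (e + e').fib = e.fib + e'.fib := rfl
@[simp] theorem zero_base : (0 : A.Ext f).base = 0 := rfl
@[simp] theorem zero_fib : (0 : A.Ext f).fib = 0 := rfl
@[simp] theorem smul_base (c : K) (e : A.Ext f) : (c • e).base = c • e.base := rfl
@[simp] theorem smul_fib (c : K) (e : A.Ext f) : (c • e).fib = c • e.fib := rfl

protected theorem mul_comm' (e e' : A.Ext f) : e * e' = e' * e := by
  ext
  · simp [mul_comm]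
  · simp [comm f e.base e'.base, add_comm]

protected theorem one_mul' (e : A.Ext f) : 1 * e = e := by
  ext
  · simp
  · simp only [mul_fib, one_base, one_fib, one_left f e.base, map_one, one_smul, smul_neg,
      neg_add_cancel_right]

protected theorem add_mul' (e e' e'' : A.Ext f) : (e + e') * e'' = e * e'' + e' * e'' := by
  ext
  · simp [add_mul]
  · simp only [mul_fib, add_base, add_fib, map_add, add_left, add_smul, smul_add]
    abel

protected theorem mul_assoc' (e e' e'' : A.Ext f) : e * e' * e'' = e * (e' * e'') := by
  ext
  · simp [mul_assoc]
  · simp only [mul_fib, mul_base, map_mul, smul_add, mul_smul]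
    have := cocycle f e.base e'.base e''.base
    rw [smul_comm (A.ε e''.base) (A.ε e.base), smul_comm (A.ε e''.base) (A.ε e'.base)]
    calc _ = A.ε e.base • A.ε e'.base • e''.fib + A.ε e.base • A.ε e''.base • e'.fib
          + A.ε e'.base • A.ε e''.base • e.fib
          + (f.1 (e.base * e'.base) e''.base + A.ε e''.base • f.1 e.base e'.base) := by abel
      _ = _ := by rw [← this]; abel

instance : CommRing (A.Ext f) :=
  { (inferInstance : AddCommGroup (A.Ext f)), (inferInstance : Mul (A.Ext f)),
    (inferInstance : One (A.Ext f)) with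
    mul_assoc := Ext.mul_assoc'
    mul_comm := Ext.mul_comm'
    one_mul := Ext.one_mul'
    mul_one := fun e => by rw [Ext.mul_comm', Ext.one_mul']
    left_distrib := fun e e' e'' => by
      rw [Ext.mul_comm' e, Ext.add_mul', Ext.mul_comm' e', Ext.mul_comm' e'']
    right_distrib := Ext.add_mul'
    zero_mul := fun e => by ext <;> simp [zero_left]
    mul_zero := fun e => by ext <;> simp [zero_right] }

protected theorem smul_mul' (c : K) (e e' : A.Ext f) : c • e * e' = c • (e * e') := by
  ext
  · simp
  · simp [mul_smul, smul_comm _ c, smul_left]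

instance : Algebra K (A.Ext f) :=
  Algebra.ofModule Ext.smul_mul'
    (fun c e e' => by rw [mul_comm, Ext.smul_mul', mul_comm])

variable (f)

/-- The projection `p : Ext f → A`. -/
def fst : A.Ext f →ₐ[K] A :=
  AlgHom.ofLinearMap
    { toFun := base, map_add' := fun _ _ => rfl, map_smul' := fun _ _ => rfl } rfl (fun _ _ => rfl)

/-- The linear map `Ext f → M`, `(a, m) ↦ m`. -/
def snd : A.Ext f →ₗ[K] M :=
  { toFun := fib, map_add' := fun _ _ => rfl, map_smul' := fun _ _ => rfl }

/-- The inclusion `i : M → Ext f`. -/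
def inr : M →ₗ[K] A.Ext f where
  toFun m := ⟨0, m⟩
  map_add' m n := by ext <;> simp
  map_smul' c m := by ext <;> simp

end Ext

/-- The extension `Ext f` with the augmentation `ε ∘ p`. -/
def extAlg {M : Type x} [AddCommGroup M] [Module K M] [FiniteDimensional K M] (f : A.harrZ M) :
    AugAlg.{u, max w x} K where
  carrier := A.Ext f
  ε := A.ε.comp (Ext.fst f)

/-- The algebra map `φ : A → B` with `ε_B ∘ φ = ε_A`, restricted to the augmentation ideals. -/
def mapM {A : AugAlg.{u, w} K} {B : AugAlg.{u, x} K} (φ : A →ₐ[K] B) (hφ : B.ε.comp φ = A.ε) :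
    A.𝔪 →ₗ[K] B.𝔪 :=
  φ.toLinearMap.restrict fun a ha => by
    have h := DFunLike.congr_fun hφ a
    exact LinearMap.mem_ker.2 (h.trans (LinearMap.mem_ker.1 ha))

/-! The coalgebra dual to the augmentation ideal. -/

theorem dualDistrib_Δ (ξ : Module.Dual K A.𝔪) (x y : A.𝔪) :
    TensorProduct.dualDistrib K A.𝔪 A.𝔪 (A.Δ ξ) (x ⊗ₜ y) = ξ (A.mulM x y) := by
  have : TensorProduct.dualDistrib K A.𝔪 A.𝔪 (A.Δ ξ) = (TensorProduct.lift A.mulM).dualMap ξ :=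
    (TensorProduct.dualDistribEquiv K A.𝔪 A.𝔪).apply_symm_apply _
  rw [this]
  simp

theorem dualDistrib_injective (V W : Type*) [AddCommGroup V] [Module K V] [AddCommGroup W]
    [Module K W] [FiniteDimensional K V] [FiniteDimensional K W] :
    Function.Injective (TensorProduct.dualDistrib K V W) :=
  (TensorProduct.dualDistribEquiv K V W).injective

theorem Δ_cocomm (ξ : Module.Dual K A.𝔪) : TensorProduct.comm K _ _ (A.Δ ξ) = A.Δ ξ := by
  apply dualDistrib_injective
  have key : ∀ (t : Module.Dual K A.𝔪 ⊗[K] Module.Dual K A.𝔪) (x y : A.𝔪),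
      TensorProduct.dualDistrib K A.𝔪 A.𝔪 (TensorProduct.comm K _ _ t) (x ⊗ₜ y)
        = TensorProduct.dualDistrib K A.𝔪 A.𝔪 t (y ⊗ₜ x) := by
    intro t x y
    induction t with
    | zero => simp
    | tmul f g => simp [mul_comm]
    | add a b ha hb => simp only [map_add, LinearMap.add_apply, ha, hb]
  ext x y
  simp only [TensorProduct.AlgebraTensorModule.curry_apply, LinearMap.restrictScalars_self,
    TensorProduct.curry_apply]
  rw [key, dualDistrib_Δ, dualDistrib_Δ]
  congr 1
  ext
  exact mul_comm _ _

theorem Δ_coassoc (ξ : Module.Dual K A.𝔪) :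
    TensorProduct.assoc K _ _ _ (A.Δ.rTensor _ (A.Δ ξ)) = A.Δ.lTensor _ (A.Δ ξ) := by
  let D := Module.Dual K A.𝔪
  let E : D ⊗[K] (D ⊗[K] D) →ₗ[K] Module.Dual K (A.𝔪 ⊗[K] (A.𝔪 ⊗[K] A.𝔪)) :=
    TensorProduct.dualDistrib K A.𝔪 (A.𝔪 ⊗[K] A.𝔪) ∘ₗ
      (TensorProduct.dualDistrib K A.𝔪 A.𝔪).lTensor D
  have hE : Function.Injective E :=
    (dualDistrib_injective _ _).comp
      (Module.Flat.lTensor_preserves_injective_linearMap _ (dualDistrib_injective _ _))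
  have key : ∀ (t : D ⊗[K] D) (x y z : A.𝔪), E (A.Δ.lTensor _ t) (x ⊗ₜ (y ⊗ₜ z))
      = TensorProduct.dualDistrib K A.𝔪 A.𝔪 t (x ⊗ₜ A.mulM y z) := by
    intro t x y z
    induction t with
    | zero => simp
    | tmul f g =>
      change f x * TensorProduct.dualDistrib K A.𝔪 A.𝔪 (A.Δ g) (y ⊗ₜ z) = f x * g (A.mulM y z)
      rw [dualDistrib_Δ]
    | add a b ha hb => simp only [map_add, LinearMap.add_apply, ha, hb]
  have key₁ : ∀ (t : D ⊗[K] D) (g : D) (x y z : A.𝔪),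
      E (TensorProduct.assoc K _ _ _ (t ⊗ₜ g)) (x ⊗ₜ (y ⊗ₜ z))
      = TensorProduct.dualDistrib K A.𝔪 A.𝔪 t (x ⊗ₜ y) * g z := by
    intro t g x y z
    induction t with
    | zero => simp
    | tmul f h => exact (mul_assoc (f x) (h y) (g z)).symm
    | add a b ha hb => simp only [TensorProduct.add_tmul, map_add, LinearMap.add_apply, ha, hb,
        add_mul]
  have key₂ : ∀ (t : D ⊗[K] D) (x y z : A.𝔪),
      E (TensorProduct.assoc K _ _ _ (A.Δ.rTensor _ t)) (x ⊗ₜ (y ⊗ₜ z))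
      = TensorProduct.dualDistrib K A.𝔪 A.𝔪 t (A.mulM x y ⊗ₜ z) := by
    intro t x y z
    induction t with
    | zero => simp
    | tmul f g =>
      rw [LinearMap.rTensor_tmul, key₁, dualDistrib_Δ]
      rfl
    | add a b ha hb => simp only [map_add, LinearMap.add_apply, ha, hb]
  apply hE
  ext x y z
  simp only [TensorProduct.AlgebraTensorModule.curry_apply, LinearMap.restrictScalars_self,
    TensorProduct.curry_apply]
  rw [key₂, key, dualDistrib_Δ, dualDistrib_Δ]
  congr 1
  ext
  exact mul_assoc _ _ _

section Filtration

variable {A} {M : Type x} [AddCommGroup M] [Module K M] [FiniteDimensional K M] (f : A.harrZ M)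

/-- The projection of augmentation ideals `𝔪_B → 𝔪_A` of the extension `B` of `A` given by `f`. -/
def projM : (A.extAlg f).𝔪 →ₗ[K] A.𝔪 := mapM (A := A.extAlg f) (Ext.fst f) rfl

/-- The product in `B` of (arbitrary preimages of) two elements of `𝔪_A`. -/
def liftMul : A.𝔪 →ₗ[K] A.𝔪 →ₗ[K] (A.extAlg f).𝔪 :=
  LinearMap.mk₂ K
    (fun a b => ⟨(⟨a.1 * b.1, f.1 a.1 b.1⟩ : A.Ext f), (A.mulM a b).2⟩)
    (fun a a' b => Subtype.ext <| Ext.ext (add_mul a.1 a'.1 b.1) (Ext.add_left f a.1 a'.1 b.1))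
    (fun c a b => Subtype.ext <| Ext.ext (smul_mul_assoc c a.1 b.1) (Ext.smul_left f c a.1 b.1))
    (fun a b b' => Subtype.ext <| Ext.ext (mul_add a.1 b.1 b'.1) (Ext.add_right f a.1 b.1 b'.1))
    (fun c a b => Subtype.ext <| Ext.ext (mul_smul_comm c a.1 b.1) (Ext.smul_right f c a.1 b.1))

theorem mulM_eq_liftMul (a b : (A.extAlg f).𝔪) :
    (A.extAlg f).mulM a b = liftMul f (projM f a) (projM f b) := by
  obtain ⟨⟨a, m⟩, ha⟩ := a
  obtain ⟨⟨b, n⟩, hb⟩ := b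
  have ha : A.ε a = 0 := ha
  have hb : A.ε b = 0 := hb
  refine Subtype.ext (Ext.ext rfl ?_)
  change A.ε a • n + A.ε b • m + f.1 a b = f.1 a b
  rw [ha, hb, zero_smul, zero_smul, zero_add, zero_add]

theorem Δ_eq (ξ : Module.Dual K (A.extAlg f).𝔪) :
    (A.extAlg f).Δ ξ = TensorProduct.map (projM f).dualMap (projM f).dualMap
      ((TensorProduct.dualDistribEquiv K A.𝔪 A.𝔪).symm
        ((TensorProduct.lift (liftMul f)).dualMap ξ)) := by
  apply dualDistrib_injective
  have key : ∀ (t : Module.Dual K A.𝔪 ⊗[K] Module.Dual K A.𝔪) (x y : (A.extAlg f).𝔪),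
      TensorProduct.dualDistrib K _ _
          (TensorProduct.map (projM f).dualMap (projM f).dualMap t) (x ⊗ₜ y)
        = TensorProduct.dualDistrib K A.𝔪 A.𝔪 t (projM f x ⊗ₜ projM f y) := by
    intro t x y
    induction t with
    | zero => simp
    | tmul f g => simp
    | add a b ha hb => simp only [map_add, LinearMap.add_apply, ha, hb]
  ext x y
  simp only [TensorProduct.AlgebraTensorModule.curry_apply, LinearMap.restrictScalars_self,
    TensorProduct.curry_apply]
  rw [key, dualDistrib_Δ, mulM_eq_liftMul]
  have : TensorProduct.dualDistrib K A.𝔪 A.𝔪 ((TensorProduct.dualDistribEquiv K A.𝔪 A.𝔪).symm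
      ((TensorProduct.lift (liftMul f)).dualMap ξ)) = (TensorProduct.lift (liftMul f)).dualMap ξ :=
    (TensorProduct.dualDistribEquiv K A.𝔪 A.𝔪).apply_symm_apply _
  rw [this]
  simp

/-- The filtered coalgebra `F = 𝔪_B'` of an extension `B` of `A` by `M`, with `F₁ = 𝔪_A'` and
`F₀ = (𝔪_A / 𝔪_A^2)'`, both embedded in `F` by the dual of the projection `𝔪_B → 𝔪_A`. -/
def extCoalgebra : FilteredCoalgebra K (Module.Dual K (A.extAlg f).𝔪) where
  Δ := (A.extAlg f).Δ
  cocomm := Δ_cocomm _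
  coassoc := Δ_coassoc _
  F₀ := Submodule.map (projM f).dualMap
    { carrier := {ξ | ∀ x y : A.𝔪, ξ (A.mulM x y) = 0}
      zero_mem' := by simp
      add_mem' := fun hξ hζ x y => by simp [hξ x y, hζ x y]
      smul_mem' := fun c ξ hξ x y => by simp [hξ x y] }
  F₁ := LinearMap.range (projM f).dualMap
  F₀_le := LinearMap.map_le_range
  F₀_le_ker := by
    rintro _ ⟨ξ, hξ, rfl⟩
    rw [LinearMap.mem_ker]
    apply dualDistrib_injective
    ext x y
    simp only [TensorProduct.AlgebraTensorModule.curry_apply, LinearMap.restrictScalars_self,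
      TensorProduct.curry_apply]
    rw [dualDistrib_Δ]
    simpa using! hξ (projM f x) (projM f y)
  range_le := by
    rintro _ ⟨ξ, rfl⟩
    rw [Δ_eq]
    have : (projM f).dualMap =
      (LinearMap.range (projM f).dualMap).subtype ∘ₗ (projM f).dualMap.rangeRestrict := rfl
    generalize (TensorProduct.dualDistribEquiv K A.𝔪 A.𝔪).symm
        ((TensorProduct.lift (liftMul f)).dualMap ξ) = t
    exact ⟨TensorProduct.map (projM f).dualMap.rangeRestrict (projM f).dualMap.rangeRestrict t,
      by rw [← LinearMap.comp_apply, ← TensorProduct.map_comp]; rfl⟩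

end Filtration

/-! The universal extension by `H^2_Harr(A, K)'`. -/

section Universal

variable {A : AugAlg.{u, max u w} K}

/-- The cocycle `f_A` with values in `H^2_Harr(A, K)'`, dual to a choice `s` of representatives of
the Harrison classes: `f_A(a, b)(h) = s(h)(a, b)`. -/
def univCocycle (s : A.harrH K →ₗ[K] A.harrZ K) : A.harrZ (Module.Dual K (A.harrH K)) :=
  ⟨fun a b =>
      { toFun := fun h => (s h).1 a b
        map_add' := fun h h' => by simp
        map_smul' := fun c h => by simp },
    ⟨LinearMap.mk₂ K _
      (fun a a' b => LinearMap.ext fun h => Ext.add_left (s h) a a' b)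
      (fun c a b => LinearMap.ext fun h => Ext.smul_left (s h) c a b)
      (fun a b b' => LinearMap.ext fun h => Ext.add_right (s h) a b b')
      (fun c a b => LinearMap.ext fun h => Ext.smul_right (s h) c a b), fun _ _ => rfl⟩,
    fun a b => LinearMap.ext fun h => (s h).2.2.1 a b,
    fun a b c => LinearMap.ext fun h => (s h).2.2.2 a b c⟩

/-- The extension `0 → H^2_Harr(A, K)' → bar s → A → 0`. -/
def bar (s : A.harrH K →ₗ[K] A.harrZ K) : AugAlg.{u, max u w} K := A.extAlg (univCocycle s)

/-- The projection `bar s → A`. -/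
def barProj (s : A.harrH K →ₗ[K] A.harrZ K) : bar s →ₐ[K] A := Ext.fst (univCocycle s)

/-- The functional `(a, θ) ↦ θ(h)` on `bar s`. -/
def barEval (s : A.harrH K →ₗ[K] A.harrZ K) (h : A.harrH K) : bar s →ₗ[K] K :=
  Module.Dual.eval K _ h ∘ₗ Ext.snd (univCocycle s)

/-- The filtered coalgebra `F = 𝔪'` of the augmentation ideal `𝔪` of `bar s`. -/
def barCoalgebra (s : A.harrH K →ₗ[K] A.harrZ K) :
    FilteredCoalgebra K (Module.Dual K (bar s).𝔪) :=
  extCoalgebra (univCocycle s)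

/-- The ideal of `bar s` generated by the image of `w' : N' → H^2_Harr(A, K)'`. -/
def obsIdeal (s : A.harrH K →ₗ[K] A.harrZ K) {N : Type*} [AddCommGroup N] [Module K N]
    (ω : A.harrH K →ₗ[K] N) : Ideal (bar s) :=
  Ideal.span (Set.range fun θ : Module.Dual K N => Ext.inr (univCocycle s) (ω.dualMap θ))

theorem obsIdeal_le (s : A.harrH K →ₗ[K] A.harrZ K) {N : Type*} [AddCommGroup N] [Module K N]
    (ω : A.harrH K →ₗ[K] N) : obsIdeal s ω ≤ RingHom.ker (barProj s) := by
  rw [obsIdeal, Ideal.span_le]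
  rintro _ ⟨θ, rfl⟩
  rfl

/-- The quotient of `bar s` by the image of `w'`. -/
def next (s : A.harrH K →ₗ[K] A.harrZ K) {N : Type*} [AddCommGroup N] [Module K N]
    (ω : A.harrH K →ₗ[K] N) : AugAlg.{u, max u w} K where
  carrier := bar s ⧸ obsIdeal s ω
  finite := inferInstanceAs (Module.Finite K (bar s ⧸ obsIdeal s ω))
  ε := A.ε.comp (Ideal.Quotient.liftₐ (obsIdeal s ω) (barProj s) fun _ ha => obsIdeal_le s ω ha)

/-- The projection `next s ω → A`. -/
def nextProj (s : A.harrH K →ₗ[K] A.harrZ K) {N : Type*} [AddCommGroup N] [Module K N]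
    (ω : A.harrH K →ₗ[K] N) : next s ω →ₐ[K] A :=
  Ideal.Quotient.liftₐ (obsIdeal s ω) (barProj s) fun _ ha => obsIdeal_le s ω ha

end Universal

end AugAlg

/-! ### Deformations -/

namespace HomLeibniz

variable {K : Type u} {L : Type v} [Field K] [AddCommGroup L] [Module K L]
variable (𝓛 : HomLeibniz K L)

/-- The `A`-bilinear operations on `A ⊗ L`. -/
abbrev Op (A : AugAlg.{u, w} K) (L : Type v) [AddCommGroup L] [Module K L] :=
  A ⊗[K] L →ₗ[A] A ⊗[K] L →ₗ[A] A ⊗[K] L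

/-- `ξ ⊗ id : A ⊗ L → K ⊗ L = L` for a linear functional `ξ` on `A`. -/
def contract {A : AugAlg.{u, w} K} (ξ : A →ₗ[K] K) : A ⊗[K] L →ₗ[K] L :=
  (TensorProduct.lid K L).toLinearMap ∘ₗ ξ.rTensor L

/-- `id ⊗ α` on `A ⊗ L`. -/
def twist (A : AugAlg.{u, w} K) : A ⊗[K] L →ₗ[A] A ⊗[K] L := 𝓛.α.baseChange A

/-- The Hom-Leibniz defect `{αx, {y, z}} - {{x, y}, αz} + {{x, z}, αy}` of an operation. -/
def defect {A : AugAlg.{u, w} K} (β : Op A L) (x y z : A ⊗[K] L) : A ⊗[K] L :=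
  β (𝓛.twist A x) (β y z) - β (β x y) (𝓛.twist A z) + β (β x z) (𝓛.twist A y)

/-- The operation `β` on `A ⊗ L` is a deformation of `𝓛` with base `A`: with `id ⊗ α` it is a
multiplicative Hom-Leibniz `A`-algebra, and `ε ⊗ id` is a morphism to `𝓛`. -/
structure IsDeformation (A : AugAlg.{u, w} K) (β : Op A L) : Prop where
  hom_jacobi : ∀ x y z, 𝓛.defect β x y z = 0
  twist_op : ∀ x y, 𝓛.twist A (β x y) = β (𝓛.twist A x) (𝓛.twist A y)
  aug : ∀ x y, contract A.ε.toLinearMap (β x y)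
    = 𝓛.br (contract A.ε.toLinearMap x) (contract A.ε.toLinearMap y)

/-- The `A`-bilinear operation on `A ⊗ L` with prescribed values on the pairs `1 ⊗ l, 1 ⊗ l'`. -/
def opOf (A : AugAlg.{u, w} K) (b : L →ₗ[K] L →ₗ[K] A ⊗[K] L) : Op A L :=
  LinearMap.liftBaseChange A
    (((LinearMap.liftBaseChangeEquiv A).toLinearMap.restrictScalars K) ∘ₗ b)

theorem opOf_tmul (A : AugAlg.{u, w} K) (b : L →ₗ[K] L →ₗ[K] A ⊗[K] L) (a a' : A) (l l' : L) :
    opOf A b (a ⊗ₜ l) (a' ⊗ₜ l') = (a * a') • b l l' := by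
  simp [opOf, mul_smul]

/-- The push-out `φ_* β`: `[1 ⊗ l, 1 ⊗ l']_{φ_* β} = (φ ⊗ id) [1 ⊗ l, 1 ⊗ l']_β`. -/
def pushout {A : AugAlg.{u, w} K} {A' : AugAlg.{u, x} K} (φ : A →ₐ[K] A') (β : Op A L) :
    Op A' L :=
  opOf A' (LinearMap.mk₂ K (fun l l' => φ.toLinearMap.rTensor L (β (1 ⊗ₜ l) (1 ⊗ₜ l')))
    (fun _ _ _ => by simp [TensorProduct.tmul_add])
    (fun c _ _ => by
      rw [TensorProduct.tmul_smul, ← algebraMap_smul A c, map_smul, LinearMap.smul_apply,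
        algebraMap_smul, map_smul])
    (fun _ _ _ => by simp [TensorProduct.tmul_add])
    (fun c _ _ => by
      rw [TensorProduct.tmul_smul, ← algebraMap_smul A c, map_smul, algebraMap_smul, map_smul]))

/-! The universal infinitesimal deformation. -/

section Infinitesimal

variable [FiniteDimensional K (𝓛.H 2)]

/-- `C_1 = K ⊕ H'`, `H = H^2(L, L)`, with `(k, h) (k', h') = (k k', k h' + k' h)`. -/
def C₁ : AugAlg.{u, max u v} K where
  carrier := TrivSqZeroExt K (Module.Dual K (𝓛.H 2))
  finite := inferInstanceAs (Module.Finite K (K × Module.Dual K (𝓛.H 2)))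
  ε := TrivSqZeroExt.fstHom K K (Module.Dual K (𝓛.H 2))

/-- The functional `(k, θ) ↦ θ(h)` on `C_1`. -/
def evalC₁ (h : 𝓛.H 2) : 𝓛.C₁ →ₗ[K] K :=
  Module.Dual.eval K _ h ∘ₗ TrivSqZeroExt.sndHom K (Module.Dual K (𝓛.H 2))

/-- The inclusion `H' → C_1`. -/
def inrC₁ : Module.Dual K (𝓛.H 2) →ₗ[K] 𝓛.C₁ :=
  TrivSqZeroExt.inrHom K (Module.Dual K (𝓛.H 2))

/-- The cochain-valued functional `h ↦ μ(h)(l, l')`. -/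
def repMap (μ : 𝓛.H 2 →ₗ[K] 𝓛.Z 2) (l l' : L) : 𝓛.H 2 →ₗ[K] L where
  toFun h := (μ h).1 ![l, l']
  map_add' h h' := by simp
  map_smul' c h := by simp

/-- The deformation `η_1` with base `C_1` given by a choice `μ` of representatives of the classes
in `H`: `[1 ⊗ l, 1 ⊗ l'] = 1 ⊗ [l, l'] + (h ↦ μ(h)(l, l'))`, where
`Hom(H, L) = H' ⊗ L ⊆ C_1 ⊗ L`. -/
def eta₁ (μ : 𝓛.H 2 →ₗ[K] 𝓛.Z 2) : Op 𝓛.C₁ L :=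
  opOf 𝓛.C₁ (LinearMap.mk₂ K
    (fun l l' => (1 : 𝓛.C₁) ⊗ₜ[K] 𝓛.br l l' + 𝓛.inrC₁.rTensor L
      ((dualTensorHomEquiv K (𝓛.H 2) L).symm (𝓛.repMap μ l l')))
    (fun l₁ l₂ l' => by
      have : 𝓛.repMap μ (l₁ + l₂) l' = 𝓛.repMap μ l₁ l' + 𝓛.repMap μ l₂ l' :=
        LinearMap.ext fun h => 𝓛.cochain_fst_add ⟨_, (μ h).2.1⟩ l₁ l₂ l'
      simp only [this, map_add, LinearMap.add_apply, TensorProduct.tmul_add]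
      abel)
    (fun c l l' => by
      have : 𝓛.repMap μ (c • l) l' = c • 𝓛.repMap μ l l' :=
        LinearMap.ext fun h => 𝓛.cochain_fst_smul ⟨_, (μ h).2.1⟩ c l l'
      simp only [this, map_smul, LinearMap.smul_apply, TensorProduct.tmul_smul, smul_add])
    (fun l l₁ l₂ => by
      have : 𝓛.repMap μ l (l₁ + l₂) = 𝓛.repMap μ l l₁ + 𝓛.repMap μ l l₂ :=
        LinearMap.ext fun h => 𝓛.cochain_snd_add ⟨_, (μ h).2.1⟩ l l₁ l₂
      simp only [this, map_add, TensorProduct.tmul_add]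
      abel)
    (fun c l l' => by
      have : 𝓛.repMap μ l (c • l') = c • 𝓛.repMap μ l l' :=
        LinearMap.ext fun h => 𝓛.cochain_snd_smul ⟨_, (μ h).2.1⟩ c l l'
      simp only [this, map_smul, TensorProduct.tmul_smul, smul_add]))

end Infinitesimal

/-! Obstructions and the inductive construction. -/

/-- `ω : H^2_Harr(A, K) → H^3(L, L)` is the obstruction map of the operation `β` on `A ⊗ L`: for a
`bar s`-bilinear lifting `β'` of `β` commuting with `id ⊗ α`, the Hom-Leibniz defect of `β'`, which
takes values in `H^2_Harr(A, K)' ⊗ L`, has for every `h` in `H^2_Harr(A, K)` an `h`-component which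
is a `3`-cocycle of class `ω h`. -/
def IsObstruction {A : AugAlg.{u, max u w} K} (β : Op A L) (s : A.harrH K →ₗ[K] A.harrZ K)
    (ω : A.harrH K →ₗ[K] 𝓛.H 3) : Prop :=
  ∃ β' : Op (AugAlg.bar s) L,
    (∀ a b, (AugAlg.barProj s).toLinearMap.rTensor L (β' a b)
      = β ((AugAlg.barProj s).toLinearMap.rTensor L a)
        ((AugAlg.barProj s).toLinearMap.rTensor L b)) ∧
    (∀ a b, 𝓛.twist _ (β' a b) = β' (𝓛.twist _ a) (𝓛.twist _ b)) ∧
    ∀ h, 𝓛.Represents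
      (fun l : Fin 3 → L => contract (AugAlg.barEval s h)
        (𝓛.defect β' (1 ⊗ₜ l 0) (1 ⊗ₜ l 1) (1 ⊗ₜ l 2)))
      (ω h)

/-- `IsStage μ k A π η`: starting from the deformation `η_1` with base `C_1` given by `μ`, the
inductive construction can produce in `k - 1` steps the algebra `C_k = A` with the projection
`π : C_k → C_1` and the deformation `η_k = η`. In each step one forms the extension `bar s` of `C_k`
by `H^2_Harr(C_k, K)'`, divides it by the image of the dual of the obstruction map `ω_k` of `η_k`,
and chooses an extension of `η_k` to a deformation with the new base. -/
inductive IsStage [FiniteDimensional K (𝓛.H 2)] (μ : 𝓛.H 2 →ₗ[K] 𝓛.Z 2) :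
    ℕ → (A : AugAlg.{u, max u v} K) → (A →ₐ[K] 𝓛.C₁) → Op A L → Prop
  | one : IsStage μ 1 𝓛.C₁ (AlgHom.id K 𝓛.C₁) (𝓛.eta₁ μ)
  | succ {k : ℕ} {A : AugAlg.{u, max u v} K} {π : A →ₐ[K] 𝓛.C₁} {η : Op A L}
      (hη : IsStage μ k A π η)
      (s : A.harrH K →ₗ[K] A.harrZ K) (hs : ∀ h, Submodule.Quotient.mk (s h) = h)
      (ω : A.harrH K →ₗ[K] 𝓛.H 3) (hω : 𝓛.IsObstruction η s ω)
      (η' : Op (AugAlg.next s ω) L) (hη' : 𝓛.IsDeformation _ η')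
      (hpush : pushout (AugAlg.nextProj s ω) η' = η) :
      IsStage μ (k + 1) (AugAlg.next s ω) (π.comp (AugAlg.nextProj s ω)) η'

end HomLeibniz

end

/-!
An operation `β` on `A ⊗ L` is the same thing as the linear family of its components
`ψ(ξ) = (ξ ⊗ id) β(1 ⊗ -, 1 ⊗ -)`, `ξ ∈ A'`. If `β` commutes with `id ⊗ α` and lifts the bracket
of `𝓛`, only the components indexed by `𝔪'` matter; they are `2`-cochains, and the Hom-Leibniz
defect of `β` has the components `δ ψ + (1/2) ν ∘ (ψ ⊗ ψ) ∘ Δ` (`contract_defect`,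
`two_smul_contract_defect`). So deformations with base `A` are the solutions of
`d ψ = (1/2) ν ∘ (ψ ⊗ ψ) ∘ Δ` on `F₁ = 𝔪_A'`, and a lifting of a deformation to `bar s` is an
extension of `ψ` to `F`, whose defect is `δ ψ + (1/2) ν ∘ (ψ ⊗ ψ) ∘ Δ` on
`F / F₁ = H^2_Harr(A, K)`. This makes `ν ∘ (ψ ⊗ ψ) ∘ Δ` represent twice the obstruction
(`IsLift.represents_lift_ν`), which is both directions of the theorem up to the following points.

* The components of the defect of a lifting are cocycles. This is the Bianchi identity
  `[β, [β, β]] = 0` (`bianchi`), since on the kernel `H^2_Harr(A, K)' ⊗ L` of `bar s ⊗ L → A ⊗ L`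
  the operation acts through the augmentation (`IsLift.defectAt_mem_Z`). Two liftings have defects
  that differ by a coboundary (`IsLift.defectAt_sub`), so the obstruction map is well defined.
* The identification `H = F₀` needs that no stage changes `𝔪 / 𝔪^2`. The reason is that a functional
  on `bar s` which kills products and is nonzero on `H^2_Harr(A, K)'` would make the representing
  cocycle of a nonzero Harrison class a coboundary (`apply_barInr_eq_zero`,
  `IsStage.stageInvariant`).
* A defining system of the Massey bracket gives a deformation whose first-order part is only
  cohomologous to `μ`. It is transported by an automorphism `1 + ∑ mᵢ ⊗ γᵢ` of `bar s ⊗ L` with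
  `mᵢ` in the nilpotent augmentation ideal; this removes the coboundaries of the `γᵢ`
  from the first-order part and leaves the obstruction cocycles unchanged, because the automorphism
  is the identity on `H^2_Harr(A, K)' ⊗ L` (`IsLift.exists_gauge`).
-/

/-! ### The Bianchi identity and the differential -/

/-- The Bianchi identity `[β, [β, β]] = 0`. -/
theorem bianchi {R V : Type*} [CommRing R] [AddCommGroup V] [Module R V]
    (β : V →ₗ[R] V →ₗ[R] V) (T : V →ₗ[R] V) (hT : ∀ x y, T (β x y) = β (T x) (T y))
    (D : V → V → V → V)
    (hD : ∀ x y z, D x y z = β (T x) (β y z) - β (β x y) (T z) + β (β x z) (T y)) (x y z t : V) :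
    β (T (T x)) (D y z t) + β (D x z t) (T (T y)) - β (D x y t) (T (T z)) + β (D x y z) (T (T t))
      - D (β x y) (T z) (T t) + D (β x z) (T y) (T t) - D (β x t) (T y) (T z)
      + D (T x) (β y z) (T t) - D (T x) (β y t) (T z) - D (T x) (T y) (β z t) = 0 := by
  simp only [hD, map_add, map_sub, LinearMap.add_apply, LinearMap.sub_apply, hT]
  abel

namespace HomLeibniz

variable {K : Type u} {L : Type v} [Field K] [AddCommGroup L] [Module K L]
variable (𝓛 : HomLeibniz K L)

theorem δ_one_apply (φ : (Fin 1 → L) → L) (x : Fin 2 → L) :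
    𝓛.δ 1 φ x = 𝓛.br (x 0) (φ ![x 1]) + 𝓛.br (φ ![x 0]) (x 1) - φ ![𝓛.br (x 0) (x 1)] := by
  obtain ⟨m, rfl⟩ : ∃ m : L → L, φ = fun f => m (f 0) :=
    ⟨fun a => φ ![a], funext fun f => congrArg φ (by funext i; fin_cases i; rfl)⟩
  simp [δ, Fin.sum_univ_succ, Fin.succAbove, Function.update]
  abel

theorem δ_two_apply (φ : (Fin 2 → L) → L) (x : Fin 3 → L) :
    𝓛.δ 2 φ x = 𝓛.br (𝓛.α (x 0)) (φ ![x 1, x 2]) + 𝓛.br (φ ![x 0, x 2]) (𝓛.α (x 1))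
      - 𝓛.br (φ ![x 0, x 1]) (𝓛.α (x 2)) - φ ![𝓛.br (x 0) (x 1), 𝓛.α (x 2)]
      + φ ![𝓛.br (x 0) (x 2), 𝓛.α (x 1)] + φ ![𝓛.α (x 0), 𝓛.br (x 1) (x 2)] := by
  obtain ⟨m, rfl⟩ : ∃ m : L → L → L, φ = fun f => m (f 0) (f 1) :=
    ⟨fun a b => φ ![a, b], funext fun f => congrArg φ (by funext i; fin_cases i <;> rfl)⟩
  simp [δ, Fin.sum_univ_succ, Fin.succAbove, Function.update]
  abel

theorem δ_three_apply (φ : (Fin 3 → L) → L) (x : Fin 4 → L) :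
    𝓛.δ 3 φ x = 𝓛.br (𝓛.α (𝓛.α (x 0))) (φ ![x 1, x 2, x 3])
      + 𝓛.br (φ ![x 0, x 2, x 3]) (𝓛.α (𝓛.α (x 1)))
      - 𝓛.br (φ ![x 0, x 1, x 3]) (𝓛.α (𝓛.α (x 2)))
      + 𝓛.br (φ ![x 0, x 1, x 2]) (𝓛.α (𝓛.α (x 3)))
      - φ ![𝓛.br (x 0) (x 1), 𝓛.α (x 2), 𝓛.α (x 3)]
      + φ ![𝓛.br (x 0) (x 2), 𝓛.α (x 1), 𝓛.α (x 3)]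
      - φ ![𝓛.br (x 0) (x 3), 𝓛.α (x 1), 𝓛.α (x 2)]
      + φ ![𝓛.α (x 0), 𝓛.br (x 1) (x 2), 𝓛.α (x 3)]
      - φ ![𝓛.α (x 0), 𝓛.br (x 1) (x 3), 𝓛.α (x 2)]
      - φ ![𝓛.α (x 0), 𝓛.α (x 1), 𝓛.br (x 2) (x 3)] := by
  obtain ⟨m, rfl⟩ : ∃ m : L → L → L → L, φ = fun f => m (f 0) (f 1) (f 2) :=
    ⟨fun a b c => φ ![a, b, c], funext fun f => congrArg φ (by funext i; fin_cases i <;> rfl)⟩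
  have h3 : (-1 : K) ^ 3 = -1 := by norm_num
  have h2 : 𝓛.α ^ 2 = 𝓛.α * 𝓛.α := pow_two _
  simp [δ, Fin.sum_univ_succ, Fin.succAbove, Function.update, h2, h3]
  abel

/-- A bilinear map commuting with `α`, as a `2`-cochain. -/
def cochainOfBilin (b : L →ₗ[K] L →ₗ[K] L) (hb : ∀ x y, 𝓛.α (b x y) = b (𝓛.α x) (𝓛.α y)) :
    𝓛.cochains 2 :=
  ⟨fun x => b (x 0) (x 1),
    ⟨{ toFun := fun x => b (x 0) (x 1)
       map_update_add' := fun x i y z => by fin_cases i <;> simp [Function.update]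
       map_update_smul' := fun x i c y => by fin_cases i <;> simp [Function.update] }, rfl⟩,
    fun x => hb _ _⟩

/-- The bilinear map underlying a `2`-cochain. -/
def bilin (φ : 𝓛.cochains 2) : L →ₗ[K] L →ₗ[K] L :=
  LinearMap.mk₂ K (fun x y => φ.1 ![x, y]) (𝓛.cochain_fst_add φ) (𝓛.cochain_fst_smul φ)
    (𝓛.cochain_snd_add φ) (fun c x y => 𝓛.cochain_snd_smul φ c x y)

@[simp] theorem bilin_apply (φ : 𝓛.cochains 2) (x y : L) : 𝓛.bilin φ x y = φ.1 ![x, y] := rfl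

theorem α_bilin (φ : 𝓛.cochains 2) (x y : L) :
    𝓛.α (𝓛.bilin φ x y) = 𝓛.bilin φ (𝓛.α x) (𝓛.α y) := by
  rw [bilin_apply, φ.2.2]
  exact congrArg φ.1 (by funext i; fin_cases i <;> rfl)

theorem mem_cochains_three (f : L → L → L → L)
    (h₁ : ∀ (c : K) x x' y z, f (c • x + x') y z = c • f x y z + f x' y z)
    (h₂ : ∀ (c : K) x y y' z, f x (c • y + y') z = c • f x y z + f x y' z)
    (h₃ : ∀ (c : K) x y z z', f x y (c • z + z') = c • f x y z + f x y z')
    (hα : ∀ x y z, 𝓛.α (f x y z) = f (𝓛.α x) (𝓛.α y) (𝓛.α z)) :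
    (fun x : Fin 3 → L => f (x 0) (x 1) (x 2)) ∈ 𝓛.cochains 3 := by
  have a₁ : ∀ x x' y z, f (x + x') y z = f x y z + f x' y z := fun x x' y z => by
    simpa using h₁ 1 x x' y z
  have a₂ : ∀ x y y' z, f x (y + y') z = f x y z + f x y' z := fun x y y' z => by
    simpa using h₂ 1 x y y' z
  have a₃ : ∀ x y z z', f x y (z + z') = f x y z + f x y z' := fun x y z z' => by
    simpa using h₃ 1 x y z z'
  have z₁ : ∀ y z, f 0 y z = 0 := fun y z => by simpa using a₁ 0 0 y z
  have z₂ : ∀ x z, f x 0 z = 0 := fun x z => by simpa using a₂ x 0 0 z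
  have z₃ : ∀ x y, f x y 0 = 0 := fun x y => by simpa using a₃ x y 0 0
  have s₁ : ∀ (c : K) x y z, f (c • x) y z = c • f x y z := fun c x y z => by
    simpa [z₁] using h₁ c x 0 y z
  have s₂ : ∀ (c : K) x y z, f x (c • y) z = c • f x y z := fun c x y z => by
    simpa [z₂] using h₂ c x y 0 z
  have s₃ : ∀ (c : K) x y z, f x y (c • z) = c • f x y z := fun c x y z => by
    simpa [z₃] using h₃ c x y z 0
  refine ⟨⟨MultilinearMap.mk' (fun x => f (x 0) (x 1) (x 2)) (fun x i y z => ?_)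
    (fun x i c y => ?_), rfl⟩, fun x => hα _ _ _⟩
  · fin_cases i <;> simp [Function.update, a₁, a₂, a₃]
  · fin_cases i <;> simp [Function.update, s₁, s₂, s₃]

/-- The differential `δ : C^2 → C^3` takes values in cocycles. -/
theorem δ_two_mem_Z (φ : 𝓛.cochains 2) : 𝓛.δ 2 φ.1 ∈ 𝓛.Z 3 := by
  have e : 𝓛.δ 2 φ.1 = fun x => 𝓛.br (𝓛.α (x 0)) (𝓛.bilin φ (x 1) (x 2))
      + 𝓛.br (𝓛.bilin φ (x 0) (x 2)) (𝓛.α (x 1)) - 𝓛.br (𝓛.bilin φ (x 0) (x 1)) (𝓛.α (x 2))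
      - 𝓛.bilin φ (𝓛.br (x 0) (x 1)) (𝓛.α (x 2)) + 𝓛.bilin φ (𝓛.br (x 0) (x 2)) (𝓛.α (x 1))
      + 𝓛.bilin φ (𝓛.α (x 0)) (𝓛.br (x 1) (x 2)) := funext fun x => 𝓛.δ_two_apply φ.1 x
  refine ⟨?_, ?_⟩
  · rw [e]
    refine 𝓛.mem_cochains_three (fun x y z => 𝓛.br (𝓛.α x) (𝓛.bilin φ y z)
      + 𝓛.br (𝓛.bilin φ x z) (𝓛.α y) - 𝓛.br (𝓛.bilin φ x y) (𝓛.α z)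
      - 𝓛.bilin φ (𝓛.br x y) (𝓛.α z) + 𝓛.bilin φ (𝓛.br x z) (𝓛.α y)
      + 𝓛.bilin φ (𝓛.α x) (𝓛.br y z)) ?_ ?_ ?_ ?_
    all_goals
      intros
      simp only [map_add, map_sub, map_smul, LinearMap.add_apply, LinearMap.smul_apply, smul_add,
        smul_sub, 𝓛.α_br, 𝓛.α_bilin]
    all_goals abel
  · have key : ∀ x y z t, 𝓛.br (𝓛.bilin φ (𝓛.α x) (𝓛.α y)) (𝓛.br z t)
        = 𝓛.br (𝓛.br (𝓛.bilin φ x y) z) (𝓛.α t) - 𝓛.br (𝓛.br (𝓛.bilin φ x y) t) (𝓛.α z) :=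
      fun x y z t => by rw [← 𝓛.α_bilin, 𝓛.hom_jacobi]
    refine LinearMap.mem_ker.2 (funext fun x => ?_)
    rw [δ_three_apply, e]
    simp only [Matrix.cons_val, map_add, map_sub, LinearMap.add_apply, LinearMap.sub_apply,
      𝓛.α_br, 𝓛.α_bilin, 𝓛.hom_jacobi, key, Pi.zero_apply]
    abel

end HomLeibniz

namespace HomLeibniz

variable {K : Type u} {L : Type v} [Field K] [AddCommGroup L] [Module K L]
variable (𝓛 : HomLeibniz K L)

/-! ### Operations on `A ⊗ L` and their components -/

section Components

variable {A : AugAlg.{u, w} K} {A' : AugAlg.{u, x} K}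

@[simp] theorem contract_tmul (ξ : A →ₗ[K] K) (a : A) (l : L) :
    contract ξ (a ⊗ₜ[K] l) = ξ a • l := by
  simp [contract]

theorem contract_add (ξ ξ' : A →ₗ[K] K) (x : A ⊗[K] L) :
    contract (ξ + ξ') x = contract ξ x + contract ξ' x := by
  simp [contract, LinearMap.rTensor_add]

theorem contract_smul (c : K) (ξ : A →ₗ[K] K) (x : A ⊗[K] L) :
    contract (c • ξ) x = c • contract ξ x := by
  simp [contract, LinearMap.rTensor_smul]

theorem sum_tmul_contract {ι : Type*} [Fintype ι] (b : Module.Basis ι K A) (x : A ⊗[K] L) :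
    ∑ i, b i ⊗ₜ[K] contract (b.coord i) x = x := by
  induction x with
  | zero => simp
  | tmul a l =>
    simp only [contract_tmul, ← TensorProduct.smul_tmul, ← TensorProduct.sum_tmul]
    congr 1
    exact b.sum_repr a
  | add x y hx hy => simp only [map_add, TensorProduct.tmul_add, Finset.sum_add_distrib, hx, hy]

theorem contract_ext {x y : A ⊗[K] L} (h : ∀ ξ : A →ₗ[K] K, contract ξ x = contract ξ y) :
    x = y := by
  rw [← sum_tmul_contract (Module.finBasis K A) x, ← sum_tmul_contract (Module.finBasis K A) y]
  simp only [h]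

theorem contract_rTensor (φ : A →ₗ[K] A') (ξ : A' →ₗ[K] K) (x : A ⊗[K] L) :
    contract ξ (φ.rTensor L x) = contract (ξ ∘ₗ φ) x := by
  simp [contract, LinearMap.rTensor_comp]

@[simp] theorem twist_tmul (a : A) (l : L) : 𝓛.twist A (a ⊗ₜ[K] l) = a ⊗ₜ[K] 𝓛.α l := by
  simp [twist]

theorem contract_twist (ξ : A →ₗ[K] K) (x : A ⊗[K] L) :
    contract ξ (𝓛.twist A x) = 𝓛.α (contract ξ x) := by
  induction x with
  | zero => simp
  | tmul a l => simp
  | add x y hx hy => simp only [map_add, hx, hy]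

theorem rTensor_twist (φ : A →ₐ[K] A') (x : A ⊗[K] L) :
    φ.toLinearMap.rTensor L (𝓛.twist A x) = 𝓛.twist A' (φ.toLinearMap.rTensor L x) := by
  induction x with
  | zero => simp
  | tmul a l => simp
  | add x y hx hy => simp only [map_add, hx, hy]

theorem rTensor_smul_of_algHom (φ : A →ₐ[K] A') (a : A) (x : A ⊗[K] L) :
    φ.toLinearMap.rTensor L (a • x) = φ a • φ.toLinearMap.rTensor L x := by
  induction x with
  | zero => simp
  | tmul b l => simp [TensorProduct.smul_tmul']
  | add x y hx hy => simp only [map_add, smul_add, hx, hy]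

theorem tmul_eq_smul (a : A) (l : L) : a ⊗ₜ[K] l = a • ((1 : A) ⊗ₜ[K] l) := by
  simp [TensorProduct.smul_tmul']

/-- An `A`-bilinear operation is determined by its values on `1 ⊗ L`. -/
theorem op_ext {β β' : Op A L}
    (h : ∀ l l' : L, β (1 ⊗ₜ l) (1 ⊗ₜ l') = β' (1 ⊗ₜ l) (1 ⊗ₜ l')) : β = β' := by
  refine LinearMap.ext fun x => LinearMap.ext fun y => ?_
  induction x with
  | zero => simp
  | tmul a l =>
    induction y with
    | zero => simp
    | tmul b l' =>
      rw [tmul_eq_smul a, tmul_eq_smul b]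
      simp only [map_smul, LinearMap.smul_apply, h]
    | add x y hx hy => simp only [map_add, hx, hy]
  | add x y hx hy => simp only [map_add, LinearMap.add_apply, hx, hy]

theorem pushout_rTensor (φ : A →ₐ[K] A') (β : Op A L) (x y : A ⊗[K] L) :
    φ.toLinearMap.rTensor L (β x y)
      = pushout φ β (φ.toLinearMap.rTensor L x) (φ.toLinearMap.rTensor L y) := by
  induction x with
  | zero => simp
  | tmul a l =>
    induction y with
    | zero => simp
    | tmul b l' =>
      rw [tmul_eq_smul a, tmul_eq_smul b]
      simp only [map_smul, LinearMap.smul_apply, rTensor_smul_of_algHom]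
      simp [pushout, opOf_tmul]
    | add x y hx hy => simp only [map_add, hx, hy]
  | add x y hx hy => simp only [map_add, LinearMap.add_apply, hx, hy]

theorem pushout_tmul (φ : A →ₐ[K] A') (β : Op A L) (l l' : L) :
    pushout φ β (1 ⊗ₜ l) (1 ⊗ₜ l') = φ.toLinearMap.rTensor L (β (1 ⊗ₜ l) (1 ⊗ₜ l')) := by
  simp [pushout, opOf_tmul]

/-- The push-out is the only operation compatible with the base change. -/
theorem eq_pushout (φ : A →ₐ[K] A') (β : Op A L) (β' : Op A' L)
    (h : ∀ l l' : L, φ.toLinearMap.rTensor L (β (1 ⊗ₜ l) (1 ⊗ₜ l')) = β' (1 ⊗ₜ l) (1 ⊗ₜ l')) :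
    pushout φ β = β' :=
  op_ext fun l l' => by rw [pushout_tmul, h]

theorem rTensor_defect (φ : A →ₐ[K] A') {β : Op A L} {β' : Op A' L}
    (h : ∀ x y, φ.toLinearMap.rTensor L (β x y)
      = β' (φ.toLinearMap.rTensor L x) (φ.toLinearMap.rTensor L y)) (x y z : A ⊗[K] L) :
    φ.toLinearMap.rTensor L (𝓛.defect β x y z) = 𝓛.defect β' (φ.toLinearMap.rTensor L x)
      (φ.toLinearMap.rTensor L y) (φ.toLinearMap.rTensor L z) := by
  simp only [defect, map_add, map_sub, h, rTensor_twist]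

theorem defect_add_left (β : Op A L) (x x' y z : A ⊗[K] L) :
    𝓛.defect β (x + x') y z = 𝓛.defect β x y z + 𝓛.defect β x' y z := by
  simp only [defect, map_add, LinearMap.add_apply]
  abel

theorem defect_add_middle (β : Op A L) (x y y' z : A ⊗[K] L) :
    𝓛.defect β x (y + y') z = 𝓛.defect β x y z + 𝓛.defect β x y' z := by
  simp only [defect, map_add, LinearMap.add_apply]
  abel

theorem defect_add_right (β : Op A L) (x y z z' : A ⊗[K] L) :
    𝓛.defect β x y (z + z') = 𝓛.defect β x y z + 𝓛.defect β x y z' := by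
  simp only [defect, map_add, LinearMap.add_apply]
  abel

theorem defect_smul (β : Op A L) (a b c : A) (x y z : A ⊗[K] L) :
    𝓛.defect β (a • x) (b • y) (c • z) = (a * b * c) • 𝓛.defect β x y z := by
  simp only [defect, map_smul, LinearMap.smul_apply, smul_add, smul_sub, smul_smul]
  rw [show c * b * a = a * b * c by ring, show c * (b * a) = a * b * c by ring,
    show b * (c * a) = a * b * c by ring]

theorem defect_eq_zero {β : Op A L}
    (h : ∀ x y z : L, 𝓛.defect β (1 ⊗ₜ x) (1 ⊗ₜ y) (1 ⊗ₜ z) = 0) (x y z : A ⊗[K] L) :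
    𝓛.defect β x y z = 0 := by
  induction x with
  | zero => simp [defect]
  | tmul a x =>
    induction y with
    | zero => simp [defect]
    | tmul b y =>
      induction z with
      | zero => simp [defect]
      | tmul c z =>
        rw [tmul_eq_smul a, tmul_eq_smul b, tmul_eq_smul c, defect_smul, h, smul_zero]
      | add z z' hz hz' => rw [defect_add_right, hz, hz', add_zero]
    | add z z' hz hz' => rw [defect_add_middle, hz, hz', add_zero]
  | add z z' hz hz' => rw [defect_add_left, hz, hz', add_zero]

/-- The components `(l, l') ↦ (ξ ⊗ id) β(1 ⊗ l, 1 ⊗ l')` of an operation, for `ξ` in `A'`. -/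
def component (β : Op A L)
    (hβ : ∀ x y, 𝓛.twist A (β x y) = β (𝓛.twist A x) (𝓛.twist A y)) :
    Module.Dual K A →ₗ[K] 𝓛.cochains 2 where
  toFun ξ := 𝓛.cochainOfBilin
    (LinearMap.mk₂ K (fun l l' => contract ξ (β (1 ⊗ₜ l) (1 ⊗ₜ l')))
      (fun _ _ _ => by simp [TensorProduct.tmul_add])
      (fun c _ _ => by
        rw [TensorProduct.tmul_smul, ← algebraMap_smul A c, map_smul, LinearMap.smul_apply,
          algebraMap_smul, map_smul])
      (fun _ _ _ => by simp [TensorProduct.tmul_add])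
      (fun c _ _ => by
        rw [TensorProduct.tmul_smul, ← algebraMap_smul A c, map_smul, algebraMap_smul, map_smul]))
    (fun x y => by simp [← contract_twist, hβ])
  map_add' ξ ξ' := Subtype.ext <| funext fun x => contract_add _ _ _
  map_smul' c ξ := Subtype.ext <| funext fun x => contract_smul _ _ _

theorem component_apply (β : Op A L) (hβ) (ξ : Module.Dual K A) (x : Fin 2 → L) :
    (𝓛.component β hβ ξ).1 x = contract ξ (β (1 ⊗ₜ x 0) (1 ⊗ₜ x 1)) := rfl

theorem bilin_component (β : Op A L) (hβ) (ξ : Module.Dual K A) (l l' : L) :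
    𝓛.bilin (𝓛.component β hβ ξ) l l' = contract ξ (β (1 ⊗ₜ l) (1 ⊗ₜ l')) := rfl

theorem twist_op_of_tmul {β : Op A L}
    (h : ∀ l l' : L, 𝓛.twist A (β (1 ⊗ₜ l) (1 ⊗ₜ l')) = β (1 ⊗ₜ 𝓛.α l) (1 ⊗ₜ 𝓛.α l'))
    (x y : A ⊗[K] L) : 𝓛.twist A (β x y) = β (𝓛.twist A x) (𝓛.twist A y) := by
  induction x with
  | zero => simp
  | tmul a l =>
    induction y with
    | zero => simp
    | tmul b l' =>
      rw [tmul_eq_smul a, tmul_eq_smul b]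
      simp only [map_smul, LinearMap.smul_apply, h, twist_tmul]
    | add x y hx hy => simp only [map_add, hx, hy]
  | add x y hx hy => simp only [map_add, LinearMap.add_apply, hx, hy]

theorem contract_ε_smul (a : A) (x : A ⊗[K] L) :
    contract A.ε.toLinearMap (a • x) = A.ε a • contract A.ε.toLinearMap x := by
  induction x with
  | zero => simp
  | tmul b l => simp [TensorProduct.smul_tmul', mul_smul]
  | add x y hx hy => simp only [map_add, smul_add, hx, hy]

theorem aug_of_tmul {β : Op A L}
    (h : ∀ l l' : L, contract A.ε.toLinearMap (β (1 ⊗ₜ l) (1 ⊗ₜ l')) = 𝓛.br l l')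
    (x y : A ⊗[K] L) : contract A.ε.toLinearMap (β x y)
      = 𝓛.br (contract A.ε.toLinearMap x) (contract A.ε.toLinearMap y) := by
  induction x with
  | zero => simp
  | tmul a l =>
    induction y with
    | zero => simp
    | tmul b l' =>
      rw [tmul_eq_smul a, tmul_eq_smul b]
      simp only [map_smul, LinearMap.smul_apply, h, contract_ε_smul, contract_tmul]
      simp
    | add x y hx hy => simp only [map_add, hx, hy]
  | add x y hx hy => simp only [map_add, LinearMap.add_apply, hx, hy]

/-- Every family of `2`-cochains indexed linearly by `A'` consists of the components of an
operation on `A ⊗ L`. -/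
theorem exists_op_of_components (Ψ : Module.Dual K A →ₗ[K] 𝓛.cochains 2) :
    ∃ β : Op A L, (∀ x y, 𝓛.twist A (β x y) = β (𝓛.twist A x) (𝓛.twist A y)) ∧
      ∀ (ξ : Module.Dual K A) (l l' : L),
        contract ξ (β (1 ⊗ₜ l) (1 ⊗ₜ l')) = 𝓛.bilin (Ψ ξ) l l' := by
  let b := Module.finBasis K A
  let β : Op A L := opOf A (LinearMap.mk₂ K
    (fun l l' => ∑ i, b i ⊗ₜ[K] 𝓛.bilin (Ψ (b.coord i)) l l')
    (fun _ _ _ => by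
      simp only [map_add, LinearMap.add_apply, TensorProduct.tmul_add, Finset.sum_add_distrib])
    (fun _ _ _ => by
      simp only [map_smul, LinearMap.smul_apply, TensorProduct.tmul_smul, Finset.smul_sum])
    (fun _ _ _ => by
      simp only [map_add, TensorProduct.tmul_add, Finset.sum_add_distrib])
    (fun _ _ _ => by
      simp only [map_smul, TensorProduct.tmul_smul, Finset.smul_sum]))
  have hβ : ∀ l l' : L, β (1 ⊗ₜ l) (1 ⊗ₜ l') = ∑ i, b i ⊗ₜ[K] 𝓛.bilin (Ψ (b.coord i)) l l' :=
    fun l l' => by simp [β, opOf_tmul]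
  refine ⟨β, 𝓛.twist_op_of_tmul fun l l' => ?_, fun ξ l l' => ?_⟩
  · rw [hβ, hβ]
    simp only [map_sum, twist_tmul, α_bilin]
  · rw [hβ, map_sum]
    have : ξ = ∑ i, ξ (b i) • b.coord i := (b.sum_dual_apply_smul_coord ξ).symm
    conv_rhs => rw [this]
    simp only [contract_tmul, map_sum, map_smul, bilin_apply]
    simp only [Submodule.coe_sum, Finset.sum_apply, Submodule.coe_smul, Pi.smul_apply]

end Components

end HomLeibniz

/-! ### The Maurer–Cartan equation of an operation -/

namespace AugAlg

variable {K : Type u} [Field K] (A : AugAlg.{u, w} K)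

/-- The projection `a ↦ a - ε(a)` of `A` onto the augmentation ideal. -/
def toM : A →ₗ[K] A.𝔪 :=
  (LinearMap.id - Algebra.linearMap K A ∘ₗ A.ε.toLinearMap).codRestrict _ fun a => by
    simp

@[simp] theorem coe_toM (a : A) : (A.toM a : A) = a - algebraMap K A (A.ε a) := rfl

/-- The extension of functionals on `𝔪` to functionals on `A` vanishing at `1`. -/
def extZero : Module.Dual K A.𝔪 →ₗ[K] Module.Dual K A := A.toM.dualMap

@[simp] theorem toM_coe (z : A.𝔪) : A.toM z = z := by
  ext
  have : A.ε z = 0 := z.2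
  simp [this]

theorem extZero_apply (ξ : Module.Dual K A.𝔪) (a : A) : A.extZero ξ a = ξ (A.toM a) := rfl

@[simp] theorem extZero_one (ξ : Module.Dual K A.𝔪) : A.extZero ξ 1 = 0 := by
  have : A.toM 1 = 0 := by ext; simp
  rw [extZero_apply, this, map_zero]

@[simp] theorem extZero_coe (ξ : Module.Dual K A.𝔪) (z : A.𝔪) : A.extZero ξ z = ξ z := by
  rw [extZero_apply, toM_coe]

/-- `A' = 𝔪' ⊕ K ε`. -/
theorem eq_extZero_add (ξ : Module.Dual K A) :
    ξ = A.extZero (ξ.domRestrict A.𝔪) + ξ 1 • A.ε.toLinearMap := by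
  ext a
  simp [extZero_apply, Algebra.algebraMap_eq_smul_one, mul_comm]

theorem Δ_eq_sum {ι : Type*} [Fintype ι] (b : Module.Basis ι K A.𝔪)
    (ξ : Module.Dual K A.𝔪) :
    A.Δ ξ = ∑ i, ∑ j, ξ (A.mulM (b i) (b j)) • (b.coord j ⊗ₜ[K] b.coord i) := by
  classical
  apply dualDistrib_injective
  refine TensorProduct.ext (b.ext fun k => b.ext fun l => ?_)
  change TensorProduct.dualDistrib K _ _ (A.Δ ξ) (b k ⊗ₜ b l)
    = TensorProduct.dualDistrib K _ _ (∑ i, ∑ j, _) (b k ⊗ₜ b l)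
  simp only [dualDistrib_Δ, map_sum, map_smul, LinearMap.sum_apply, LinearMap.smul_apply,
    TensorProduct.dualDistrib_apply, Module.Basis.coord_apply, Module.Basis.repr_self]
  rw [Finset.sum_eq_single l, Finset.sum_eq_single k]
  · simp only [Finsupp.single_eq_same, mul_one, smul_eq_mul]
    exact congrArg ξ (Subtype.ext (mul_comm _ _))
  · intro i _ hi
    simp [Ne.symm hi]
  · simp
  · intro i _ hi
    simp [Finsupp.single_apply, Ne.symm hi]
  · simp

end AugAlg

namespace HomLeibniz

variable {K : Type u} {L : Type v} [Field K] [AddCommGroup L] [Module K L]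
variable (𝓛 : HomLeibniz K L)

section MaurerCartan

variable {A : AugAlg.{u, w} K}

theorem eq_one_tmul_add_sum {ι : Type*} [Fintype ι] (b : Module.Basis ι K A.𝔪)
    (x : A ⊗[K] L) :
    x = 1 ⊗ₜ contract A.ε.toLinearMap x
      + ∑ i, (b i : A) ⊗ₜ[K] contract (A.extZero (b.coord i)) x := by
  induction x with
  | zero => simp
  | tmul a l =>
    simp only [contract_tmul, ← TensorProduct.smul_tmul, ← TensorProduct.sum_tmul,
      ← TensorProduct.add_tmul]
    congr 1
    have h := congrArg Subtype.val (b.sum_repr (A.toM a))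
    rw [AugAlg.coe_toM, eq_sub_iff_add_eq', Algebra.algebraMap_eq_smul_one] at h
    simp only [AddSubmonoidClass.coe_finsetSum, Submodule.coe_smul] at h
    exact h.symm
  | add x y hx hy =>
    conv_lhs => rw [hx, hy]
    simp only [map_add, TensorProduct.tmul_add, Finset.sum_add_distrib]
    abel

/-- The `ξ`-component of `f w` for an `A`-linear map `f` of `A ⊗ L` and `ξ` in `𝔪'`, in terms of
the components of `w` and of the restriction of `f` to `1 ⊗ L`. -/
theorem contract_extZero_apply {ι : Type*} [Fintype ι] (b : Module.Basis ι K A.𝔪)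
    (f : A ⊗[K] L →ₗ[A] A ⊗[K] L) (w : A ⊗[K] L) (ξ : Module.Dual K A.𝔪) :
    contract (A.extZero ξ) (f w)
      = contract (A.extZero ξ) (f (1 ⊗ₜ contract A.ε.toLinearMap w))
        + contract A.ε.toLinearMap (f (1 ⊗ₜ contract (A.extZero ξ) w))
        + ∑ i, ∑ j, ξ (A.mulM (b i) (b j)) •
            contract (A.extZero (b.coord j)) (f (1 ⊗ₜ contract (A.extZero (b.coord i)) w)) := by
  have hsmul : ∀ (i : ι) (x : A ⊗[K] L), contract (A.extZero ξ) ((b i : A) • x)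
      = ξ (b i) • contract A.ε.toLinearMap x
        + ∑ j, ξ (A.mulM (b i) (b j)) • contract (A.extZero (b.coord j)) x := by
    intro i x
    conv_lhs => rw [eq_one_tmul_add_sum b x]
    simp only [smul_add, map_add, Finset.smul_sum, map_sum, TensorProduct.smul_tmul',
      contract_tmul, smul_eq_mul, mul_one, AugAlg.extZero_coe]
    congr 1
    refine Finset.sum_congr rfl fun j _ => ?_
    rw [← AugAlg.extZero_coe]
    rfl
  have hw : contract (A.extZero ξ) w
      = ∑ i, ξ (b i) • contract (A.extZero (b.coord i)) w := by
    conv_lhs => rw [eq_one_tmul_add_sum b w]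
    simp
  conv_lhs => rw [eq_one_tmul_add_sum b w]
  simp only [map_add, map_sum]
  have hb : ∀ (i : ι) (l : L), (b i : A) ⊗ₜ[K] l = (b i : A) • ((1 : A) ⊗ₜ[K] l) :=
    fun i l => tmul_eq_smul _ _
  simp only [hb, map_smul, hsmul,
    Finset.sum_add_distrib]
  rw [add_assoc]
  congr 2
  rw [hw]
  simp only [TensorProduct.tmul_sum, map_sum, TensorProduct.tmul_smul]
  refine Finset.sum_congr rfl fun i _ => ?_
  rw [LinearMap.map_smul_of_tower, map_smul]

theorem lift_ν_of_comm {D : Type*} [AddCommGroup D] [Module K D] (ψ : D →ₗ[K] 𝓛.cochains 2)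
    (t : D ⊗[K] D) (ht : TensorProduct.comm K D D t = t) :
    TensorProduct.lift 𝓛.ν (TensorProduct.map ψ ψ t)
      = (2 : K) • TensorProduct.lift 𝓛.circ (TensorProduct.map ψ ψ t) := by
  have h : ∀ t : D ⊗[K] D, TensorProduct.lift 𝓛.ν (TensorProduct.map ψ ψ t)
      = TensorProduct.lift 𝓛.circ (TensorProduct.map ψ ψ t)
        + TensorProduct.lift 𝓛.circ (TensorProduct.map ψ ψ (TensorProduct.comm K D D t)) := by
    intro t
    induction t with
    | zero => simp
    | tmul x y => simp [ν]
    | add x y hx hy =>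
      simp only [map_add, hx, hy]
      abel
  rw [h, ht, two_smul]

/-- The components of an operation, indexed by `𝔪'`. -/
def componentM (β : Op A L)
    (hβ : ∀ x y, 𝓛.twist A (β x y) = β (𝓛.twist A x) (𝓛.twist A y)) :
    Module.Dual K A.𝔪 →ₗ[K] 𝓛.cochains 2 :=
  𝓛.component β hβ ∘ₗ A.extZero

/-- The components of the Hom-Leibniz defect of an operation lifting the bracket of `𝓛`: writing
`ψ` for the components of the operation, they are `δ ψ + ∘ (ψ ⊗ ψ) ∘ Δ`. -/
theorem contract_defect
    (β : Op A L)
    (hβ : ∀ x y, 𝓛.twist A (β x y) = β (𝓛.twist A x) (𝓛.twist A y))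
    (haug : ∀ x y, contract A.ε.toLinearMap (β x y)
      = 𝓛.br (contract A.ε.toLinearMap x) (contract A.ε.toLinearMap y))
    (ξ : Module.Dual K A.𝔪) :
    (fun l : Fin 3 → L =>
        contract (A.extZero ξ) (𝓛.defect β (1 ⊗ₜ l 0) (1 ⊗ₜ l 1) (1 ⊗ₜ l 2)))
      = 𝓛.δ 2 (𝓛.componentM β hβ ξ).1
        + TensorProduct.lift 𝓛.circ
          (TensorProduct.map (𝓛.componentM β hβ) (𝓛.componentM β hβ) (A.Δ ξ)) := by
  funext l
  have b := Module.finBasis K A.𝔪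
  rw [A.Δ_eq_sum b, Pi.add_apply, δ_two_apply]
  have h₁ := fun x y z : L => contract_extZero_apply b (β (1 ⊗ₜ x)) (β (1 ⊗ₜ y) (1 ⊗ₜ z)) ξ
  have h₂ := fun x y z : L => contract_extZero_apply b (β.flip (1 ⊗ₜ x)) (β (1 ⊗ₜ y) (1 ⊗ₜ z)) ξ
  simp only [LinearMap.flip_apply] at h₂
  simp only [defect, twist_tmul, map_add, map_sub, h₁, h₂, haug, contract_tmul, map_one,
    AlgHom.toLinearMap_apply, one_smul, map_sum, map_smul, TensorProduct.map_tmul,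
    TensorProduct.lift.tmul, Finset.sum_apply, Pi.smul_apply, circ, LinearMap.mk₂_apply, smul_add,
    smul_sub, Finset.sum_add_distrib, Finset.sum_sub_distrib]
  simp only [componentM, LinearMap.comp_apply, component_apply, Matrix.cons_val]
  abel

/-- As `Δ` is cocommutative, the components of the defect are those of the Maurer–Cartan expression
`δ ψ + (1/2) ν ∘ (ψ ⊗ ψ) ∘ Δ`. -/
theorem two_smul_contract_defect
    (β : Op A L)
    (hβ : ∀ x y, 𝓛.twist A (β x y) = β (𝓛.twist A x) (𝓛.twist A y))
    (haug : ∀ x y, contract A.ε.toLinearMap (β x y)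
      = 𝓛.br (contract A.ε.toLinearMap x) (contract A.ε.toLinearMap y))
    (ξ : Module.Dual K A.𝔪) :
    (2 : K) • (fun l : Fin 3 → L =>
        contract (A.extZero ξ) (𝓛.defect β (1 ⊗ₜ l 0) (1 ⊗ₜ l 1) (1 ⊗ₜ l 2)))
      = (2 : K) • 𝓛.δ 2 (𝓛.componentM β hβ ξ).1
        + TensorProduct.lift 𝓛.ν
          (TensorProduct.map (𝓛.componentM β hβ) (𝓛.componentM β hβ) (A.Δ ξ)) := by
  rw [lift_ν_of_comm _ _ _ (A.Δ_cocomm ξ), ← smul_add, contract_defect]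
  exact haug

end MaurerCartan

end HomLeibniz

namespace HomLeibniz

variable {K : Type u} {L : Type v} [Field K] [AddCommGroup L] [Module K L]
variable (𝓛 : HomLeibniz K L)

/-! ### Obstructions -/

section Represents

variable {𝓛} {n : ℕ}

theorem Represents.unique {φ : (Fin n → L) → L} {c c' : 𝓛.H n} (h : 𝓛.Represents φ c)
    (h' : 𝓛.Represents φ c') : c = c' := by
  obtain ⟨_, rfl⟩ := h
  obtain ⟨_, rfl⟩ := h'
  rfl

theorem Represents.smul {φ : (Fin n → L) → L} {c : 𝓛.H n} (r : K) (h : 𝓛.Represents φ c) :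
    𝓛.Represents (r • φ) (r • c) := by
  obtain ⟨h, rfl⟩ := h
  exact ⟨Submodule.smul_mem _ r h, rfl⟩

theorem Represents.add_δ {φ : (Fin 3 → L) → L} {c : 𝓛.H 3} (h : 𝓛.Represents φ c)
    (χ : 𝓛.cochains 2) : 𝓛.Represents (φ + 𝓛.δ 2 χ.1) c := by
  obtain ⟨h, rfl⟩ := h
  refine ⟨Submodule.add_mem _ h (𝓛.δ_two_mem_Z χ), ?_⟩
  refine (Submodule.Quotient.eq _).2 ?_
  rw [Submodule.submoduleOf, Submodule.mem_comap]
  exact ⟨χ.1, χ.2, by simp⟩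

end Represents

section Fiber

variable {A : AugAlg.{u, max u w} K} (s : A.harrH K →ₗ[K] A.harrZ K)

theorem barEval_add (c c' : A.harrH K) :
    AugAlg.barEval s (c + c') = AugAlg.barEval s c + AugAlg.barEval s c' :=
  LinearMap.ext fun a => map_add (AugAlg.Ext.snd (AugAlg.univCocycle s) a) c c'

theorem barEval_smul (r : K) (c : A.harrH K) :
    AugAlg.barEval s (r • c) = r • AugAlg.barEval s c :=
  LinearMap.ext fun a => map_smul (AugAlg.Ext.snd (AugAlg.univCocycle s) a) r c

/-- The inclusion of the kernel `H^2_Harr(A, K)'` of `bar s → A`. -/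
def barInr : Module.Dual K (A.harrH K) →ₗ[K] AugAlg.bar s := AugAlg.Ext.inr (AugAlg.univCocycle s)

/-- The linear section `a ↦ (a, 0)` of `bar s → A`. -/
def barSec : A →ₗ[K] AugAlg.bar s where
  toFun a := (⟨a, 0⟩ : A.Ext (AugAlg.univCocycle s))
  map_add' _ _ := AugAlg.Ext.ext rfl (add_zero _).symm
  map_smul' c _ := AugAlg.Ext.ext rfl (smul_zero c).symm

theorem barSec_mul (a b : A) :
    barSec s a * barSec s b = barSec s (a * b) + barInr s ((AugAlg.univCocycle s).1 a b) := by
  refine AugAlg.Ext.ext (add_zero _).symm ?_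
  change A.ε a • (0 : Module.Dual K (A.harrH K)) + A.ε b • (0 : Module.Dual K (A.harrH K))
    + (AugAlg.univCocycle s).1 a b = 0 + (AugAlg.univCocycle s).1 a b
  simp

theorem mul_barInr (a : AugAlg.bar s) (θ : Module.Dual K (A.harrH K)) :
    a * barInr s θ = (AugAlg.bar s).ε a • barInr s θ := by
  refine AugAlg.Ext.ext ?_ ?_
  · change a.base * 0 = A.ε a.base • 0
    simp
  · change A.ε a.base • θ + A.ε 0 • a.fib + (AugAlg.univCocycle s).1 a.base 0 = A.ε a.base • θ
    rw [AugAlg.Ext.zero_right]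
    simp

theorem exact_barInr : Function.Exact (barInr s) (AugAlg.barProj s).toLinearMap := by
  intro a
  constructor
  · intro h
    exact ⟨a.fib, AugAlg.Ext.ext h.symm rfl⟩
  · rintro ⟨θ, rfl⟩
    rfl

theorem barProj_surjective : Function.Surjective (AugAlg.barProj s) :=
  fun a => ⟨⟨a, 0⟩, rfl⟩

variable {s}

/-- Elements of the kernel of `bar s ⊗ L → A ⊗ L` come from `H^2_Harr(A, K)' ⊗ L`. -/
theorem fiber_induction {m : AugAlg.bar s ⊗[K] L}
    (hm : (AugAlg.barProj s).toLinearMap.rTensor L m = 0)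
    {p : AugAlg.bar s ⊗[K] L → Prop} (zero : p 0)
    (tmul : ∀ θ l, p (barInr s θ ⊗ₜ l)) (add : ∀ x y, p x → p y → p (x + y)) : p m := by
  obtain ⟨t, rfl⟩ := (rTensor_exact L (exact_barInr s) (barProj_surjective s) m).1 hm
  induction t with
  | zero => simpa using zero
  | tmul θ l => exact tmul θ l
  | add x y hx hy =>
    rw [map_add]
    refine add _ _ (hx ?_) (hy ?_)
    all_goals exact (rTensor_exact L (exact_barInr s) (barProj_surjective s) _).2 ⟨_, rfl⟩

theorem smul_fiber {m : AugAlg.bar s ⊗[K] L}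
    (hm : (AugAlg.barProj s).toLinearMap.rTensor L m = 0) (a : AugAlg.bar s) :
    a • m = (AugAlg.bar s).ε a • m := by
  refine fiber_induction (p := fun m => a • m = (AugAlg.bar s).ε a • m) hm ?_ ?_ ?_
  · simp
  · intro θ l
    rw [TensorProduct.smul_tmul', smul_eq_mul, mul_barInr, TensorProduct.smul_tmul']
  · intro x y hx hy
    rw [smul_add, hx, hy, smul_add]

/-- A `bar s`-linear map with values in `H^2_Harr(A, K)' ⊗ L` factors through `ε ⊗ id`. -/
theorem apply_eq_of_fiber (f : AugAlg.bar s ⊗[K] L → AugAlg.bar s ⊗[K] L)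
    (hadd : ∀ x y, f (x + y) = f x + f y) (hsmul : ∀ (a : AugAlg.bar s) x, f (a • x) = a • f x)
    (hf : ∀ x, (AugAlg.barProj s).toLinearMap.rTensor L (f x) = 0) (x : AugAlg.bar s ⊗[K] L) :
    f x = f (1 ⊗ₜ contract (AugAlg.bar s).ε.toLinearMap x) := by
  induction x with
  | zero => simp
  | tmul a l =>
    have h : (1 : AugAlg.bar s) ⊗ₜ[K] contract (AugAlg.bar s).ε.toLinearMap (a ⊗ₜ[K] l)
        = algebraMap K (AugAlg.bar s) ((AugAlg.bar s).ε a) • ((1 : AugAlg.bar s) ⊗ₜ[K] l) := by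
      simp
    rw [h, hsmul, tmul_eq_smul, hsmul, smul_fiber (hf _), smul_fiber (hf _)]
    simp
  | add x y hx hy => rw [hadd, hx, hy, map_add, TensorProduct.tmul_add, hadd]

theorem contract_barEval_fiber (h : A.harrH K) (θ : Module.Dual K (A.harrH K))
    (x : AugAlg.bar s ⊗[K] L) :
    contract (AugAlg.barEval s h) (barInr s θ • x)
      = θ h • contract (AugAlg.bar s).ε.toLinearMap x := by
  induction x with
  | zero => simp
  | tmul a l =>
    rw [TensorProduct.smul_tmul', smul_eq_mul, mul_comm, mul_barInr, contract_tmul, contract_tmul,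
      smul_smul, map_smul]
    congr 1
    exact mul_comm _ _
  | add x y hx hy => rw [smul_add, map_add, hx, hy, map_add, smul_add]

theorem contract_map_fiber (f : AugAlg.bar s ⊗[K] L →ₗ[AugAlg.bar s] AugAlg.bar s ⊗[K] L)
    (g : L →ₗ[K] L) (hf : ∀ x, contract (AugAlg.bar s).ε.toLinearMap (f x)
      = g (contract (AugAlg.bar s).ε.toLinearMap x)) {m : AugAlg.bar s ⊗[K] L}
    (hm : (AugAlg.barProj s).toLinearMap.rTensor L m = 0) (h : A.harrH K) :
    contract (AugAlg.barEval s h) (f m) = g (contract (AugAlg.barEval s h) m) := by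
  refine fiber_induction (p := fun m => contract (AugAlg.barEval s h) (f m)
    = g (contract (AugAlg.barEval s h) m)) hm ?_ ?_ ?_
  · simp
  · intro θ l
    rw [tmul_eq_smul, map_smul, contract_barEval_fiber, contract_barEval_fiber, hf, map_smul]
  · intro x y hx hy
    rw [map_add, map_add, hx, hy, map_add, map_add]

end Fiber

section Lift

variable {A : AugAlg.{u, max u w} K} {s : A.harrH K →ₗ[K] A.harrZ K}

variable (s) in
/-- `β'` is a lifting of the operation `β` along `bar s → A` that commutes with `id ⊗ α`. -/
structure IsLift (β : Op A L) (β' : Op (AugAlg.bar s) L) : Prop where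
  proj : ∀ a b, (AugAlg.barProj s).toLinearMap.rTensor L (β' a b)
    = β ((AugAlg.barProj s).toLinearMap.rTensor L a)
      ((AugAlg.barProj s).toLinearMap.rTensor L b)
  twist_op : ∀ a b, 𝓛.twist _ (β' a b) = β' (𝓛.twist _ a) (𝓛.twist _ b)

/-- The `h`-component of the Hom-Leibniz defect of an operation on `bar s ⊗ L`. -/
def defectAt (β' : Op (AugAlg.bar s) L) (h : A.harrH K) : (Fin 3 → L) → L :=
  fun l => contract (AugAlg.barEval s h) (𝓛.defect β' (1 ⊗ₜ l 0) (1 ⊗ₜ l 1) (1 ⊗ₜ l 2))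

theorem isObstruction_iff {β : Op A L} {ω : A.harrH K →ₗ[K] 𝓛.H 3} :
    𝓛.IsObstruction β s ω ↔
      ∃ β', 𝓛.IsLift s β β' ∧ ∀ h, 𝓛.Represents (𝓛.defectAt β' h) (ω h) :=
  ⟨fun ⟨β', h₁, h₂, h₃⟩ => ⟨β', ⟨h₁, h₂⟩, h₃⟩, fun ⟨β', h, h₃⟩ => ⟨β', h.1, h.2, h₃⟩⟩

variable (s) in
theorem exists_isLift {β : Op A L} (hβ : ∀ x y, 𝓛.twist A (β x y) = β (𝓛.twist A x) (𝓛.twist A y)) :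
    ∃ β', 𝓛.IsLift s β β' := by
  obtain ⟨β', h₁, h₂⟩ := 𝓛.exists_op_of_components (A := AugAlg.bar s)
    (𝓛.component β hβ ∘ₗ LinearMap.lcomp K K (barSec s))
  refine ⟨β', fun x y => ?_, h₁⟩
  rw [pushout_rTensor, eq_pushout]
  intro l l'
  refine contract_ext fun ξ => ?_
  rw [contract_rTensor, h₂, LinearMap.comp_apply, bilin_component]
  rfl

variable {𝓛} {β : Op A L} {β' β'' : Op (AugAlg.bar s) L}

theorem IsLift.contract_ε (h : 𝓛.IsLift s β β') (hβ : 𝓛.IsDeformation A β)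
    (x y : AugAlg.bar s ⊗[K] L) :
    contract (AugAlg.bar s).ε.toLinearMap (β' x y)
      = 𝓛.br (contract (AugAlg.bar s).ε.toLinearMap x)
        (contract (AugAlg.bar s).ε.toLinearMap y) := by
  have e : ∀ x : AugAlg.bar s ⊗[K] L, contract (AugAlg.bar s).ε.toLinearMap x
      = contract A.ε.toLinearMap ((AugAlg.barProj s).toLinearMap.rTensor L x) := fun x => by
    rw [contract_rTensor]
    rfl
  rw [e, e, e, h.proj, hβ.aug]

theorem IsLift.rTensor_defect (h : 𝓛.IsLift s β β') (hβ : 𝓛.IsDeformation A β)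
    (x y z : AugAlg.bar s ⊗[K] L) :
    (AugAlg.barProj s).toLinearMap.rTensor L (𝓛.defect β' x y z) = 0 := by
  rw [𝓛.rTensor_defect _ h.proj, hβ.hom_jacobi]

theorem tmul_smul_eq_algebraMap (B : AugAlg.{u, x} K) (c : K) (l : L) :
    (1 : B) ⊗ₜ[K] (c • l) = algebraMap K B c • ((1 : B) ⊗ₜ[K] l) := by
  simp

/-- On `H^2_Harr(A, K)' ⊗ L` a lifting acts in its second argument as the bracket of `𝓛`, because
`bar s` acts there through the augmentation. -/
theorem IsLift.contract_right (h : 𝓛.IsLift s β β') (hβ : 𝓛.IsDeformation A β)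
    (x : AugAlg.bar s ⊗[K] L) {m : AugAlg.bar s ⊗[K] L}
    (hm : (AugAlg.barProj s).toLinearMap.rTensor L m = 0) (c : A.harrH K) :
    contract (AugAlg.barEval s c) (β' x m) = 𝓛.br (contract (AugAlg.bar s).ε.toLinearMap x)
      (contract (AugAlg.barEval s c) m) :=
  contract_map_fiber (β' x) _ (fun y => h.contract_ε hβ x y) hm c

theorem IsLift.contract_left (h : 𝓛.IsLift s β β') (hβ : 𝓛.IsDeformation A β)
    (x : AugAlg.bar s ⊗[K] L) {m : AugAlg.bar s ⊗[K] L}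
    (hm : (AugAlg.barProj s).toLinearMap.rTensor L m = 0) (c : A.harrH K) :
    contract (AugAlg.barEval s c) (β' m x) = 𝓛.br (contract (AugAlg.barEval s c) m)
      (contract (AugAlg.bar s).ε.toLinearMap x) :=
  contract_map_fiber (β'.flip x) (𝓛.br.flip _) (fun y => h.contract_ε hβ y x) hm c

/-- The defect has values in `H^2_Harr(A, K)' ⊗ L`, so it depends on each of its arguments only
through the augmentation. -/
theorem IsLift.defect_left (h : 𝓛.IsLift s β β') (hβ : 𝓛.IsDeformation A β)
    (x y z : AugAlg.bar s ⊗[K] L) :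
    𝓛.defect β' x y z = 𝓛.defect β' (1 ⊗ₜ contract (AugAlg.bar s).ε.toLinearMap x) y z :=
  apply_eq_of_fiber (fun x => 𝓛.defect β' x y z) (fun _ _ => 𝓛.defect_add_left _ _ _ _ _)
    (fun a x => by simpa using 𝓛.defect_smul β' a 1 1 x y z) (fun _ => h.rTensor_defect hβ _ _ _) x

theorem IsLift.defect_middle (h : 𝓛.IsLift s β β') (hβ : 𝓛.IsDeformation A β)
    (x y z : AugAlg.bar s ⊗[K] L) :
    𝓛.defect β' x y z = 𝓛.defect β' x (1 ⊗ₜ contract (AugAlg.bar s).ε.toLinearMap y) z :=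
  apply_eq_of_fiber (fun y => 𝓛.defect β' x y z) (fun _ _ => 𝓛.defect_add_middle _ _ _ _ _)
    (fun a y => by simpa using 𝓛.defect_smul β' 1 a 1 x y z) (fun _ => h.rTensor_defect hβ _ _ _) y

theorem IsLift.defect_right (h : 𝓛.IsLift s β β') (hβ : 𝓛.IsDeformation A β)
    (x y z : AugAlg.bar s ⊗[K] L) :
    𝓛.defect β' x y z = 𝓛.defect β' x y (1 ⊗ₜ contract (AugAlg.bar s).ε.toLinearMap z) :=
  apply_eq_of_fiber (fun z => 𝓛.defect β' x y z) (fun _ _ => 𝓛.defect_add_right _ _ _ _ _)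
    (fun a z => by simpa using 𝓛.defect_smul β' 1 1 a x y z) (fun _ => h.rTensor_defect hβ _ _ _) z

/-- The components of the defect of a lifting are cocycles, by the Bianchi identity. -/
theorem IsLift.defectAt_mem_Z (h : 𝓛.IsLift s β β') (hβ : 𝓛.IsDeformation A β)
    (c : A.harrH K) : 𝓛.defectAt β' c ∈ 𝓛.Z 3 := by
  have smul₁ := fun (a : AugAlg.bar s) x y z => by
    simpa using 𝓛.defect_smul β' a 1 1 x y z
  have smul₂ := fun (a : AugAlg.bar s) x y z => by
    simpa using 𝓛.defect_smul β' 1 a 1 x y z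
  have smul₃ := fun (a : AugAlg.bar s) x y z => by
    simpa using 𝓛.defect_smul β' 1 1 a x y z
  refine ⟨?_, LinearMap.mem_ker.2 (funext fun l => ?_)⟩
  · refine 𝓛.mem_cochains_three (fun x y z => contract (AugAlg.barEval s c)
      (𝓛.defect β' (1 ⊗ₜ x) (1 ⊗ₜ y) (1 ⊗ₜ z))) ?_ ?_ ?_ ?_
    · intro r x x' y z
      rw [TensorProduct.tmul_add, defect_add_left, tmul_smul_eq_algebraMap, smul₁,
        algebraMap_smul, map_add, map_smul]
    · intro r x y y' z
      rw [TensorProduct.tmul_add, defect_add_middle, tmul_smul_eq_algebraMap, smul₂,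
        algebraMap_smul, map_add, map_smul]
    · intro r x y z z'
      rw [TensorProduct.tmul_add, defect_add_right, tmul_smul_eq_algebraMap, smul₃,
        algebraMap_smul, map_add, map_smul]
    · intro x y z
      rw [← contract_twist]
      simp only [defect, map_add, map_sub, h.twist_op, twist_tmul]
  · have hD := h.rTensor_defect hβ
    have hB := congrArg (contract (AugAlg.barEval s c)) (bianchi β' (𝓛.twist _) h.twist_op
      (𝓛.defect β') (fun _ _ _ => rfl) (1 ⊗ₜ l 0) (1 ⊗ₜ l 1) (1 ⊗ₜ l 2) (1 ⊗ₜ l 3))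
    -- inside the defect every bracket may be replaced by `1 ⊗ [·, ·]`, outside it `β'` acts as the
    -- bracket of `𝓛`; the Bianchi identity becomes the cocycle condition
    rw [h.defect_left hβ (β' _ _), h.defect_left hβ (β' _ _), h.defect_left hβ (β' _ _),
      h.defect_middle hβ _ (β' _ _), h.defect_middle hβ _ (β' _ _),
      h.defect_right hβ _ _ (β' _ _)] at hB
    simp only [map_add, map_sub, h.contract_right hβ _ (hD _ _ _), h.contract_left hβ _ (hD _ _ _),
      h.contract_ε hβ, twist_tmul, contract_tmul, AlgHom.toLinearMap_apply, map_one, one_smul,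
      map_zero] at hB
    rw [δ_three_apply]
    exact hB

/-- The defects of two liftings differ by a coboundary. -/
theorem IsLift.defectAt_sub (h : 𝓛.IsLift s β β') (h' : 𝓛.IsLift s β β'')
    (hβ : 𝓛.IsDeformation A β) (c : A.harrH K) :
    𝓛.defectAt β' c = 𝓛.defectAt β'' c + 𝓛.δ 2 (𝓛.component β' h.twist_op (AugAlg.barEval s c)
      - 𝓛.component β'' h'.twist_op (AugAlg.barEval s c)).1 := by
  obtain ⟨γ, hγ'⟩ : ∃ γ : Op (AugAlg.bar s) L, ∀ x y, γ x y = β' x y - β'' x y :=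
    ⟨LinearMap.mk₂ (AugAlg.bar s) (fun x y => β' x y - β'' x y)
      (fun _ _ _ => by simp only [map_add, LinearMap.add_apply]; abel)
      (fun _ _ _ => by simp only [map_smul, LinearMap.smul_apply, smul_sub])
      (fun _ _ _ => by simp only [map_add]; abel)
      (fun _ _ _ => by simp only [map_smul, smul_sub]), fun _ _ => rfl⟩
  have hγ : ∀ x y, (AugAlg.barProj s).toLinearMap.rTensor L (γ x y) = 0 := fun x y => by
    rw [hγ', map_sub, h.proj, h'.proj, sub_self]
  have hD : ∀ x y z, 𝓛.defect β' x y z = 𝓛.defect β'' x y z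
      + (β' (𝓛.twist _ x) (γ y z) + γ (𝓛.twist _ x) (β'' y z))
      - (β' (γ x y) (𝓛.twist _ z) + γ (β'' x y) (𝓛.twist _ z))
      + (β' (γ x z) (𝓛.twist _ y) + γ (β'' x z) (𝓛.twist _ y)) := by
    intro x y z
    have hl : ∀ u v w, β' (u - v) w = β' u w - β' v w := fun u v w => map_sub (β'.flip w) u v
    simp only [defect, hγ', hl]
    simp only [map_sub]
    abel
  -- the difference `γ = β' - β''` has values in `H^2_Harr(A, K)' ⊗ L`, so it factors through `ε`
  -- in both arguments
  have f₁ : ∀ x y, γ x y = γ (1 ⊗ₜ contract _ x) y := fun x y =>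
    apply_eq_of_fiber (fun x => γ x y) (fun _ _ => by rw [map_add, LinearMap.add_apply])
      (fun _ _ => by rw [map_smul, LinearMap.smul_apply]) (fun _ => hγ _ _) x
  have f₂ : ∀ x y, γ x y = γ x (1 ⊗ₜ contract _ y) := fun x y =>
    apply_eq_of_fiber (fun y => γ x y) (map_add _) (map_smul _) (fun _ => hγ _ _) y
  funext l
  rw [Pi.add_apply, δ_two_apply]
  simp only [defectAt, hD]
  rw [f₂ _ (β'' _ _), f₁ (β'' _ _), f₁ (β'' _ _)]
  simp only [map_add, map_sub, h.contract_right hβ _ (hγ _ _), h.contract_left hβ _ (hγ _ _),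
      h'.contract_ε hβ, twist_tmul, contract_tmul, AlgHom.toLinearMap_apply, map_one, one_smul]
  simp only [hγ', map_sub, AddSubgroupClass.coe_sub, Pi.sub_apply, component_apply,
    Matrix.cons_val]
  abel

/-- The components of the defect of an arbitrary lifting represent the obstruction classes. -/
theorem IsObstruction.represents {ω : A.harrH K →ₗ[K] 𝓛.H 3} (hω : 𝓛.IsObstruction β s ω)
    (hβ : 𝓛.IsDeformation A β) (h : 𝓛.IsLift s β β') (c : A.harrH K) :
    𝓛.Represents (𝓛.defectAt β' c) (ω c) := by
  obtain ⟨β'', h', hω⟩ := 𝓛.isObstruction_iff.1 hω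
  rw [h.defectAt_sub h' hβ]
  exact (hω c).add_δ _

theorem IsLift.exists_isObstruction (h : 𝓛.IsLift s β β') (hβ : 𝓛.IsDeformation A β) :
    ∃ ω, 𝓛.IsObstruction β s ω := by
  let f : A.harrH K →ₗ[K] 𝓛.Z 3 :=
    { toFun := fun c => ⟨𝓛.defectAt β' c, h.defectAt_mem_Z hβ c⟩
      map_add' := fun c c' => Subtype.ext <| funext fun l => by
        simp [defectAt, barEval_add, contract_add]
      map_smul' := fun r c => Subtype.ext <| funext fun l => by
        simp [defectAt, barEval_smul, contract_smul] }
  exact ⟨Submodule.mkQ _ ∘ₗ f, 𝓛.isObstruction_iff.2 ⟨β', h, fun c => ⟨_, rfl⟩⟩⟩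

variable (s) in
theorem existsUnique_isObstruction (hβ : 𝓛.IsDeformation A β) :
    ∃! ω, 𝓛.IsObstruction β s ω := by
  obtain ⟨β', h⟩ := 𝓛.exists_isLift s hβ.twist_op
  obtain ⟨ω, hω⟩ := h.exists_isObstruction hβ
  exact ⟨ω, hω, fun ω' hω' => LinearMap.ext fun c =>
    (hω'.represents hβ h c).unique (hω.represents hβ h c)⟩

end Lift

end HomLeibniz

namespace HomLeibniz

variable {K : Type u} {L : Type v} [Field K] [AddCommGroup L] [Module K L]
variable (𝓛 : HomLeibniz K L)

/-! ### The universal infinitesimal deformation -/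

theorem contract_ε_defect {A : AugAlg.{u, w} K} {β : Op A L}
    (haug : ∀ x y, contract A.ε.toLinearMap (β x y)
      = 𝓛.br (contract A.ε.toLinearMap x) (contract A.ε.toLinearMap y)) (x y z : A ⊗[K] L) :
    contract A.ε.toLinearMap (𝓛.defect β x y z) = 0 := by
  simp only [defect, map_add, map_sub, haug, contract_twist, hom_jacobi]
  abel

/-- The Hom-Leibniz identity needs to be checked on the components in `𝔪'` only. -/
theorem defect_eq_zero_of_extZero {A : AugAlg.{u, w} K} {β : Op A L}
    (haug : ∀ x y, contract A.ε.toLinearMap (β x y)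
      = 𝓛.br (contract A.ε.toLinearMap x) (contract A.ε.toLinearMap y))
    (h : ∀ (ξ : Module.Dual K A.𝔪) (x y z : L),
      contract (A.extZero ξ) (𝓛.defect β (1 ⊗ₜ x) (1 ⊗ₜ y) (1 ⊗ₜ z)) = 0) (x y z : A ⊗[K] L) :
    𝓛.defect β x y z = 0 := by
  refine 𝓛.defect_eq_zero (fun x y z => contract_ext fun ξ => ?_) x y z
  rw [A.eq_extZero_add ξ, contract_add, contract_smul, h, 𝓛.contract_ε_defect haug]
  simp

section Infinitesimal

variable [FiniteDimensional K (𝓛.H 2)]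

theorem evalC₁_apply (h : 𝓛.H 2) (a : 𝓛.C₁) :
    𝓛.evalC₁ h a = TrivSqZeroExt.snd (R := K) (M := Module.Dual K (𝓛.H 2)) a h := rfl

@[simp] theorem evalC₁_one (h : 𝓛.H 2) : 𝓛.evalC₁ h 1 = 0 := by
  rw [evalC₁_apply]
  exact LinearMap.congr_fun (TrivSqZeroExt.snd_one (R := K) (M := Module.Dual K (𝓛.H 2))) h

theorem evalC₁_mul (h : 𝓛.H 2) (a b : 𝓛.C₁) :
    𝓛.evalC₁ h (a * b) = 𝓛.C₁.ε a * 𝓛.evalC₁ h b + 𝓛.C₁.ε b * 𝓛.evalC₁ h a := by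
  rw [evalC₁_apply]
  refine (LinearMap.congr_fun
    (TrivSqZeroExt.snd_mul (R := K) (M := Module.Dual K (𝓛.H 2)) a b) h).trans ?_
  rw [op_smul_eq_smul]
  rfl

theorem exists_eq_evalC₁ (ξ : Module.Dual K 𝓛.C₁) :
    ∃ h, ξ = ξ 1 • 𝓛.C₁.ε.toLinearMap + 𝓛.evalC₁ h := by
  refine ⟨(Module.evalEquiv K (𝓛.H 2)).symm (ξ ∘ₗ 𝓛.inrC₁), LinearMap.ext fun a => ?_⟩
  have ha : a = 𝓛.C₁.ε a • (1 : 𝓛.C₁)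
      + 𝓛.inrC₁ (TrivSqZeroExt.snd (R := K) (M := Module.Dual K (𝓛.H 2)) a) := by
    refine TrivSqZeroExt.ext ?_ ?_
    · change a.fst = a.fst • (1 : K) + 0
      simp
    · change a.snd = a.fst • (0 : Module.Dual K (𝓛.H 2)) + a.snd
      simp
  have key : ∀ θ : Module.Dual K (𝓛.H 2),
      θ ((Module.evalEquiv K (𝓛.H 2)).symm (ξ ∘ₗ 𝓛.inrC₁)) = ξ (𝓛.inrC₁ θ) := fun θ => by
    rw [Module.apply_evalEquiv_symm_apply]
    rfl
  conv_lhs => rw [ha]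
  rw [map_add, map_smul, ← key, LinearMap.add_apply, evalC₁_apply, LinearMap.smul_apply]
  simp only [smul_eq_mul, AlgHom.toLinearMap_apply]
  rw [mul_comm]

theorem contract_eval_symm {V : Type*} [AddCommGroup V] [Module K V] [FiniteDimensional K V]
    (h : V) (f : V →ₗ[K] L) :
    TensorProduct.lid K L ((Module.Dual.eval K V h).rTensor L
      ((dualTensorHomEquiv K V L).symm f)) = f h := by
  have key : ∀ t : Module.Dual K V ⊗[K] L,
      TensorProduct.lid K L ((Module.Dual.eval K V h).rTensor L t)
        = dualTensorHom K V L t h := by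
    intro t
    induction t with
    | zero => simp
    | tmul θ l => simp
    | add x y hx hy => simp only [map_add, hx, hy, LinearMap.add_apply]
  rw [key]
  exact LinearMap.congr_fun ((dualTensorHomEquiv K V L).apply_symm_apply f) h

theorem contract_ε_eta₁ (μ : 𝓛.H 2 →ₗ[K] 𝓛.Z 2) (l l' : L) :
    contract 𝓛.C₁.ε.toLinearMap (𝓛.eta₁ μ (1 ⊗ₜ l) (1 ⊗ₜ l')) = 𝓛.br l l' := by
  have h : 𝓛.C₁.ε.toLinearMap ∘ₗ 𝓛.inrC₁ = 0 := rfl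
  simp only [eta₁, opOf_tmul, LinearMap.mk₂_apply, mul_one, one_smul, map_add, contract_tmul,
    AlgHom.toLinearMap_apply, map_one]
  rw [contract, LinearMap.comp_apply, ← LinearMap.comp_apply (LinearMap.rTensor _ _),
    ← LinearMap.rTensor_comp, h]
  simp

theorem contract_eval_eta₁ (μ : 𝓛.H 2 →ₗ[K] 𝓛.Z 2) (h : 𝓛.H 2) (l l' : L) :
    contract (𝓛.evalC₁ h) (𝓛.eta₁ μ (1 ⊗ₜ l) (1 ⊗ₜ l')) = (μ h).1 ![l, l'] := by
  have e : 𝓛.evalC₁ h ∘ₗ 𝓛.inrC₁ = Module.Dual.eval K (𝓛.H 2) h := rfl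
  simp only [eta₁, opOf_tmul, LinearMap.mk₂_apply, mul_one, one_smul, map_add, contract_tmul,
    evalC₁_one, zero_smul, zero_add]
  rw [contract, LinearMap.comp_apply, ← LinearMap.comp_apply (LinearMap.rTensor _ _),
    ← LinearMap.rTensor_comp, e]
  exact contract_eval_symm _ _

/-- An operation on `C_1 ⊗ L` is determined by its components at `ε` and at the classes of `H`. -/
theorem op_C₁_ext {β β' : Op 𝓛.C₁ L}
    (h₀ : ∀ l l' : L, contract 𝓛.C₁.ε.toLinearMap (β (1 ⊗ₜ l) (1 ⊗ₜ l'))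
      = contract 𝓛.C₁.ε.toLinearMap (β' (1 ⊗ₜ l) (1 ⊗ₜ l')))
    (h₁ : ∀ h (l l' : L), contract (𝓛.evalC₁ h) (β (1 ⊗ₜ l) (1 ⊗ₜ l'))
      = contract (𝓛.evalC₁ h) (β' (1 ⊗ₜ l) (1 ⊗ₜ l'))) : β = β' := by
  refine op_ext fun l l' => contract_ext fun ξ => ?_
  obtain ⟨h, hξ⟩ := 𝓛.exists_eq_evalC₁ ξ
  rw [hξ, contract_add, contract_add, contract_smul, contract_smul, h₀, h₁]

theorem isDeformation_eta₁ (μ : 𝓛.H 2 →ₗ[K] 𝓛.Z 2) : 𝓛.IsDeformation 𝓛.C₁ (𝓛.eta₁ μ) := by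
  have haug := 𝓛.aug_of_tmul (𝓛.contract_ε_eta₁ μ)
  have htw : ∀ x y, 𝓛.twist _ (𝓛.eta₁ μ x y) = 𝓛.eta₁ μ (𝓛.twist _ x) (𝓛.twist _ y) := by
    refine 𝓛.twist_op_of_tmul fun l l' => contract_ext fun ξ => ?_
    obtain ⟨h, hξ⟩ := 𝓛.exists_eq_evalC₁ ξ
    rw [contract_twist, hξ, contract_add, contract_add, contract_smul, contract_smul,
      contract_ε_eta₁, contract_ε_eta₁, contract_eval_eta₁, contract_eval_eta₁, map_add, map_smul,
      α_br]
    congr 1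
    exact 𝓛.α_bilin ⟨_, (μ h).2.1⟩ l l'
  refine ⟨𝓛.defect_eq_zero_of_extZero haug fun ξ x y z => ?_, htw, haug⟩
  have hΔ : 𝓛.C₁.Δ ξ = 0 := by
    apply AugAlg.dualDistrib_injective
    refine TensorProduct.ext' fun a b => ?_
    have hab : 𝓛.C₁.mulM a b = 0 := by
      refine Subtype.ext (TrivSqZeroExt.ext ?_ (LinearMap.ext fun h => ?_))
      · change 𝓛.C₁.ε a * 𝓛.C₁.ε b = 0
        rw [show 𝓛.C₁.ε a = 0 from a.2, zero_mul]
      · refine (𝓛.evalC₁_mul h a b).trans ?_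
        rw [show 𝓛.C₁.ε a = 0 from a.2, show 𝓛.C₁.ε b = 0 from b.2, zero_mul, zero_mul, add_zero]
        rfl
    rw [AugAlg.dualDistrib_Δ, hab]
    simp
  have hδ : 𝓛.δ 2 (𝓛.componentM (𝓛.eta₁ μ) htw ξ).1 = 0 := by
    obtain ⟨h, hξ⟩ := 𝓛.exists_eq_evalC₁ (𝓛.C₁.extZero ξ)
    rw [AugAlg.extZero_one, zero_smul, zero_add] at hξ
    have : (𝓛.componentM (𝓛.eta₁ μ) htw ξ).1 = (μ h).1 := by
      funext l
      rw [componentM, LinearMap.comp_apply, hξ, component_apply, contract_eval_eta₁]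
      exact congrArg (μ h).1 (by funext i; fin_cases i <;> rfl)
    rw [this]
    exact LinearMap.mem_ker.1 (μ h).2.2
  have key := congrFun (𝓛.contract_defect (𝓛.eta₁ μ) htw haug ξ) ![x, y, z]
  rw [hδ, hΔ] at key
  simpa using key

end Infinitesimal

/-! ### The stages of the construction -/

section Harrison

variable {A : AugAlg.{u, max u w} K} {s : A.harrH K →ₗ[K] A.harrZ K}

/-- A functional on `bar s` that kills the products of elements of the augmentation ideal vanishes
on `H^2_Harr(A, K)'`: otherwise it would exhibit a representative `s h` as a coboundary. -/
theorem apply_barInr_eq_zero (hs : ∀ h, Submodule.Quotient.mk (s h) = h)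
    (ξ : AugAlg.bar s →ₗ[K] K)
    (hξ : ∀ a b, (AugAlg.bar s).ε a = 0 → (AugAlg.bar s).ε b = 0 → ξ (a * b) = 0)
    (θ : Module.Dual K (A.harrH K)) : ξ (barInr s θ) = 0 := by
  obtain ⟨h, hh⟩ : ∃ h : A.harrH K, ∀ θ, ξ (barInr s θ) = θ h := by
    refine ⟨(Module.evalEquiv K (A.harrH K)).symm (ξ ∘ₗ barInr s), fun θ => ?_⟩
    rw [Module.apply_evalEquiv_symm_apply]
    rfl
  let G : A →ₗ[K] K := ξ ∘ₗ barSec s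
  have hG : ∀ a b, A.ε a = 0 → A.ε b = 0 → (s h).1 a b = -G (a * b) := by
    intro a b ha hb
    have h₁ := hξ (barSec s a) (barSec s b) ha hb
    rw [barSec_mul, map_add, hh] at h₁
    exact eq_neg_of_add_eq_zero_right h₁
  have hh0 : h = 0 := by
    rw [← hs h]
    refine (Submodule.Quotient.mk_eq_zero _).2 ?_
    change (s h).1 ∈ LinearMap.range (A.harrD K)
    -- the cocycle need not be normalized: the multiple of `ε` accounts for its value at `(1, 1)`
    refine ⟨G ∘ₗ (A.𝔪.subtype ∘ₗ A.toM) + (s h).1 1 1 • A.ε.toLinearMap, ?_⟩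
    funext a b
    have hone : ∀ z : A.𝔪, (s h).1 1 z = 0 := fun z => by
      rw [AugAlg.Ext.one_left, show A.ε z = 0 from z.2, zero_smul]
    have hone' : ∀ z : A.𝔪, (s h).1 z 1 = 0 := fun z => by rw [AugAlg.Ext.comm, hone]
    have ha : a = A.toM a + A.ε a • (1 : A) := by
      rw [AugAlg.coe_toM, Algebra.algebraMap_eq_smul_one, sub_add_cancel]
    have hb : b = A.toM b + A.ε b • (1 : A) := by
      rw [AugAlg.coe_toM, Algebra.algebraMap_eq_smul_one, sub_add_cancel]
    have hab : (A.toM (a * b) : A)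
        = A.toM a * A.toM b + A.ε b • (A.toM a : A) + A.ε a • (A.toM b : A) := by
      simp only [AugAlg.coe_toM, map_mul, Algebra.smul_def]
      ring
    have hs' : (s h).1 a b = -G (A.toM a * A.toM b) + A.ε a * (A.ε b * (s h).1 1 1) := by
      conv_lhs => rw [ha, hb]
      simp only [AugAlg.Ext.add_left, AugAlg.Ext.add_right, AugAlg.Ext.smul_left,
        AugAlg.Ext.smul_right, hone, hone', hG _ _ (A.toM a).2 (A.toM b).2, smul_eq_mul]
      ring
    change A.ε a * (G (A.toM b) + (s h).1 1 1 * A.ε b)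
      - (G (A.toM (a * b)) + (s h).1 1 1 * A.ε (a * b))
      + A.ε b * (G (A.toM a) + (s h).1 1 1 * A.ε a) = (s h).1 a b
    rw [hab, hs', map_mul]
    simp only [map_add, map_smul, smul_eq_mul]
    ring
  rw [hh, hh0, map_zero]

end Harrison

variable [FiniteDimensional K (𝓛.H 2)]

/-- The properties of the stages `(C_k, η_k)` on which the argument rests: `C_k → C_1` is a
surjective map of augmented algebras, `C_k` is local with nilpotent augmentation ideal `𝔪`, the
space `(𝔪 / 𝔪^2)'` is that of `C_1`, and `η_k` is a deformation extending `η_1`. -/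
structure StageInvariant (μ : 𝓛.H 2 →ₗ[K] 𝓛.Z 2) (A : AugAlg.{u, max u v} K)
    (π : A →ₐ[K] 𝓛.C₁) (η : Op A L) : Prop where
  surjective : Function.Surjective π
  comp_eq : 𝓛.C₁.ε.comp π = A.ε
  nilpotent : ∀ a, A.ε a = 0 → IsNilpotent a
  exists_evalC₁ : ∀ ξ : A →ₗ[K] K, (∀ a b, A.ε a = 0 → A.ε b = 0 → ξ (a * b) = 0) →
    ∃ h, ∀ a, A.ε a = 0 → ξ a = 𝓛.evalC₁ h (π a)
  isDeformation : 𝓛.IsDeformation A η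
  pushout_eq : pushout π η = 𝓛.eta₁ μ

theorem nilpotent_bar {A : AugAlg.{u, max u w} K} {s : A.harrH K →ₗ[K] A.harrZ K}
    (h : ∀ a, A.ε a = 0 → IsNilpotent a) (a : AugAlg.bar s) (ha : (AugAlg.bar s).ε a = 0) :
    IsNilpotent a := by
  obtain ⟨n, hn⟩ := h (AugAlg.barProj s a) ha
  refine ⟨n + 1, ?_⟩
  rw [← map_pow] at hn
  obtain ⟨θ, hθ⟩ := (exact_barInr s _).1 hn
  rw [pow_succ', ← hθ, mul_barInr, ha, zero_smul]

theorem pushout_comp {A : AugAlg.{u, w} K} {B : AugAlg.{u, x} K} {C : AugAlg.{u, x} K}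
    (φ : A →ₐ[K] B) (χ : B →ₐ[K] C) (β : Op A L) :
    pushout (χ.comp φ) β = pushout χ (pushout φ β) := by
  refine eq_pushout _ _ _ fun l l' => ?_
  rw [pushout_tmul, pushout_tmul, ← LinearMap.comp_apply, ← LinearMap.rTensor_comp]
  rfl

theorem IsStage.stageInvariant {μ : 𝓛.H 2 →ₗ[K] 𝓛.Z 2} {k : ℕ} {A : AugAlg.{u, max u v} K}
    {π : A →ₐ[K] 𝓛.C₁} {η : Op A L} (hη : 𝓛.IsStage μ k A π η) :
    𝓛.StageInvariant μ A π η := by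
  induction hη with
  | one =>
    refine ⟨Function.surjective_id, rfl, fun a ha => ⟨2, ?_⟩, fun ξ _ => ?_,
      𝓛.isDeformation_eta₁ μ, eq_pushout _ _ _ fun l l' => ?_⟩
    · rw [pow_two]
      refine TrivSqZeroExt.ext ?_ ?_
      · change 𝓛.C₁.ε a * 𝓛.C₁.ε a = 0
        rw [ha, zero_mul]
      · refine LinearMap.ext fun h => (𝓛.evalC₁_mul h a a).trans ?_
        rw [ha, zero_mul, add_zero]
        rfl
    · obtain ⟨h, hξ⟩ := 𝓛.exists_eq_evalC₁ ξ
      refine ⟨h, fun a ha => ?_⟩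
      rw [hξ, LinearMap.add_apply, LinearMap.smul_apply, AlgHom.toLinearMap_apply, ha]
      simp
    · exact LinearMap.rTensor_id_apply _ _ _
  | @succ k A π η hη s hs ω hω η' hη' hpush ih =>
    have hmk := Ideal.Quotient.mk_surjective (I := AugAlg.obsIdeal s ω)
    refine ⟨ih.surjective.comp ?_, ?_, fun a ha => ?_, fun ξ hξ => ?_, hη', ?_⟩
    · intro a
      obtain ⟨b, hb⟩ := barProj_surjective s a
      exact ⟨Ideal.Quotient.mk _ b, hb⟩
    · rw [← AlgHom.comp_assoc, ih.comp_eq]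
      rfl
    · obtain ⟨b, rfl⟩ := hmk a
      exact (nilpotent_bar ih.nilpotent b ha).map (Ideal.Quotient.mk (AugAlg.obsIdeal s ω))
    · let ζ : AugAlg.bar s →ₗ[K] K := ξ ∘ₗ (Ideal.Quotient.mkₐ K (AugAlg.obsIdeal s ω)).toLinearMap
      have hζ : ∀ a b, (AugAlg.bar s).ε a = 0 → (AugAlg.bar s).ε b = 0 → ζ (a * b) = 0 :=
        fun a b ha hb => hξ (Ideal.Quotient.mk _ a) (Ideal.Quotient.mk _ b) ha hb
      -- a functional on `C_{k+1}` that kills `𝔪^2` comes from `C_k`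
      have hζ0 : ∀ a b, AugAlg.barProj s a = AugAlg.barProj s b → ζ a = ζ b := by
        intro a b hab
        rw [← sub_eq_zero, ← map_sub] at hab
        obtain ⟨θ, hθ⟩ := (exact_barInr s (a - b)).1 hab
        rw [← sub_eq_zero, ← map_sub, ← hθ]
        exact apply_barInr_eq_zero hs ζ hζ θ
      obtain ⟨h, hh⟩ := ih.exists_evalC₁ (ζ ∘ₗ barSec s) fun a b ha hb =>
        (hζ0 (barSec s (a * b)) (barSec s a * barSec s b) rfl).trans (hζ _ _ ha hb)
      refine ⟨h, fun a ha => ?_⟩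
      obtain ⟨b, rfl⟩ := hmk a
      exact (hζ0 b (barSec s (AugAlg.barProj s b)) rfl).trans (hh _ ha)
    · rw [pushout_comp, hpush, ih.pushout_eq]

end HomLeibniz

namespace HomLeibniz

variable {K : Type u} {L : Type v} [Field K] [AddCommGroup L] [Module K L]
variable (𝓛 : HomLeibniz K L)

/-! ### Gauge transformations -/

section Gauge

variable {B : AugAlg.{u, w} K}

/-- The endomorphism `∑ mᵢ ⊗ γᵢ` of `B ⊗ L`. -/
def gauge {ι : Type*} [Fintype ι] (m : ι → B) (γ : ι → L →ₗ[K] L) :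
    Module.End B (B ⊗[K] L) :=
  ∑ i, m i • (γ i).baseChange B

variable {ι : Type*} [Fintype ι] (m : ι → B) (γ : ι → L →ₗ[K] L)

theorem gauge_apply (x : B ⊗[K] L) : gauge m γ x = ∑ i, m i • (γ i).baseChange B x := by
  simp [gauge]

theorem contract_baseChange (ξ : B →ₗ[K] K) (f : L →ₗ[K] L) (x : B ⊗[K] L) :
    contract ξ (f.baseChange B x) = f (contract ξ x) := by
  induction x with
  | zero => simp
  | tmul a l => simp
  | add x y hx hy => simp only [map_add, hx, hy]

variable {m} in
theorem isNilpotent_gauge (hm : ∀ i, B.ε (m i) = 0) (hB : ∀ a, B.ε a = 0 → IsNilpotent a) :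
    IsNilpotent (gauge m γ) := by
  have : IsArtinianRing B := IsArtinianRing.of_finite K B
  obtain ⟨n, hn⟩ := IsArtinianRing.isNilpotent_nilradical (R := B)
  have key : ∀ k, ∀ x : B ⊗[K] L,
      (gauge m γ ^ k) x ∈ nilradical B ^ k • (⊤ : Submodule B (B ⊗[K] L)) := by
    intro k
    induction k with
    | zero => intro x; simp
    | succ k ih =>
      intro x
      rw [pow_succ' (gauge m γ), Module.End.mul_apply, gauge_apply]
      refine Submodule.sum_mem _ fun i _ => ?_
      rw [pow_succ', ← smul_eq_mul, Submodule.smul_assoc]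
      refine Submodule.smul_mem_smul (mem_nilradical.2 (hB _ (hm i))) ?_
      have h := Submodule.mem_map_of_mem (f := (γ i).baseChange B) (ih x)
      rw [Submodule.map_smul''] at h
      exact Submodule.smul_mono le_rfl le_top h
  refine ⟨n, LinearMap.ext fun x => ?_⟩
  have h := key n x
  rw [hn] at h
  simpa using h

variable {m} in
theorem contract_ε_gauge (hm : ∀ i, B.ε (m i) = 0) (x : B ⊗[K] L) :
    contract B.ε.toLinearMap (gauge m γ x) = 0 := by
  simp [gauge_apply, contract_ε_smul, hm]

theorem twist_gauge (hγ : ∀ i l, 𝓛.α (γ i l) = γ i (𝓛.α l)) (x : B ⊗[K] L) :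
    𝓛.twist B (gauge m γ x) = gauge m γ (𝓛.twist B x) := by
  have h : ∀ i (x : B ⊗[K] L), 𝓛.twist B ((γ i).baseChange B x)
      = (γ i).baseChange B (𝓛.twist B x) := by
    intro i x
    induction x with
    | zero => simp
    | tmul a l => simp [hγ]
    | add x y hx hy => simp only [map_add, hx, hy]
  simp only [gauge_apply, map_sum, map_smul, h]

/-- The rule for a functional `E` that is a derivation over `ε`. -/
theorem contract_deriv_smul {E : B →ₗ[K] K} (hE : ∀ a b, E (a * b) = B.ε a * E b + B.ε b * E a)
    (a : B) (x : B ⊗[K] L) :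
    contract E (a • x) = B.ε a • contract E x + E a • contract B.ε.toLinearMap x := by
  induction x with
  | zero => simp
  | tmul b l =>
    simp only [TensorProduct.smul_tmul', contract_tmul, smul_eq_mul, hE, add_smul, mul_smul,
      AlgHom.toLinearMap_apply]
    rw [smul_comm (B.ε b)]
  | add x y hx hy =>
    simp only [smul_add, map_add, hx, hy]
    abel

theorem contract_deriv_gauge {E : B →ₗ[K] K}
    (hE : ∀ a b, E (a * b) = B.ε a * E b + B.ε b * E a) (hm : ∀ i, B.ε (m i) = 0)
    (x : B ⊗[K] L) :
    contract E (gauge m γ x) = ∑ i, E (m i) • γ i (contract B.ε.toLinearMap x) := by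
  simp [gauge_apply, contract_deriv_smul hE, hm, contract_baseChange]

theorem contract_deriv_op {E : B →ₗ[K] K}
    (hE : ∀ a b, E (a * b) = B.ε a * E b + B.ε b * E a) {β : Op B L}
    (hβ : ∀ x y, 𝓛.twist B (β x y) = β (𝓛.twist B x) (𝓛.twist B y))
    (haug : ∀ x y, contract B.ε.toLinearMap (β x y)
      = 𝓛.br (contract B.ε.toLinearMap x) (contract B.ε.toLinearMap y)) (x y : B ⊗[K] L) :
    contract E (β x y) = 𝓛.br (contract E x) (contract B.ε.toLinearMap y)
      + 𝓛.br (contract B.ε.toLinearMap x) (contract E y)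
      + 𝓛.bilin (𝓛.component β hβ E) (contract B.ε.toLinearMap x)
        (contract B.ε.toLinearMap y) := by
  induction x with
  | zero => simp only [map_zero, LinearMap.zero_apply, add_zero]
  | tmul a l =>
    induction y with
    | zero => simp only [map_zero, add_zero]
    | tmul b l' =>
      rw [tmul_eq_smul a, tmul_eq_smul b]
      simp only [map_smul, LinearMap.smul_apply, contract_deriv_smul hE, contract_ε_smul, haug,
        smul_add, map_add, LinearMap.add_apply, bilin_component, contract_tmul,
        AlgHom.toLinearMap_apply, map_one, one_smul]
      have h1 : E 1 = 0 := by
        have := hE 1 1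
        simpa using this
      simp only [h1, zero_smul, smul_zero, zero_add]
      rw [smul_comm (B.ε b) (E a)]
      abel
    | add x y hx hy =>
      simp only [map_add, hx, hy]
      abel
  | add x y hx hy =>
    simp only [map_add, LinearMap.add_apply, hx, hy]
    abel

/-- The transport of an operation by the automorphism `G` with inverse `G'`. -/
def conj (β : Op B L) (G G' : Module.End B (B ⊗[K] L)) : Op B L :=
  (β.compl₁₂ G' G').compr₂ G

@[simp] theorem conj_apply (β : Op B L) (G G' : Module.End B (B ⊗[K] L)) (x y : B ⊗[K] L) :
    conj β G G' x y = G (β (G' x) (G' y)) := rfl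

end Gauge

section GaugeLift

variable {𝓛} {A : AugAlg.{u, max u w} K} {s : A.harrH K →ₗ[K] A.harrZ K}

theorem rTensor_baseChange {A : AugAlg.{u, w} K} {A' : AugAlg.{u, x} K} (φ : A →ₐ[K] A')
    (f : L →ₗ[K] L) (x : A ⊗[K] L) :
    φ.toLinearMap.rTensor L (f.baseChange A x)
      = f.baseChange A' (φ.toLinearMap.rTensor L x) := by
  induction x with
  | zero => simp
  | tmul a l => simp
  | add x y hx hy => simp only [map_add, hx, hy]

/-- A deformation and a lifting of it to `bar s` can be transported by the automorphism
`1 + ∑ mᵢ ⊗ γᵢ`, with `mᵢ` in the augmentation ideal. As the automorphism is the identity on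
`H^2_Harr(A, K)' ⊗ L`, the components of the defect do not change, and the components of first order
change by coboundaries. -/
theorem IsLift.exists_gauge {β : Op A L} {β' : Op (AugAlg.bar s) L} (h : 𝓛.IsLift s β β')
    (hβ : 𝓛.IsDeformation A β) (hA : ∀ a, A.ε a = 0 → IsNilpotent a)
    {ι : Type*} [Fintype ι] (m : ι → AugAlg.bar s) (hm : ∀ i, (AugAlg.bar s).ε (m i) = 0)
    (γ : ι → L →ₗ[K] L) (hγ : ∀ i l, 𝓛.α (γ i l) = γ i (𝓛.α l)) :
    ∃ (η : Op A L) (η' : Op (AugAlg.bar s) L), 𝓛.IsDeformation A η ∧ 𝓛.IsLift s η η' ∧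
      (∀ c, 𝓛.defectAt η' c = 𝓛.defectAt β' c) ∧
      ∀ E : AugAlg.bar s →ₗ[K] K,
        (∀ a b, E (a * b) = (AugAlg.bar s).ε a * E b + (AugAlg.bar s).ε b * E a) →
        ∀ l l' : L, contract E (η' (1 ⊗ₜ l) (1 ⊗ₜ l')) = contract E (β' (1 ⊗ₜ l) (1 ⊗ₜ l'))
          - 𝓛.br l (∑ i, E (m i) • γ i l') - 𝓛.br (∑ i, E (m i) • γ i l) l'
          + ∑ i, E (m i) • γ i (𝓛.br l l') := by
  have hN := isNilpotent_gauge γ hm (nilpotent_bar hA)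
  obtain ⟨G, hG⟩ := IsNilpotent.isUnit_one_add (r := gauge m γ) hN
  have hGx : ∀ x, G.1 x = x + gauge m γ x := fun x => by rw [hG]; rfl
  have hGG' : ∀ x, G.1 (G⁻¹.1 x) = x := fun x => LinearMap.congr_fun G.mul_inv x
  have hG'G : ∀ x, G⁻¹.1 (G.1 x) = x := fun x => LinearMap.congr_fun G.inv_mul x
  have hGt : ∀ x, 𝓛.twist _ (G.1 x) = G.1 (𝓛.twist _ x) := fun x => by
    rw [hGx, hGx, map_add, 𝓛.twist_gauge m γ hγ]
  have hG't : ∀ x, 𝓛.twist _ (G⁻¹.1 x) = G⁻¹.1 (𝓛.twist _ x) := fun x => by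
    rw [← hG'G (𝓛.twist _ (G⁻¹.1 x)), ← hGt, hGG']
  have hGε : ∀ x, contract (AugAlg.bar s).ε.toLinearMap (G.1 x)
      = contract (AugAlg.bar s).ε.toLinearMap x := fun x => by
    rw [hGx, map_add, contract_ε_gauge γ hm, add_zero]
  have hG'ε : ∀ x, contract (AugAlg.bar s).ε.toLinearMap (G⁻¹.1 x)
      = contract (AugAlg.bar s).ε.toLinearMap x := fun x => by
    rw [← hGε, hGG']
  -- the automorphism fixes the kernel of `bar s ⊗ L → A ⊗ L`, where the defect has its values
  have hGf : ∀ x, (AugAlg.barProj s).toLinearMap.rTensor L x = 0 → G.1 x = x := fun x hx => by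
    rw [hGx, gauge_apply, Finset.sum_eq_zero, add_zero]
    intro i _
    rw [smul_fiber, hm, zero_smul]
    rw [rTensor_baseChange, hx, map_zero]
  have haug : ∀ x y, contract (AugAlg.bar s).ε.toLinearMap (conj β' G.1 G⁻¹.1 x y)
      = 𝓛.br (contract (AugAlg.bar s).ε.toLinearMap x)
        (contract (AugAlg.bar s).ε.toLinearMap y) := fun x y => by
    rw [conj_apply, hGε, h.contract_ε hβ, hG'ε, hG'ε]
  have htw : ∀ x y, 𝓛.twist _ (conj β' G.1 G⁻¹.1 x y)
      = conj β' G.1 G⁻¹.1 (𝓛.twist _ x) (𝓛.twist _ y) := fun x y => by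
    rw [conj_apply, hGt, h.twist_op, hG't, hG't, conj_apply]
  have hdef : ∀ x y z, 𝓛.defect (conj β' G.1 G⁻¹.1) x y z
      = 𝓛.defect β' (G⁻¹.1 x) (G⁻¹.1 y) (G⁻¹.1 z) := fun x y z => by
    rw [← hGf _ (h.rTensor_defect hβ _ _ _)]
    simp only [defect, conj_apply, hG'G, map_add, map_sub, hG't]
  have hproj := pushout_rTensor (AugAlg.barProj s) (conj β' G.1 G⁻¹.1)
  have hpr : ∀ l : L, (1 : A) ⊗ₜ[K] l
      = (AugAlg.barProj s).toLinearMap.rTensor L (1 ⊗ₜ l) := fun l =>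
    congrArg (· ⊗ₜ[K] l) (map_one (AugAlg.barProj s)).symm
  refine ⟨pushout (AugAlg.barProj s) (conj β' G.1 G⁻¹.1), conj β' G.1 G⁻¹.1,
    ⟨𝓛.defect_eq_zero fun x y z => ?_, 𝓛.twist_op_of_tmul fun l l' => ?_,
      𝓛.aug_of_tmul fun l l' => ?_⟩, ⟨hproj, htw⟩, fun c => funext fun l => ?_,
    fun E hE l l' => ?_⟩
  · rw [hpr, hpr, hpr, ← 𝓛.rTensor_defect _ hproj, hdef, h.rTensor_defect hβ]
  · rw [pushout_tmul, ← rTensor_twist, htw, twist_tmul, twist_tmul, pushout_tmul]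
  · rw [pushout_tmul, contract_rTensor]
    refine (haug _ _).trans ?_
    simp
  · rw [defectAt, defectAt, hdef, h.defect_left hβ, h.defect_middle hβ, h.defect_right hβ]
    simp only [hG'ε, contract_tmul, AlgHom.toLinearMap_apply, map_one, one_smul]
  · have hG'E : ∀ l : L, contract E (G⁻¹.1 (1 ⊗ₜ l)) = -∑ i, E (m i) • γ i l := fun l => by
      have h1 : E 1 = 0 := by
        have := hE 1 1
        simpa using this
      have := congrArg (contract E) (hGG' (1 ⊗ₜ l))
      rw [hGx, map_add, contract_deriv_gauge m γ hE hm, hG'ε] at this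
      rw [eq_neg_iff_add_eq_zero]
      simpa [h1] using this
    rw [conj_apply, hGx, map_add, contract_deriv_gauge m γ hE hm,
      𝓛.contract_deriv_op hE h.twist_op (h.contract_ε hβ), h.contract_ε hβ, hG'ε, hG'ε, hG'E, hG'E,
      contract_tmul, contract_tmul, AlgHom.toLinearMap_apply, map_one, one_smul, one_smul,
      bilin_component]
    simp only [map_neg, LinearMap.neg_apply]
    abel

end GaugeLift

end HomLeibniz

/-! ### The filtration of the coalgebra `F` -/

namespace AugAlg

variable {K : Type u} [Field K] {A : AugAlg.{u, max u w} K} (s : A.harrH K →ₗ[K] A.harrZ K)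

/-- The projection of augmentation ideals of `bar s → A`. -/
def barProjM : (bar s).𝔪 →ₗ[K] A.𝔪 := projM (univCocycle s)

theorem mem_F₁_iff_exists (ξ : Module.Dual K (bar s).𝔪) :
    ξ ∈ (barCoalgebra s).F₁ ↔ ∃ ζ, (barProjM s).dualMap ζ = ξ := Iff.rfl

theorem mem_F₀_iff_exists (ξ : Module.Dual K (bar s).𝔪) :
    ξ ∈ (barCoalgebra s).F₀ ↔
      ∃ ζ : Module.Dual K A.𝔪, (∀ x y, ζ (A.mulM x y) = 0) ∧ (barProjM s).dualMap ζ = ξ := Iff.rfl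

theorem extZero_projM (ξ : Module.Dual K A.𝔪) :
    (bar s).extZero ((barProjM s).dualMap ξ)
      = A.extZero ξ ∘ₗ (barProj s).toLinearMap := by
  refine LinearMap.ext fun a => congrArg ξ (Subtype.ext ?_)
  change barProj s (a - algebraMap K (bar s) ((bar s).ε a))
    = barProj s a - algebraMap K A (A.ε (barProj s a))
  rw [map_sub, AlgHom.commutes]
  rfl

/-- The elements of `H^2_Harr(A, K)'` as elements of the augmentation ideal of `bar s`. -/
def inrM (θ : Module.Dual K (A.harrH K)) : (bar s).𝔪 :=
  ⟨HomLeibniz.barInr s θ, LinearMap.mem_ker.2 (map_zero A.ε)⟩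

theorem mem_F₁_iff (ξ : Module.Dual K (bar s).𝔪) :
    ξ ∈ (barCoalgebra s).F₁ ↔ ∀ θ, ξ (inrM s θ) = 0 := by
  rw [mem_F₁_iff_exists]
  constructor
  · rintro ⟨ζ, rfl⟩ θ
    have : barProjM s (inrM s θ) = 0 := Subtype.ext rfl
    rw [LinearMap.dualMap_apply, this, map_zero]
  · intro h
    refine ⟨((bar s).extZero ξ ∘ₗ HomLeibniz.barSec s).domRestrict A.𝔪,
      LinearMap.ext fun (z : (bar s).𝔪) => ?_⟩
    change (bar s).extZero ξ (HomLeibniz.barSec s (barProj s z)) = ξ z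
    obtain ⟨θ, hθ⟩ := (HomLeibniz.exact_barInr s
      ((z : bar s) - HomLeibniz.barSec s (barProj s z))).1 (by
        change barProj s _ = 0
        rw [map_sub]
        exact sub_self _)
    have hz : HomLeibniz.barSec s (barProj s z) = ((z - inrM s θ : (bar s).𝔪) : bar s) := by
      change _ = (z : bar s) - HomLeibniz.barInr s θ
      rw [hθ, sub_sub_cancel]
    rw [hz, extZero_coe, map_sub, h, sub_zero]

/-- The canonical map `H^2_Harr(A, K) → F / F₁` is an isomorphism. -/
theorem exists_equiv_quotient_F₁ :
    ∃ e : A.harrH K ≃ₗ[K] Module.Dual K (bar s).𝔪 ⧸ (barCoalgebra s).F₁,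
      ∀ h, e h = Submodule.Quotient.mk ((barEval s h).domRestrict (bar s).𝔪) := by
  let E : A.harrH K →ₗ[K] Module.Dual K (bar s).𝔪 ⧸ (barCoalgebra s).F₁ :=
    (barCoalgebra s).F₁.mkQ ∘ₗ
      { toFun := fun h => (barEval s h).domRestrict (bar s).𝔪
        map_add' := fun h h' => by rw [HomLeibniz.barEval_add]; rfl
        map_smul' := fun c h => by rw [HomLeibniz.barEval_smul]; rfl }
  refine ⟨LinearEquiv.ofBijective E ⟨?_, ?_⟩, fun h => rfl⟩
  · refine (injective_iff_map_eq_zero E).2 fun h hh => ?_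
    have := (mem_F₁_iff s _).1 ((Submodule.Quotient.mk_eq_zero _).1 hh)
    exact (Module.forall_dual_apply_eq_zero_iff K h).1 this
  · intro q
    obtain ⟨ζ, rfl⟩ := Submodule.mkQ_surjective _ q
    refine ⟨(Module.evalEquiv K (A.harrH K)).symm
      ((bar s).extZero ζ ∘ₗ HomLeibniz.barInr s), ?_⟩
    refine (Submodule.Quotient.eq _).2 ((mem_F₁_iff s _).2 fun θ => ?_)
    rw [LinearMap.sub_apply, sub_eq_zero]
    change θ _ = _
    rw [Module.apply_evalEquiv_symm_apply]
    exact (bar s).extZero_coe ζ (inrM s θ)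

end AugAlg

namespace HomLeibniz

variable {K : Type u} {L : Type v} [Field K] [AddCommGroup L] [Module K L]
variable {𝓛 : HomLeibniz K L}

section FZero

variable [FiniteDimensional K (𝓛.H 2)] {μ : 𝓛.H 2 →ₗ[K] 𝓛.Z 2} {A : AugAlg.{u, max u v} K}
    {π : A →ₐ[K] 𝓛.C₁} {η : Op A L}

/-- The functional `evalC₁ h ∘ π` on `bar s`. -/
def firstOrder (s : A.harrH K →ₗ[K] A.harrZ K) (π : A →ₐ[K] 𝓛.C₁) (h : 𝓛.H 2) :
    AugAlg.bar s →ₗ[K] K :=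
  𝓛.evalC₁ h ∘ₗ (π.comp (AugAlg.barProj s)).toLinearMap

theorem firstOrder_mul (hπ : 𝓛.C₁.ε.comp π = A.ε) (s : A.harrH K →ₗ[K] A.harrZ K) (h : 𝓛.H 2)
    (a b : AugAlg.bar s) : firstOrder s π h (a * b)
      = (AugAlg.bar s).ε a * firstOrder s π h b + (AugAlg.bar s).ε b * firstOrder s π h a := by
  have hε : ∀ a, (AugAlg.bar s).ε a = 𝓛.C₁.ε (π (AugAlg.barProj s a)) := fun a =>
    (AlgHom.congr_fun hπ (AugAlg.barProj s a)).symm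
  rw [hε, hε]
  refine Eq.trans ?_ (𝓛.evalC₁_mul h _ _)
  exact congrArg (𝓛.evalC₁ h) (map_mul (π.comp (AugAlg.barProj s)) a b)

theorem extZero_firstOrder (hπ : 𝓛.C₁.ε.comp π = A.ε) (s : A.harrH K →ₗ[K] A.harrZ K) (h : 𝓛.H 2) :
    (AugAlg.bar s).extZero ((firstOrder s π h).domRestrict _) = firstOrder s π h := by
  have h1 : firstOrder s π h 1 = 0 := by
    have := firstOrder_mul hπ s h 1 1
    simpa using this
  conv_rhs => rw [(AugAlg.bar s).eq_extZero_add (firstOrder s π h), h1, zero_smul, add_zero]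

/-- The canonical map `H → F₀` is an isomorphism. -/
theorem StageInvariant.exists_equiv_F₀ (hA : 𝓛.StageInvariant μ A π η)
    (s : A.harrH K →ₗ[K] A.harrZ K) :
    ∃ j : 𝓛.H 2 ≃ₗ[K] (AugAlg.barCoalgebra s).F₀,
      ∀ h, (j h : Module.Dual K (AugAlg.bar s).𝔪) = (firstOrder s π h).domRestrict _ := by
  let J : 𝓛.H 2 →ₗ[K] Module.Dual K (AugAlg.bar s).𝔪 :=
    { toFun := fun h => (firstOrder s π h).domRestrict _
      map_add' := fun h h' => LinearMap.ext fun z =>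
        map_add (TrivSqZeroExt.snd (R := K) (π (AugAlg.barProj s z))) h h'
      map_smul' := fun c h => LinearMap.ext fun z =>
        map_smul (TrivSqZeroExt.snd (R := K) (π (AugAlg.barProj s z))) c h }
  have hε : ∀ a, 𝓛.C₁.ε (π a) = A.ε a := AlgHom.congr_fun hA.comp_eq
  have hJ : ∀ h, J h ∈ (AugAlg.barCoalgebra s).F₀ := fun h => by
    rw [AugAlg.mem_F₀_iff_exists]
    refine ⟨(𝓛.evalC₁ h ∘ₗ π.toLinearMap).domRestrict A.𝔪, fun x y => ?_, rfl⟩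
    change 𝓛.evalC₁ h (π (x.1 * y.1)) = 0
    rw [map_mul, evalC₁_mul, hε, hε, show A.ε x = 0 from x.2, show A.ε y = 0 from y.2]
    simp
  refine ⟨LinearEquiv.ofBijective (J.codRestrict _ hJ) ⟨?_, ?_⟩, fun h => rfl⟩
  · refine (injective_iff_map_eq_zero _).2 fun h hh => ?_
    refine (Module.forall_dual_apply_eq_zero_iff K h).1 fun θ => ?_
    obtain ⟨a, ha⟩ := hA.surjective (𝓛.inrC₁ θ)
    have ha' : A.ε a = 0 := by
      rw [← hε, ha]
      rfl
    have := LinearMap.congr_fun (congrArg Subtype.val hh)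
      (⟨barSec s a, LinearMap.mem_ker.2 ha'⟩ : (AugAlg.bar s).𝔪)
    change 𝓛.evalC₁ h (π a) = 0 at this
    rw [ha] at this
    exact this
  · rintro ⟨x, hx⟩
    obtain ⟨ξ, hξ, rfl⟩ := (AugAlg.mem_F₀_iff_exists s x).1 hx
    obtain ⟨h, hh⟩ := hA.exists_evalC₁ (A.extZero ξ) fun a b ha hb =>
      (A.extZero_coe ξ (A.mulM ⟨a, ha⟩ ⟨b, hb⟩)).trans (hξ ⟨a, ha⟩ ⟨b, hb⟩)
    refine ⟨h, Subtype.ext (LinearMap.ext fun z => ?_)⟩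
    have hz : A.ε (AugAlg.barProj s z) = 0 := z.2
    exact (hh _ hz).symm.trans (A.extZero_coe ξ ⟨_, hz⟩)

end FZero

/-! ### Massey brackets and obstructions -/

section Massey

variable {A : AugAlg.{u, max u w} K} {s : A.harrH K →ₗ[K] A.harrZ K}

theorem lift_map_Δ₁ {F : Type*} [AddCommGroup F] [Module K F] (Φ : FilteredCoalgebra K F)
    (C : F →ₗ[K] 𝓛.cochains 2) (x : F) :
    TensorProduct.lift 𝓛.ν (TensorProduct.map (C ∘ₗ Φ.F₁.subtype) (C ∘ₗ Φ.F₁.subtype) (Φ.Δ₁ x))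
      = TensorProduct.lift 𝓛.ν (TensorProduct.map C C (Φ.Δ x)) := by
  rw [← Φ.map_Δ₁, ← LinearMap.comp_apply (TensorProduct.map C C), ← TensorProduct.map_comp]

/-- Rescaling the defining systems of a Massey bracket. -/
theorem smul_mem_massey {F : Type*} [AddCommGroup F] [Module K F] (Φ : FilteredCoalgebra K F)
    {c : K} {a : Φ.F₀ →ₗ[K] 𝓛.H 2} {b : F ⧸ Φ.F₁ →ₗ[K] 𝓛.H 3} (hb : b ∈ Φ.massey c 𝓛 a)
    {r : K} (hr : r ≠ 0) : (r * r) • b ∈ Φ.massey (c / r) 𝓛 (r • a) := by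
  obtain ⟨ψ, h₁, h₂, h₃⟩ := hb
  have key : ∀ t, TensorProduct.lift 𝓛.ν (TensorProduct.map (r • ψ) (r • ψ) t)
      = (r * r) • TensorProduct.lift 𝓛.ν (TensorProduct.map ψ ψ t) := fun t => by
    rw [TensorProduct.map_smul_left, TensorProduct.map_smul_right]
    simp [smul_smul]
  refine ⟨r • ψ, fun x => ?_, fun x => (h₂ x).smul r, fun x => ?_⟩
  · rw [key, LinearMap.smul_apply, map_smul, h₁, smul_smul, smul_smul]
    congr 1
    field_simp
  · rw [key]
    exact (h₃ x).smul _

variable {β : Op A L} {β' : Op (AugAlg.bar s) L}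

/-- On `F₁` the components of a lifting of a deformation satisfy the Maurer–Cartan equation. -/
theorem contract_extZero_defect_of_mem_F₁
    (h : ∀ x y z, (AugAlg.barProj s).toLinearMap.rTensor L (𝓛.defect β' x y z) = 0)
    {ξ : Module.Dual K (AugAlg.bar s).𝔪} (hξ : ξ ∈ (AugAlg.barCoalgebra s).F₁)
    (x y z : AugAlg.bar s ⊗[K] L) :
    contract ((AugAlg.bar s).extZero ξ) (𝓛.defect β' x y z) = 0 := by
  obtain ⟨ζ, rfl⟩ := (AugAlg.mem_F₁_iff_exists s ξ).1 hξ
  rw [AugAlg.extZero_projM, ← contract_rTensor, h, map_zero]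

/-- The components of `ν ∘ (ψ ⊗ ψ) ∘ Δ` represent twice the obstruction classes. -/
theorem IsLift.represents_lift_ν (h : 𝓛.IsLift s β β') (hβ : 𝓛.IsDeformation A β)
    {ω : A.harrH K →ₗ[K] 𝓛.H 3} (hω : 𝓛.IsObstruction β s ω)
    (ξ : Module.Dual K (AugAlg.bar s).𝔪) (c : A.harrH K)
    (hc : Submodule.Quotient.mk ((AugAlg.barEval s c).domRestrict (AugAlg.bar s).𝔪)
      = (Submodule.Quotient.mk ξ : _ ⧸ (AugAlg.barCoalgebra s).F₁)) :
    𝓛.Represents (TensorProduct.lift 𝓛.ν (TensorProduct.map (𝓛.componentM β' h.twist_op)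
      (𝓛.componentM β' h.twist_op) ((AugAlg.bar s).Δ ξ))) ((2 : K) • ω c) := by
  have hMC := 𝓛.two_smul_contract_defect β' h.twist_op (h.contract_ε hβ) ξ
  have hD : (fun l : Fin 3 → L => contract ((AugAlg.bar s).extZero ξ)
      (𝓛.defect β' (1 ⊗ₜ l 0) (1 ⊗ₜ l 1) (1 ⊗ₜ l 2))) = 𝓛.defectAt β' c := by
    funext l
    have hF := (Submodule.Quotient.eq _).1 hc
    have e := (AugAlg.bar s).eq_extZero_add (AugAlg.barEval s c)
    rw [defectAt, e, contract_add, contract_smul,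
      𝓛.contract_ε_defect (h.contract_ε hβ), smul_zero, add_zero]
    have := contract_extZero_defect_of_mem_F₁ (h.rTensor_defect hβ) hF (1 ⊗ₜ l 0) (1 ⊗ₜ l 1)
      (1 ⊗ₜ l 2)
    rw [map_sub, sub_eq_add_neg, ← neg_one_smul K, contract_add, contract_smul, neg_one_smul,
      ← sub_eq_add_neg, sub_eq_zero] at this
    exact this.symm
  rw [hD] at hMC
  have := ((hω.represents hβ h c).smul 2).add_δ ((-2 : K) • 𝓛.componentM β' h.twist_op ξ)
  rw [hMC] at this
  convert this using 1
  simp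

/-- The components of a lifting form a defining system for the Massey bracket containing twice the
obstruction. -/
theorem two_smul_mem_massey [CharZero K] (hβ : 𝓛.IsDeformation A β)
    {ω : A.harrH K →ₗ[K] 𝓛.H 3} (hω : 𝓛.IsObstruction β s ω)
    {e : A.harrH K ≃ₗ[K] Module.Dual K (AugAlg.bar s).𝔪 ⧸ (AugAlg.barCoalgebra s).F₁}
    (he : ∀ h, e h = Submodule.Quotient.mk ((AugAlg.barEval s h).domRestrict (AugAlg.bar s).𝔪))
    (h : 𝓛.IsLift s β β') {a : (AugAlg.barCoalgebra s).F₀ →ₗ[K] 𝓛.H 2}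
    (ha : ∀ x : (AugAlg.barCoalgebra s).F₀,
      𝓛.Represents (𝓛.componentM β' h.twist_op x.1).1 (a x)) :
    ((2 : K) • ω) ∘ₗ e.symm.toLinearMap ∈ (AugAlg.barCoalgebra s).massey (1 / 2) 𝓛 a := by
  have hΔ := fun x => lift_map_Δ₁ (AugAlg.barCoalgebra s) (𝓛.componentM β' h.twist_op) x
  refine ⟨𝓛.componentM β' h.twist_op ∘ₗ (AugAlg.barCoalgebra s).F₁.subtype, fun x => ?_, ha,
    fun x => ?_⟩
  · rw [hΔ]
    have hMC := 𝓛.two_smul_contract_defect β' h.twist_op (h.contract_ε hβ) x.1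
    simp only [contract_extZero_defect_of_mem_F₁ (h.rTensor_defect hβ) x.2] at hMC
    have hMC' := (eq_neg_of_add_eq_zero_right (hMC.symm.trans (smul_zero _)))
    refine Eq.trans ?_ (congrArg (fun t => (1 / 2 : K) • t) hMC').symm
    rw [smul_neg, smul_smul, one_div, inv_mul_cancel₀ two_ne_zero, one_smul]
    rfl
  · rw [hΔ]
    refine h.represents_lift_ν hβ hω x (e.symm (Submodule.Quotient.mk x)) ?_
    rw [← he, e.apply_symm_apply]

end Massey

end HomLeibniz

theorem FilteredCoalgebra.exists_projection_F₁ {K : Type u} {F : Type w} [Field K]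
    [AddCommGroup F] [Module K F] (Φ : FilteredCoalgebra K F) :
    ∃ P : F →ₗ[K] Φ.F₁, P ∘ₗ Φ.F₁.subtype = LinearMap.id :=
  LinearMap.exists_leftInverse_of_injective _ (Submodule.ker_subtype _)

namespace HomLeibniz

variable {K : Type u} {L : Type v} [Field K] [AddCommGroup L] [Module K L]
variable {𝓛 : HomLeibniz K L}

/-! ### Deformations from defining systems -/

section Converse

variable {A : AugAlg.{u, max u w} K} {s : A.harrH K →ₗ[K] A.harrZ K}

/-- Every linear family of `2`-cochains indexed by `𝔪'` consists of the components of an operation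
that lifts the bracket of `𝓛`. -/
theorem exists_op_of_componentM {B : AugAlg.{u, x} K}
    (ψ : Module.Dual K B.𝔪 →ₗ[K] 𝓛.cochains 2) :
    ∃ (β : Op B L) (h : ∀ a b, 𝓛.twist B (β a b) = β (𝓛.twist B a) (𝓛.twist B b)),
      𝓛.componentM β h = ψ ∧ ∀ x y, contract B.ε.toLinearMap (β x y)
        = 𝓛.br (contract B.ε.toLinearMap x) (contract B.ε.toLinearMap y) := by
  let Ψ : Module.Dual K B →ₗ[K] 𝓛.cochains 2 :=
    (LinearMap.applyₗ (1 : B)).smulRight (𝓛.cochainOfBilin 𝓛.br 𝓛.α_br)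
      + ψ ∘ₗ B.𝔪.subtype.dualMap
  obtain ⟨β, htw, hΨ⟩ := 𝓛.exists_op_of_components Ψ
  refine ⟨β, htw, LinearMap.ext fun x => Subtype.ext (funext fun l => ?_),
    𝓛.aug_of_tmul fun l l' => ?_⟩
  · have hx : B.𝔪.subtype.dualMap (B.extZero x) = x :=
      LinearMap.ext fun z => B.extZero_coe x z
    have hΨx : Ψ (B.extZero x) = ψ x := by
      simp only [Ψ, LinearMap.add_apply, LinearMap.smulRight_apply, LinearMap.applyₗ_apply_apply,
        AugAlg.extZero_one, zero_smul, zero_add, LinearMap.comp_apply, hx]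
    rw [componentM, LinearMap.comp_apply, component_apply, hΨ, hΨx, bilin_apply]
    exact congrArg (ψ x).1 (by funext i; fin_cases i <;> rfl)
  · have hz : B.𝔪.subtype.dualMap B.ε.toLinearMap = 0 := LinearMap.ext fun z => z.2
    have hΨε : Ψ B.ε.toLinearMap = 𝓛.cochainOfBilin 𝓛.br 𝓛.α_br := by
      simp only [Ψ, LinearMap.add_apply, LinearMap.smulRight_apply, LinearMap.applyₗ_apply_apply,
        LinearMap.comp_apply, hz, map_zero, add_zero, AlgHom.toLinearMap_apply, map_one, one_smul]
    rw [hΨ, hΨε]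
    rfl

/-- If the components of an operation satisfy the Maurer–Cartan equation on `F₁`, then those
components of its defect vanish. -/
theorem contract_defect_eq_zero_of_maurerCartan [CharZero K] {β' : Op (AugAlg.bar s) L}
    (htw : ∀ a b, 𝓛.twist _ (β' a b) = β' (𝓛.twist _ a) (𝓛.twist _ b))
    (haug : ∀ x y, contract (AugAlg.bar s).ε.toLinearMap (β' x y)
      = 𝓛.br (contract (AugAlg.bar s).ε.toLinearMap x)
        (contract (AugAlg.bar s).ε.toLinearMap y))
    {ψ : (AugAlg.barCoalgebra s).F₁ →ₗ[K] 𝓛.cochains 2}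
    (hψ : ∀ x : (AugAlg.barCoalgebra s).F₁, 𝓛.d (ψ x) = (1 / 2 : K) •
      TensorProduct.lift 𝓛.ν (TensorProduct.map ψ ψ
        ((AugAlg.barCoalgebra s).Δ₁ (x : Module.Dual K (AugAlg.bar s).𝔪))))
    (hψ' : 𝓛.componentM β' htw ∘ₗ (AugAlg.barCoalgebra s).F₁.subtype = ψ)
    (x : (AugAlg.barCoalgebra s).F₁) (l₀ l₁ l₂ : L) :
    contract ((AugAlg.bar s).extZero x.1) (𝓛.defect β' (1 ⊗ₜ l₀) (1 ⊗ₜ l₁) (1 ⊗ₜ l₂)) = 0 := by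
  have hMC := 𝓛.two_smul_contract_defect β' htw haug x.1
  have h₁ : 𝓛.componentM β' htw x.1 = ψ x := LinearMap.congr_fun hψ' x
  have h₂ := lift_map_Δ₁ (AugAlg.barCoalgebra s) (𝓛.componentM β' htw) x.1
  have h₃ := hψ x
  rw [hψ'] at h₂
  have h₄ : TensorProduct.lift 𝓛.ν (TensorProduct.map (𝓛.componentM β' htw)
      (𝓛.componentM β' htw) ((AugAlg.bar s).Δ x.1)) = -((2 : K) • 𝓛.δ 2 (ψ x).1) := by
    refine h₂.symm.trans ?_
    have h₅ := congrArg (fun t => (2 : K) • t) h₃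
    simp only [smul_smul, mul_one_div_cancel (two_ne_zero' K), one_smul] at h₅
    rw [← h₅, ← smul_neg]
    rfl
  rw [h₄, h₁, add_neg_cancel] at hMC
  have h₆ := congrFun hMC ![l₀, l₁, l₂]
  rw [Pi.smul_apply, Pi.zero_apply] at h₆
  exact (smul_eq_zero.1 h₆).resolve_left (two_ne_zero' K)

/-- If the components of the defect of an operation on `bar s ⊗ L` vanish on `F₁`, then its push-out
is a deformation with base `A`. -/
theorem isDeformation_pushout_barProj {β' : Op (AugAlg.bar s) L}
    (htw : ∀ a b, 𝓛.twist _ (β' a b) = β' (𝓛.twist _ a) (𝓛.twist _ b))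
    (haug : ∀ x y, contract (AugAlg.bar s).ε.toLinearMap (β' x y)
      = 𝓛.br (contract (AugAlg.bar s).ε.toLinearMap x)
        (contract (AugAlg.bar s).ε.toLinearMap y))
    (hzero : ∀ (x : (AugAlg.barCoalgebra s).F₁) (l₀ l₁ l₂ : L),
      contract ((AugAlg.bar s).extZero x.1) (𝓛.defect β' (1 ⊗ₜ l₀) (1 ⊗ₜ l₁) (1 ⊗ₜ l₂)) = 0) :
    𝓛.IsDeformation A (pushout (AugAlg.barProj s) β') := by
  have hproj := pushout_rTensor (AugAlg.barProj s) β'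
  have hpr : ∀ l : L, (1 : A) ⊗ₜ[K] l
      = (AugAlg.barProj s).toLinearMap.rTensor L (1 ⊗ₜ l) := fun l =>
    congrArg (· ⊗ₜ[K] l) (map_one (AugAlg.barProj s)).symm
  have haugA : ∀ x y, contract A.ε.toLinearMap (pushout (AugAlg.barProj s) β' x y)
      = 𝓛.br (contract A.ε.toLinearMap x) (contract A.ε.toLinearMap y) := by
    refine 𝓛.aug_of_tmul fun l l' => ?_
    rw [pushout_tmul, contract_rTensor]
    refine (haug _ _).trans ?_
    simp only [contract_tmul, AlgHom.toLinearMap_apply, map_one, one_smul]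
  refine ⟨𝓛.defect_eq_zero_of_extZero haugA fun ξ x y z => ?_,
    𝓛.twist_op_of_tmul fun l l' => ?_, haugA⟩
  · rw [hpr, hpr, hpr, ← 𝓛.rTensor_defect _ hproj, contract_rTensor, ← AugAlg.extZero_projM]
    exact hzero ⟨_, (AugAlg.mem_F₁_iff_exists s _).2 ⟨ξ, rfl⟩⟩ _ _ _
  · rw [pushout_tmul, ← rTensor_twist, htw, twist_tmul, twist_tmul, pushout_tmul]

/-- A solution `ψ` of the Maurer–Cartan equation on `F₁` consists of the components of an operation
on `bar s ⊗ L` that lifts a deformation with base `A`. -/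
theorem exists_isLift_of_maurerCartan [CharZero K]
    (ψ : (AugAlg.barCoalgebra s).F₁ →ₗ[K] 𝓛.cochains 2)
    (hψ : ∀ x : (AugAlg.barCoalgebra s).F₁, 𝓛.d (ψ x) = (1 / 2 : K) •
      TensorProduct.lift 𝓛.ν (TensorProduct.map ψ ψ
        ((AugAlg.barCoalgebra s).Δ₁ (x : Module.Dual K (AugAlg.bar s).𝔪)))) :
    ∃ (β : Op A L) (β' : Op (AugAlg.bar s) L) (h : 𝓛.IsLift s β β'), 𝓛.IsDeformation A β ∧
      𝓛.componentM β' h.twist_op ∘ₗ (AugAlg.barCoalgebra s).F₁.subtype = ψ := by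
  obtain ⟨P, hP⟩ := (AugAlg.barCoalgebra s).exists_projection_F₁
  obtain ⟨β', htw, hΨ, haug⟩ := exists_op_of_componentM (B := AugAlg.bar s) (ψ ∘ₗ P)
  have hψ' : 𝓛.componentM β' htw ∘ₗ (AugAlg.barCoalgebra s).F₁.subtype = ψ := by
    rw [hΨ, LinearMap.comp_assoc, hP, LinearMap.comp_id]
  exact ⟨pushout (AugAlg.barProj s) β', β', ⟨pushout_rTensor (AugAlg.barProj s) β', htw⟩,
    isDeformation_pushout_barProj htw haug
      (contract_defect_eq_zero_of_maurerCartan htw haug hψ hψ'), hψ'⟩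

end Converse

section Main

variable [FiniteDimensional K (𝓛.H 2)] {μ : 𝓛.H 2 →ₗ[K] 𝓛.Z 2} {A : AugAlg.{u, max u v} K}
    {π : A →ₐ[K] 𝓛.C₁} {η : Op A L} {s : A.harrH K →ₗ[K] A.harrZ K}

theorem contract_firstOrder {β : Op A L} {β' : Op (AugAlg.bar s) L} (h : 𝓛.IsLift s β β')
    (c : 𝓛.H 2) (l l' : L) : contract (firstOrder s π c) (β' (1 ⊗ₜ l) (1 ⊗ₜ l'))
      = contract (𝓛.evalC₁ c) (pushout π β (1 ⊗ₜ l) (1 ⊗ₜ l')) := by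
  rw [pushout_tmul, contract_rTensor]
  have : β (1 ⊗ₜ l) (1 ⊗ₜ l')
      = (AugAlg.barProj s).toLinearMap.rTensor L (β' (1 ⊗ₜ l) (1 ⊗ₜ l')) := by
    rw [h.proj]
    exact congrArg (fun a => β (a ⊗ₜ[K] l) (a ⊗ₜ[K] l')) (map_one (AugAlg.barProj s)).symm
  rw [this, contract_rTensor]
  rfl

/-- Representatives of the same classes differ by the coboundaries of a linear family of
`1`-cochains. -/
theorem exists_linear_gauge (φ φ' : 𝓛.H 2 →ₗ[K] 𝓛.cochains 2)
    (hφ : ∀ c, 𝓛.Represents (φ c).1 c) (hφ' : ∀ c, 𝓛.Represents (φ' c).1 c) :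
    ∃ γ : 𝓛.H 2 →ₗ[K] L →ₗ[K] L, (∀ c l, 𝓛.α (γ c l) = γ c (𝓛.α l)) ∧
      ∀ c l l', 𝓛.bilin (φ c) l l' - 𝓛.bilin (φ' c) l l'
        = 𝓛.br l (γ c l') + 𝓛.br (γ c l) l' - γ c (𝓛.br l l') := by
  have hex : ∀ c : 𝓛.H 2, ∃ g : L →ₗ[K] L, (∀ l, 𝓛.α (g l) = g (𝓛.α l)) ∧
      ∀ l l', 𝓛.bilin (φ c) l l' - 𝓛.bilin (φ' c) l l'
        = 𝓛.br l (g l') + 𝓛.br (g l) l' - g (𝓛.br l l') := by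
    intro c
    obtain ⟨h₁, e₁⟩ := hφ c
    obtain ⟨h₂, e₂⟩ := hφ' c
    obtain ⟨_, ⟨⟨m, rfl⟩, hm⟩, hδ⟩ := (Submodule.Quotient.eq _).1 (e₁.trans e₂.symm)
    have hup : ∀ x y : L, Function.update ![x] 0 y = ![y] := fun x y => by
      funext i
      fin_cases i
      rfl
    refine ⟨{ toFun := fun l => m ![l]
              map_add' := fun x y => by simpa only [hup] using m.map_update_add ![0] 0 x y
              map_smul' := fun r x => by
                simpa only [hup, RingHom.id_apply] using m.map_update_smul ![0] 0 r x },
      fun l => ?_, fun l l' => ?_⟩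
    · refine (hm ![l]).trans (congrArg m ?_)
      funext i
      fin_cases i
      rfl
    · have := congrFun hδ ![l, l']
      rw [δ_one_apply] at this
      exact this.symm
  choose g hg hδ using hex
  let b := Module.finBasis K (𝓛.H 2)
  have hb : ∀ c, c = ∑ i, b.repr c i • b i := fun c => (b.sum_repr c).symm
  refine ⟨b.constr K fun i => g (b i), fun c l => ?_, fun c l l' => ?_⟩
  · simp only [Module.Basis.constr_apply_fintype, LinearMap.sum_apply, LinearMap.smul_apply,
      map_sum, map_smul, hg]
  · have key : ∀ (φ : 𝓛.H 2 →ₗ[K] 𝓛.cochains 2), 𝓛.bilin (φ c) l l'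
        = ∑ i, b.repr c i • 𝓛.bilin (φ (b i)) l l' := fun φ => by
      conv_lhs => rw [hb c]
      simp only [map_sum, map_smul, bilin_apply, Submodule.coe_sum, Finset.sum_apply,
        Submodule.coe_smul, Pi.smul_apply]
    rw [key φ, key φ', ← Finset.sum_sub_distrib]
    simp only [← smul_sub, hδ]
    simp only [Module.Basis.constr_apply_fintype, LinearMap.sum_apply,
      LinearMap.smul_apply, map_sum, map_smul, smul_add, smul_sub, Finset.sum_add_distrib,
      Finset.sum_sub_distrib, Module.Basis.equivFun_apply]

/-- Every element of the Massey bracket is twice the obstruction of a deformation extending `η₁`. -/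
theorem StageInvariant.exists_of_mem_massey [CharZero K] (hA : 𝓛.StageInvariant μ A π η)
    (hμ : ∀ h, Submodule.Quotient.mk (μ h) = h)
    {j : 𝓛.H 2 ≃ₗ[K] (AugAlg.barCoalgebra s).F₀}
    (hj : ∀ h, (j h : Module.Dual K (AugAlg.bar s).𝔪) = (firstOrder s π h).domRestrict _)
    {e : A.harrH K ≃ₗ[K] Module.Dual K (AugAlg.bar s).𝔪 ⧸ (AugAlg.barCoalgebra s).F₁}
    (he : ∀ h, e h = Submodule.Quotient.mk ((AugAlg.barEval s h).domRestrict (AugAlg.bar s).𝔪))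
    {b : Module.Dual K (AugAlg.bar s).𝔪 ⧸ (AugAlg.barCoalgebra s).F₁ →ₗ[K] 𝓛.H 3}
    (hb : b ∈ (AugAlg.barCoalgebra s).massey (1 / 2) 𝓛 j.symm.toLinearMap) :
    ∃ η' ω', 𝓛.IsDeformation A η' ∧ pushout π η' = 𝓛.eta₁ μ ∧
      𝓛.IsObstruction η' s ω' ∧ b = ((2 : K) • ω') ∘ₗ e.symm.toLinearMap := by
  obtain ⟨ψ, h₁, h₂, h₃⟩ := hb
  obtain ⟨β, β', h, hβ, hψ⟩ := exists_isLift_of_maurerCartan ψ h₁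
  let φ : 𝓛.H 2 →ₗ[K] 𝓛.cochains 2 :=
    ψ ∘ₗ Submodule.inclusion (AugAlg.barCoalgebra s).F₀_le ∘ₗ j.toLinearMap
  have hφ : ∀ c, 𝓛.Represents (φ c).1 c := fun c => by
    have := h₂ (j c)
    rwa [LinearEquiv.coe_coe, j.symm_apply_apply] at this
  have hφ' : ∀ c l l', 𝓛.bilin (φ c) l l'
      = contract (firstOrder s π c) (β' (1 ⊗ₜ l) (1 ⊗ₜ l')) := fun c l l' => by
    have : φ c = 𝓛.component β' h.twist_op (firstOrder s π c) := by
      rw [← extZero_firstOrder hA.comp_eq s c, ← hj]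
      exact (LinearMap.congr_fun hψ
        (Submodule.inclusion (AugAlg.barCoalgebra s).F₀_le (j c))).symm
    rw [this, bilin_component]
  obtain ⟨γ, hγ, hδ⟩ := exists_linear_gauge φ
    (Submodule.inclusion (inf_le_left : 𝓛.Z 2 ≤ 𝓛.cochains 2) ∘ₗ μ) hφ
    fun c => ⟨(μ c).2, hμ c⟩
  let B := Module.finBasis K (𝓛.H 2)
  -- the automorphism `1 + ∑ mᵢ ⊗ γ(hᵢ)`, with `mᵢ` lifting the basis dual to `(hᵢ)`, turns the
  -- first-order part `φ` into `μ`
  choose m₀ hm₀ using fun i => hA.surjective (𝓛.inrC₁ (B.coord i))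
  have hm : ∀ i, (AugAlg.bar s).ε (barSec s (m₀ i)) = 0 := fun i => by
    refine (AlgHom.congr_fun hA.comp_eq (m₀ i)).symm.trans ?_
    change 𝓛.C₁.ε (π (m₀ i)) = 0
    rw [hm₀]
    rfl
  obtain ⟨η', β'', hη', h', hdef, hE⟩ := h.exists_gauge hβ hA.nilpotent (fun i => barSec s (m₀ i))
    hm (fun i => γ (B i)) (fun i => hγ (B i))
  obtain ⟨ω, hω, -⟩ := existsUnique_isObstruction s hη'
  have hωβ : 𝓛.IsObstruction β s ω := 𝓛.isObstruction_iff.2 ⟨β', h, fun c => by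
    rw [← hdef]
    exact hω.represents hη' h' c⟩
  refine ⟨η', ω, hη', 𝓛.op_C₁_ext (fun l l' => ?_) (fun c l l' => ?_), hω, ?_⟩
  · rw [contract_ε_eta₁, pushout_tmul, contract_rTensor]
    refine (congrArg (fun ξ => contract ξ (η' (1 ⊗ₜ l) (1 ⊗ₜ l')))
      (congrArg AlgHom.toLinearMap hA.comp_eq)).trans ?_
    rw [hη'.aug]
    simp
  · have hsum : ∀ l, ∑ i, firstOrder s π c (barSec s (m₀ i)) • γ (B i) l = γ c l := fun l => by
      have : ∀ i, firstOrder s π c (barSec s (m₀ i)) = B.repr c i := fun i => by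
        change 𝓛.evalC₁ c (π (m₀ i)) = _
        rw [hm₀]
        rfl
      simp only [this]
      conv_rhs => rw [← B.sum_repr c, map_sum, LinearMap.sum_apply]
      simp only [map_smul, LinearMap.smul_apply]
    rw [← contract_firstOrder h', hE _ (firstOrder_mul hA.comp_eq s c), hsum, hsum, hsum, ← hφ',
      contract_eval_eta₁]
    have := hδ c l l'
    rw [sub_eq_iff_eq_add] at this
    rw [this]
    simp only [bilin_apply]
    change _ = (μ c).1 ![l, l']
    change _ + (μ c).1 ![l, l'] - _ - _ + _ = _
    abel
  · refine LinearMap.ext fun q => ?_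
    obtain ⟨x, rfl⟩ := Submodule.mkQ_surjective _ q
    have hx := h₃ x
    rw [← hψ, lift_map_Δ₁] at hx
    refine hx.unique (h.represents_lift_ν hβ hωβ x (e.symm (Submodule.Quotient.mk x)) ?_)
    rw [← he, e.apply_symm_apply]

/-- Twice the obstruction of a deformation extending `η₁` lies in the Massey bracket. -/
theorem StageInvariant.two_smul_mem_massey [CharZero K] (hA : 𝓛.StageInvariant μ A π η)
    (hμ : ∀ h, Submodule.Quotient.mk (μ h) = h)
    {j : 𝓛.H 2 ≃ₗ[K] (AugAlg.barCoalgebra s).F₀}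
    (hj : ∀ h, (j h : Module.Dual K (AugAlg.bar s).𝔪) = (firstOrder s π h).domRestrict _)
    {e : A.harrH K ≃ₗ[K] Module.Dual K (AugAlg.bar s).𝔪 ⧸ (AugAlg.barCoalgebra s).F₁}
    (he : ∀ h, e h = Submodule.Quotient.mk ((AugAlg.barEval s h).domRestrict (AugAlg.bar s).𝔪))
    {ω : A.harrH K →ₗ[K] 𝓛.H 3} (hω : 𝓛.IsObstruction η s ω) :
    ((2 : K) • ω) ∘ₗ e.symm.toLinearMap ∈
      (AugAlg.barCoalgebra s).massey (1 / 2) 𝓛 j.symm.toLinearMap := by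
  obtain ⟨β', h⟩ := 𝓛.exists_isLift s hA.isDeformation.twist_op
  refine HomLeibniz.two_smul_mem_massey hA.isDeformation hω he h fun x => ?_
  obtain ⟨c, rfl⟩ := j.surjective x
  have hc : (𝓛.componentM β' h.twist_op (j c)).1 = (μ c).1 := by
    funext l
    rw [hj, componentM, LinearMap.comp_apply, extZero_firstOrder hA.comp_eq, component_apply,
      contract_firstOrder h, hA.pushout_eq, contract_eval_eta₁]
    exact congrArg (μ c).1 (by funext i; fin_cases i <;> rfl)
  rw [hc, LinearEquiv.coe_coe, j.symm_apply_apply]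
  exact ⟨(μ c).2, hμ c⟩

end Main

section Normalization

variable [CharZero K] {F M : Type*} [AddCommGroup F] [Module K F] [AddCommGroup M] [Module K M]
  {Φ : FilteredCoalgebra K F} {a : Φ.F₀ →ₗ[K] 𝓛.H 2} {ω : M →ₗ[K] 𝓛.H 3} {f : F ⧸ Φ.F₁ →ₗ[K] M}

theorem half_smul_mem_massey (h : ((2 : K) • ω) ∘ₗ f ∈ Φ.massey (1 / 2) 𝓛 a) :
    ((1 / 2 : K) • ω) ∘ₗ f ∈ Φ.massey 1 𝓛 ((1 / 2 : K) • a) := by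
  have h2 : (1 / 2 : K) ≠ 0 := one_div_ne_zero two_ne_zero
  have := smul_mem_massey Φ h h2
  rwa [div_self h2, ← LinearMap.smul_comp, smul_smul,
    show (1 / 2 * (1 / 2) * 2 : K) = 1 / 2 by norm_num] at this

theorem four_smul_mem_massey {b : F ⧸ Φ.F₁ →ₗ[K] 𝓛.H 3}
    (h : b ∈ Φ.massey 1 𝓛 ((1 / 2 : K) • a)) : (2 * 2 : K) • b ∈ Φ.massey (1 / 2) 𝓛 a := by
  have := smul_mem_massey Φ h two_ne_zero
  rwa [smul_smul, mul_one_div_cancel two_ne_zero, one_smul] at this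

theorem eq_half_smul_comp {b : F ⧸ Φ.F₁ →ₗ[K] 𝓛.H 3}
    (h : (2 * 2 : K) • b = ((2 : K) • ω) ∘ₗ f) : b = ((1 / 2 : K) • ω) ∘ₗ f := by
  have h4 : b = (1 / 4 : K) • ((2 * 2 : K) • b) := by
    rw [smul_smul, show (1 / 4 * (2 * 2) : K) = 1 by norm_num, one_smul]
  rw [h4, h, ← LinearMap.smul_comp, smul_smul, show (1 / 4 * 2 : K) = 1 / 2 by norm_num]

end Normalization

end HomLeibniz

theorem mainTheorem1 {K : Type u} {L : Type v} [Field K] [IsAlgClosed K] [CharZero K]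
    [AddCommGroup L] [Module K L] (𝓛 : HomLeibniz K L) [FiniteDimensional K (𝓛.H 2)]
    (μ : 𝓛.H 2 →ₗ[K] 𝓛.Z 2) (hμ : ∀ h, Submodule.Quotient.mk (μ h) = h)
    {k : ℕ} {A : AugAlg.{u, max u v} K} {π : A →ₐ[K] 𝓛.C₁} {η : HomLeibniz.Op A L}
    (hη : 𝓛.IsStage μ k A π η)
    (s : A.harrH K →ₗ[K] A.harrZ K) (hs : ∀ h, Submodule.Quotient.mk (s h) = h) :
    ∃ (j : 𝓛.H 2 ≃ₗ[K] (AugAlg.barCoalgebra s).F₀)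
      (e : A.harrH K ≃ₗ[K] Module.Dual K (AugAlg.bar s).𝔪 ⧸ (AugAlg.barCoalgebra s).F₁),
      -- the canonical identifications `H = F₀` and `H^2_Harr(C_k, K) = F / F₁`
      (∀ (h : 𝓛.H 2) (z : (AugAlg.bar s).𝔪),
        (j h : Module.Dual K (AugAlg.bar s).𝔪) z = 𝓛.evalC₁ h (π (AugAlg.barProj s z))) ∧
      (∀ h : A.harrH K,
        e h = Submodule.Quotient.mk ((AugAlg.barEval s h).domRestrict (AugAlg.bar s).𝔪)) ∧
      -- the obstruction map `w_k` of `η_k` is well defined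
      (∃! ω, 𝓛.IsObstruction η s ω) ∧
      -- the bracket `[id]_F` with the defining equation `d ψ = (1/2) ν ∘ (ψ ⊗ ψ) ∘ Δ`
      (∀ ω, 𝓛.IsObstruction η s ω →
        ((2 : K) • ω) ∘ₗ e.symm.toLinearMap ∈
          (AugAlg.barCoalgebra s).massey (1 / 2) 𝓛 j.symm.toLinearMap) ∧
      (∀ b ∈ (AugAlg.barCoalgebra s).massey (1 / 2) 𝓛 j.symm.toLinearMap,
        ∃ η' ω', 𝓛.IsDeformation A η' ∧ HomLeibniz.pushout π η' = 𝓛.eta₁ μ ∧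
          𝓛.IsObstruction η' s ω' ∧ b = ((2 : K) • ω') ∘ₗ e.symm.toLinearMap) ∧
      -- the same in the normalization `d ψ = ν ∘ (ψ ⊗ ψ) ∘ Δ`, by the substitution `ψ ↦ (1/2) ψ`
      (∀ ω, 𝓛.IsObstruction η s ω →
        ((1 / 2 : K) • ω) ∘ₗ e.symm.toLinearMap ∈
          (AugAlg.barCoalgebra s).massey 1 𝓛 ((1 / 2 : K) • j.symm.toLinearMap)) ∧
      (∀ b ∈ (AugAlg.barCoalgebra s).massey 1 𝓛 ((1 / 2 : K) • j.symm.toLinearMap),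
        ∃ η' ω', 𝓛.IsDeformation A η' ∧ HomLeibniz.pushout π η' = 𝓛.eta₁ μ ∧
          𝓛.IsObstruction η' s ω' ∧ b = ((1 / 2 : K) • ω') ∘ₗ e.symm.toLinearMap) := by
  have hA := hη.stageInvariant
  obtain ⟨j, hj⟩ := hA.exists_equiv_F₀ s
  obtain ⟨e, he⟩ := AugAlg.exists_equiv_quotient_F₁ s
  refine ⟨j, e, fun h z => LinearMap.congr_fun (hj h) z, he,
    HomLeibniz.existsUnique_isObstruction s hA.isDeformation,
    fun ω hω => hA.two_smul_mem_massey hμ hj he hω,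
    fun b hb => hA.exists_of_mem_massey hμ hj he hb,
    fun ω hω => HomLeibniz.half_smul_mem_massey (hA.two_smul_mem_massey hμ hj he hω),
    fun b hb => ?_⟩
  obtain ⟨η', ω', h₁, h₂, h₃, h₄⟩ :=
    hA.exists_of_mem_massey hμ hj he (HomLeibniz.four_smul_mem_massey hb)
  exact ⟨η', ω', h₁, h₂, h₃, HomLeibniz.eq_half_smul_comp h₄⟩
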